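/- **Model.** For $n\in\mathbb N$ and $p_0,p_1,\rho\in[0,1]$, let $\theta\in\{0,1\}^n$ have i.i.d. $\mathrm{Ber}(\rho)$ entries and, given $\theta$, let $Y=(Y_{ij})_{i<j}$ be independent with $Y_{ij}\sim\mathrm{Ber}(p_0+(p_1-p_0)\theta_i\theta_j)$. Let $\mathbb P_{p_0,p_1,\rho,n}$ be the law of $Y$, let $\mathbb Q_{p_0,n}$ be the law of the Erdős–Rényi graph on $[n]$ with edge probability $p_0$, and put $\Theta=(p_1-p_0)\theta\theta^\top\in\mathbb R^{n\times n}$ and $\lambda=(p_1-p_0)/\sqrt{p_0(1-p_0)}$. For sequences, $a_n\ll b_n$ means $a_n/b_n\to0$. **Algorithms.** An algorithm is a sequence of randomized programs, one for each problem in the sequence (it may depend on the size and on the parameters, which are known). Each program is a straight-line sequence of instructions that read an input bit, load a real constant, toss an independent coin of a prescribed bias, or apply $+,-,\times,\div$ or a comparison $\le$ to earlier results; its running time is the number of instructions. An estimator outputs a matrix $\mathcal X=\mathcal X(Y)\in\mathbb R^{n\times n}$; it achieves *weak recovery* if there is a constant $c>0$ such that, for all large $n$, $$\mathbb E\left[\frac{\langle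 \mathcal X,\Theta\rangle}{\|\mathcal X\|_F\|\Theta\|_F}\right]\ge c$$ (the quotient being $0$ if $\mathcal X=0$ or $\Theta=0$), the expectation being over $\theta$, $Y$ and the coins. A test outputs $0$ or $1$; its error between $P$ and $Q$ is $Q(\text{output }1)+P(\text{output }0)$. It achieves strong detection if the error tends to $0$, and weak detection if the error is at most $1-\varepsilon$ for some fixed $\varepsilon>0$ and all large indices. **Low-degree heuristic.** Let $\mathsf{Adv}_{\le D}(P;Q)=\sup_f \mathbb E_P[f]/\sqrt{\mathbb E_Q[f^2]}$ over real polynomials $f$ of degree at most $D$ in the observed variables. The low-degree heuristic for a sequence of pairs $P_k,Q_k$ of laws on $\{0,1\}^{d_k}$ and degrees $D_k$ says: (1) if $\mathsf{Adv}_{\le D_k}(P_k;Q_k)=O(1)$, then there is a constant $C>0$ such that no algorithm with running time at most $d_k^{D_k/(C\log d_k)}$ achieves strong detection; (2) if $\mathsf{Adv}_{\le D_k}(P_k;Q_k)=1+o(1)$, then there is a constant $C>0$ such that no algorithm with running time at most $d_k^{D_k/(C\log d_k)}$ achieves weak detection. The *hidden informative sample problem* with $M$ samples built from $P,Q$ is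 to distinguish $M$ independent samples from $Q$ from $M$ independent samples of which a uniformly random one has law $P$ and the others have law $Q$. **Theorem.** Assume the low-degree heuristic for the hidden informative sample problems built from $\mathbb P_{p_{0,k},p_{1,k},\rho_k,m_k}$ and $\mathbb Q_{p_{0,k},m_k}$, for all sequences of sizes $m_k\to\infty$ and of parameters satisfying condition $(*)$ below with $n=m_k$, all degrees $D_k$, and all numbers $M_k$ of samples with $\Delta_k\ll M_k\le\binom{m_k}{2}\Delta_k$, where $\Delta_k>1$ and $\mathsf{Adv}_{\le D_k}(\mathbb P_{p_{0,k},p_{1,k},\rho_k,m_k};\mathbb Q_{p_{0,k},m_k})^2\le\Delta_k$. Let $p_0=p_{0,n}$, $p_1=p_{1,n}$, $\rho=\rho_n$ satisfy $0\le p_0\le p_1\le 1$, $0\le\rho\le1$ and, as $n\to\infty$, $$\frac1n\ll p_0\le p_1\ll1,\qquad \frac{(\log n)^2}{\sqrt n}\ll\rho\ll\frac1{\log n},\qquad \lambda^2\rho^2n\ll\frac1{(\log n)^2}.\tag{$*$}$$ Then for every algorithm that, given $Y\sim\mathbb P_{p_0,p_1,\rho,n}$, achieves weak recovery, there is a constant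 $c>0$ such that for all sufficiently large $n$ its running time is at least $\exp\!\big(c\,\lambda^{-2}(\log n)^{-4}\big)$. -/

import Mathlib

open Filter Topology Asymptotics

noncomputable section

namespace PlantedDenseSubgraph

/-! ## Laws on finite Boolean cubes

A law on a finite type `α` is given by its weights `α → ℝ`. -/

/-- Weight of the outcome `b` under `Ber(q)`. -/
def bern (q : ℝ) (b : Bool) : ℝ := if b then q else 1 - q

/-- Law of a vector of independent bits, the `i`-th one being `Ber(q i)`. -/
def prodBern {ι : Type} [Fintype ι] (q : ι → ℝ) (x : ι → Bool) : ℝ := ∏ i, bern (q i) (x i)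

/-- A bit read as a real number. -/
def bit (b : Bool) : ℝ := if b then 1 else 0

/-- Expectation of `f` under the law with weights `P`. -/
def expect {α : Type} [Fintype α] (P : α → ℝ) (f : α → ℝ) : ℝ := ∑ x, P x * f x

/-! ## Algorithms: randomized real-arithmetic programs

The input is a 0/1 vector. An algorithm for one input size is a straight-line program; every
instruction costs one unit of time. Programs may depend on the size (and on the parameters of the
model, which are known). -/

/-- Instructions; `j` and `k` are the times of earlier instructions whose results are used. -/
inductive Instr (ι : Type) : Type
  | const (a : ℝ)
  | input (i : ι)
  | coin (q : unitInterval)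
  | add (j k : ℕ)
  | sub (j k : ℕ)
  | mul (j k : ℕ)
  | div (j k : ℕ)
  | le (j k : ℕ)

namespace Instr

variable {ι : Type}

/-- Result of an instruction, given the input `x`, the outcome `b` of the coin attached to this
instruction and the results `mem` of the earlier instructions. -/
def eval (x : ι → Bool) (b : Bool) (mem : ℕ → ℝ) : Instr ι → ℝ
  | const a => a
  | input i => bit (x i)
  | coin _ => bit b
  | add j k => mem j + mem k
  | sub j k => mem j - mem k
  | mul j k => mem j * mem k
  | div j k => mem j / mem k
  | le j k => if mem j ≤ mem k then 1 else 0

/-- Bias of the coin attached to an instruction (instructions that toss no coin have bias `0`). -/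
def bias : Instr ι → ℝ
  | coin q => (q : ℝ)
  | _ => 0

end Instr

/-- A randomized program: a sequence of `time` instructions. -/
structure Program (ι : Type) where
  /-- number of instructions executed -/
  time : ℕ
  instr : Fin time → Instr ι

namespace Program

variable {ι : Type}

/-- Result of the instruction executed at time `t`, on input `x` and coin outcomes `ω`.
References to something that has not been computed return `0`. -/
def result (C : Program ι) (x : ι → Bool) (ω : Fin C.time → Bool) (t : ℕ) : ℝ :=
  if h : t < C.time then
    (C.instr ⟨t, h⟩).eval x (ω ⟨t, h⟩) (fun j => if _hj : j < t then C.result x ω j else 0)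
  else 0
termination_by t

/-- Law of the (independent) coin tosses of the program. -/
def coinLaw (C : Program ι) : (Fin C.time → Bool) → ℝ := prodBern fun t => (C.instr t).bias

end Program

/-- A test: a program together with the place of its answer. It outputs `1` if this result is `1`,
and `0` otherwise. -/
structure Test (ι : Type) where
  prog : Program ι
  out : ℕ

/-- Probability that the test outputs `1` when its input has law `P`. -/
def Test.acceptProb {ι : Type} [Fintype ι] [DecidableEq ι] (A : Test ι) (P : (ι → Bool) → ℝ) : ℝ :=
  expect P fun x => expect A.prog.coinLaw fun ω => if A.prog.result x ω A.out = 1 then 1 else 0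

/-- Probability that the test outputs `0` when its input has law `P`. -/
def Test.rejectProb {ι : Type} [Fintype ι] [DecidableEq ι] (A : Test ι) (P : (ι → Bool) → ℝ) : ℝ :=
  expect P fun x => expect A.prog.coinLaw fun ω => if A.prog.result x ω A.out = 1 then 0 else 1

/-- Sum of the type-I and type-II errors of a test between `P` (planted) and `Q` (null). -/
def Test.error {ι : Type} [Fintype ι] [DecidableEq ι] (A : Test ι) (P Q : (ι → Bool) → ℝ) : ℝ :=
  A.acceptProb Q + A.rejectProb P

/-! ## Low-degree advantage and the low-degree heuristic -/

/-- `Adv_{≤ D}(P; Q)`: the supremum of `E_P[f] / √(E_Q[f²])` over real polynomials `f` of degree at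
most `D`, in `[0, ∞]` (`f = 1` shows that negative values of `E_P[f]` play no role). -/
def adv {ι : Type} [Fintype ι] [DecidableEq ι] (P Q : (ι → Bool) → ℝ) (D : ℕ) : ENNReal :=
  ⨆ f : {f : MvPolynomial ι ℝ // f.totalDegree ≤ D},
    ENNReal.ofReal (expect P fun x => MvPolynomial.eval (fun i => bit (x i)) f.1) /
      ENNReal.ofReal
        (√(expect Q fun x => (MvPolynomial.eval (fun i => bit (x i)) f.1) ^ 2))

/-- The running time `N ^ (D / (C log N))`, `N` being the dimension of the observation. -/
def timeBound (N D : ℕ) (C : ℝ) : ℝ := (N : ℝ) ^ ((D : ℝ) / (C * Real.log N))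

/-- The low-degree heuristic for the sequence of testing problems between `P k` and `Q k`
(observations in `{0,1}^{ι k}`) and the degrees `D k`:
(1) if `Adv_{≤ D} = O(1)`, then for some constant `C` no algorithm with running time
`N ^ (D / (C log N))` achieves strong detection;
(2) if `Adv_{≤ D} = 1 + o(1)`, then for some constant `C` no algorithm with running time
`N ^ (D / (C log N))` achieves weak detection. -/
def LowDegreeHeuristic (ι : ℕ → Type) [∀ k, Fintype (ι k)] [∀ k, DecidableEq (ι k)]
    (P Q : ∀ k, (ι k → Bool) → ℝ) (D : ℕ → ℕ) : Prop :=
  ((∃ B : NNReal, ∀ᶠ k in atTop, adv (P k) (Q k) (D k) ≤ B) →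
    ∃ C : ℝ, 0 < C ∧ ¬ ∃ A : ∀ k, Test (ι k),
      (∀ k, ((A k).prog.time : ℝ) ≤ timeBound (Fintype.card (ι k)) (D k) C) ∧
      Tendsto (fun k => (A k).error (P k) (Q k)) atTop (𝓝 0)) ∧
  (Tendsto (fun k => adv (P k) (Q k) (D k)) atTop (𝓝 1) →
    ∃ C : ℝ, 0 < C ∧ ¬ ∃ A : ∀ k, Test (ι k),
      (∀ k, ((A k).prog.time : ℝ) ≤ timeBound (Fintype.card (ι k)) (D k) C) ∧
      ∃ ε : ℝ, 0 < ε ∧ ∀ᶠ k in atTop, (A k).error (P k) (Q k) ≤ 1 - ε)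

/-! ## The hidden informative sample problem -/

/-- Null law: `M` independent samples from `Q`. -/
def hiddenNull {ι : Type} [Fintype ι] (M : ℕ) (Q : (ι → Bool) → ℝ) (Y : Fin M × ι → Bool) : ℝ :=
  ∏ j, Q fun i => Y (j, i)

/-- Planted law: a uniformly random one of the `M` independent samples comes from `P`, the others
from `Q`. -/
def hiddenPlanted {ι : Type} [Fintype ι] (M : ℕ) (P Q : (ι → Bool) → ℝ)
    (Y : Fin M × ι → Bool) : ℝ :=
  (M : ℝ)⁻¹ * ∑ κ : Fin M, ∏ j, if j = κ then P (fun i => Y (j, i)) else Q (fun i => Y (j, i))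

/-! ## The planted dense subgraph model -/

/-- The pairs `i < j` of vertices in `[n]`. -/
abbrev Edge (n : ℕ) : Type := {e : Fin n × Fin n // e.1 < e.2}

/-- Conditional law of the graph given the planted signal `θ`: the pair `i < j` is an edge with
probability `p₀ + (p₁ - p₀) θᵢ θⱼ`, independently. -/
def graphLawGiven (p₀ p₁ : ℝ) {n : ℕ} (θ : Fin n → Bool) : (Edge n → Bool) → ℝ :=
  prodBern fun e => p₀ + (p₁ - p₀) * (bit (θ e.1.1) * bit (θ e.1.2))

/-- Law of the observed graph, with `θ` having i.i.d. `Ber(ρ)` entries. -/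
def plantedLaw (p₀ p₁ ρ : ℝ) (n : ℕ) (Y : Edge n → Bool) : ℝ :=
  expect (prodBern fun _ : Fin n => ρ) fun θ => graphLawGiven p₀ p₁ θ Y

/-- Law of an Erdős–Rényi graph with edge probability `p₀`. -/
def nullLaw (p₀ : ℝ) (n : ℕ) : (Edge n → Bool) → ℝ := prodBern fun _ => p₀

/-- The signal `Θ = (p₁ - p₀) θ θᵀ`. -/
def signal (p₀ p₁ : ℝ) {n : ℕ} (θ : Fin n → Bool) : Matrix (Fin n) (Fin n) ℝ :=
  fun i j => (p₁ - p₀) * (bit (θ i) * bit (θ j))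

/-- Frobenius inner product. -/
def frobInner {n : ℕ} (X Z : Matrix (Fin n) (Fin n) ℝ) : ℝ := ∑ i, ∑ j, X i j * Z i j

/-- Frobenius norm. -/
def frobNorm {n : ℕ} (X : Matrix (Fin n) (Fin n) ℝ) : ℝ := √(frobInner X X)

/-- Normalized correlation of two matrices (`0` if one of them vanishes). -/
def corr {n : ℕ} (X Z : Matrix (Fin n) (Fin n) ℝ) : ℝ :=
  frobInner X Z / (frobNorm X * frobNorm Z)

/-- An estimator on graphs with vertex set `[n]`: a program together with the places of the entries
of its output, a real `n × n` matrix. -/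
structure Estimator (n : ℕ) where
  prog : Program (Edge n)
  out : Fin n → Fin n → ℕ

/-- Output of the estimator on the graph `Y` and the coin outcomes `ω`. -/
def Estimator.output {n : ℕ} (A : Estimator n) (Y : Edge n → Bool)
    (ω : Fin A.prog.time → Bool) : Matrix (Fin n) (Fin n) ℝ :=
  fun i j => A.prog.result Y ω (A.out i j)

/-- `E[⟨𝒳, Θ⟩ / (‖𝒳‖ ‖Θ‖)]`, over the signal, the graph and the coins of the estimator. -/
def Estimator.meanCorr {n : ℕ} (A : Estimator n) (p₀ p₁ ρ : ℝ) : ℝ :=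
  expect (prodBern fun _ : Fin n => ρ) fun θ =>
    expect (graphLawGiven p₀ p₁ θ) fun Y =>
      expect A.prog.coinLaw fun ω => corr (A.output Y ω) (signal p₀ p₁ θ)

/-- Weak recovery: the mean correlation is bounded below by a positive constant. -/
def WeakRecovery (p₀ p₁ ρ : ℕ → ℝ) (A : ∀ n, Estimator n) : Prop :=
  ∃ c : ℝ, 0 < c ∧ ∀ᶠ n in atTop, c ≤ (A n).meanCorr (p₀ n) (p₁ n) (ρ n)

/-- The signal-to-noise ratio `λ = (p₁ - p₀) / √(p₀ (1 - p₀))`. -/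
def snr (p₀ p₁ : ℝ) : ℝ := (p₁ - p₀) / √(p₀ * (1 - p₀))

/-- Parameters of planted dense subgraph problems on `m k` vertices, `k = 0, 1, 2, …`, with
`m → ∞`, `0 ≤ p₀ ≤ p₁ ≤ 1`, `0 ≤ ρ ≤ 1`, `1/m ≪ p₀`, `p₁ ≪ 1`,
`(log m)² / √m ≪ ρ ≪ 1 / log m` and `λ² ρ² m ≪ (log m)⁻²`. -/
structure Regime (m : ℕ → ℕ) (p₀ p₁ ρ : ℕ → ℝ) : Prop where
  size : Tendsto m atTop atTop
  p₀_nonneg : ∀ k, 0 ≤ p₀ k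
  p₀_le_p₁ : ∀ k, p₀ k ≤ p₁ k
  p₁_le_one : ∀ k, p₁ k ≤ 1
  ρ_nonneg : ∀ k, 0 ≤ ρ k
  ρ_le_one : ∀ k, ρ k ≤ 1
  p₀_large : (fun k => 1 / (m k : ℝ)) =o[atTop] p₀
  p₁_small : p₁ =o[atTop] fun _ => (1 : ℝ)
  ρ_large : (fun k => Real.log (m k) ^ 2 / √(m k : ℝ)) =o[atTop] ρ
  ρ_small : ρ =o[atTop] fun k => 1 / Real.log (m k)
  snr_small : (fun k => snr (p₀ k) (p₁ k) ^ 2 * ρ k ^ 2 * (m k : ℝ))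
    =o[atTop] fun k => 1 / Real.log (m k) ^ 2

/-- The low-degree heuristic holds for the hidden informative sample problems built from the planted
dense subgraph model and the Erdős–Rényi model, for all parameters in the regime above, all degrees
`D` and all numbers `M` of samples with `Δ ≪ M ≤ N Δ`, where `Adv_{≤ D}² ≤ Δ` for the original
testing problem and `N` is the dimension of one sample. -/
def HiddenSampleHeuristic : Prop :=
  ∀ (m M D : ℕ → ℕ) (p₀ p₁ ρ Δ : ℕ → ℝ), Regime m p₀ p₁ ρ →
    (∀ k, 1 < Δ k) →
    (∀ᶠ k in atTop, adv (plantedLaw (p₀ k) (p₁ k) (ρ k) (m k)) (nullLaw (p₀ k) (m k)) (D k) ^ 2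
      ≤ ENNReal.ofReal (Δ k)) →
    Δ =o[atTop] (fun k => (M k : ℝ)) →
    (∀ᶠ k in atTop, (M k : ℝ) ≤ (Fintype.card (Edge (m k)) : ℝ) * Δ k) →
    LowDegreeHeuristic (fun k => Fin (M k) × Edge (m k))
      (fun k => hiddenPlanted (M k) (plantedLaw (p₀ k) (p₁ k) (ρ k) (m k)) (nullLaw (p₀ k) (m k)))
      (fun k => hiddenNull (M k) (nullLaw (p₀ k) (m k))) D

end PlantedDenseSubgraph

end

/-! The proof is a reduction: a fast weak recovery algorithm would give a fast weak detection test
for a hidden informative sample problem whose low-degree advantage is `1 + o(1)`. Write `λ` for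
`snr` and `R = nρ`.

From estimation to testing. Take a graph with densities `2p₀, 2p₁` and keep each edge with
probability `1/2`. The kept graph `Y` has densities `p₀, p₁`, and given `θ` and `Y` the pairs
outside `Y` are still independent, with odds-type densities `p/(1-p)` (`expect_thinning`). So the
estimator can be run on `Y` and its output correlated with the remaining edges, which are fresh
noise. Large entries of the output are truncated to make exponential moments available. Under the
null law a Chernoff bound gives false alarm probability at most `e^{-F}`, with `F` of order `λR ·
min(ρ√n, λR)` (`expect_scanAccept_le`). Under the planted law, correlation `c` of the estimator
forces acceptance with probability at least `c/8` for large `n` (`corr_le_scanAccept`,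
`Estimator.exists_test`).

Why samples are hidden. The squared low-degree advantage `e^L` of the original problem may be large,
so this test contradicts nothing yet. Hiding the informative sample among `M` samples divides the
excess of the squared advantage by `M` (`lowDegreeSum_hiddenPlanted_le`), while testing every sample
multiplies the false alarms by `M` (`Test.exists_hidden_test`). A contradiction needs `e^L ≪ M ≪
e^F`.

Why there is room. The Fourier expansion and moments of the overlap of two independent signals give
`L = O(λ²n²ρ⁴ + 1)` when `λ²` times the degree is small (`lowDegreeSum_plantedLaw_le`). Weak
recovery is information-theoretically impossible unless `λR → ∞` (`meanCorr_pow_four_le`), hence `F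
→ ∞`, and the regime then yields `L ≤ F/4` (`eventually_advExponent_le`). With degree `⌊λ⁻²(log
n)⁻⁴⌋`, both `L` and `log n` are negligible against the degree, so the time budget `e^{D/C}` of the
heuristic pays for `M` runs of any estimator of time `e^{o(D)}`. -/

noncomputable section

namespace PlantedDenseSubgraph

/-! ## Expectations under laws on finite types -/

/-- The weights `P` form a probability law. -/
structure IsLaw {α : Type} [Fintype α] (P : α → ℝ) : Prop where
  nonneg : ∀ x, 0 ≤ P x
  sum_eq_one : ∑ x, P x = 1

section Expect

variable {α β : Type} [Fintype α] [Fintype β] {P : α → ℝ} {Q : β → ℝ}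

lemma expect_mono (hP : IsLaw P) {f g : α → ℝ} (h : ∀ x, f x ≤ g x) :
    expect P f ≤ expect P g :=
  Finset.sum_le_sum fun x _ => mul_le_mul_of_nonneg_left (h x) (hP.nonneg x)

lemma expect_nonneg (hP : IsLaw P) {f : α → ℝ} (h : ∀ x, 0 ≤ f x) : 0 ≤ expect P f :=
  Finset.sum_nonneg fun x _ => mul_nonneg (hP.nonneg x) (h x)

lemma expect_add (P : α → ℝ) (f g : α → ℝ) :
    expect P (fun x => f x + g x) = expect P f + expect P g := by
  simp [expect, mul_add, Finset.sum_add_distrib]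

lemma expect_sub (P : α → ℝ) (f g : α → ℝ) :
    expect P (fun x => f x - g x) = expect P f - expect P g := by
  simp [expect, mul_sub, Finset.sum_sub_distrib]

lemma expect_const_mul (P : α → ℝ) (c : ℝ) (f : α → ℝ) :
    expect P (fun x => c * f x) = c * expect P f := by
  simp only [expect, Finset.mul_sum]
  exact Finset.sum_congr rfl fun x _ => by ring

lemma expect_mul_const (P : α → ℝ) (c : ℝ) (f : α → ℝ) :
    expect P (fun x => f x * c) = expect P f * c := by
  simp only [expect, Finset.sum_mul]
  exact Finset.sum_congr rfl fun x _ => by ring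

lemma expect_const (hP : IsLaw P) (c : ℝ) : expect P (fun _ => c) = c := by
  simp [expect, ← Finset.sum_mul, hP.sum_eq_one]

lemma expect_sum {κ : Type*} (P : α → ℝ) (s : Finset κ) (f : κ → α → ℝ) :
    expect P (fun x => ∑ i ∈ s, f i x) = ∑ i ∈ s, expect P (f i) := by
  simp only [expect, Finset.mul_sum]
  exact Finset.sum_comm

lemma expect_comm (P : α → ℝ) (Q : β → ℝ) (f : α → β → ℝ) :
    expect P (fun x => expect Q fun y => f x y) = expect Q fun y => expect P fun x => f x y := by
  simp only [expect, Finset.mul_sum]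
  rw [Finset.sum_comm]
  exact Finset.sum_congr rfl fun x _ => Finset.sum_congr rfl fun y _ => by ring

lemma expect_le_of_le (hP : IsLaw P) {f : α → ℝ} {c : ℝ} (h : ∀ x, f x ≤ c) :
    expect P f ≤ c :=
  (expect_mono hP h).trans_eq (expect_const hP c)

/-- Cauchy–Schwarz. -/
lemma sq_expect_mul_le (hP : IsLaw P) (f g : α → ℝ) :
    expect P (fun x => f x * g x) ^ 2 ≤
      expect P (fun x => f x ^ 2) * expect P fun x => g x ^ 2 := by
  refine Finset.sum_sq_le_sum_mul_sum_of_sq_le_mul _ (fun x _ => mul_nonneg (hP.nonneg x)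
    (sq_nonneg _)) (fun x _ => mul_nonneg (hP.nonneg x) (sq_nonneg _)) fun x _ => le_of_eq (by ring)

lemma sq_expect_le (hP : IsLaw P) (f : α → ℝ) :
    expect P f ^ 2 ≤ expect P fun x => f x ^ 2 := by
  simpa [expect_const hP] using sq_expect_mul_le hP f fun _ => 1

end Expect

/-! ## Products of Bernoulli laws -/

lemma bern_nonneg {q : ℝ} (h0 : 0 ≤ q) (h1 : q ≤ 1) (b : Bool) : 0 ≤ bern q b := by
  cases b <;> simp [bern, h0, h1]

section ProdBern

variable {ι : Type} [Fintype ι] [DecidableEq ι]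

/-- Expectation of a product of functions of the single bits. -/
lemma expect_prodBern_prod (q : ι → ℝ) (f : ι → Bool → ℝ) :
    expect (prodBern q) (fun x => ∏ i, f i (x i)) =
      ∏ i, (q i * f i true + (1 - q i) * f i false) := by
  have h : ∀ i, q i * f i true + (1 - q i) * f i false = ∑ b : Bool, bern (q i) b * f i b := by
    intro i; simp [bern]
  simp only [h, expect, prodBern, ← Finset.prod_mul_distrib]
  rw [Finset.prod_univ_sum, Fintype.piFinset_univ]

lemma isLaw_prodBern {q : ι → ℝ} (h0 : ∀ i, 0 ≤ q i) (h1 : ∀ i, q i ≤ 1) :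
    IsLaw (prodBern q) where
  nonneg x := Finset.prod_nonneg fun i _ => bern_nonneg (h0 i) (h1 i) _
  sum_eq_one := by
    simpa [expect] using expect_prodBern_prod q fun _ _ => 1

lemma expect_prodBern_prod_finset (q : ι → ℝ) (s : Finset ι) (f : ι → Bool → ℝ) :
    expect (prodBern q) (fun x => ∏ i ∈ s, f i (x i)) =
      ∏ i ∈ s, (q i * f i true + (1 - q i) * f i false) := by
  have h1 : ∀ x : ι → Bool, ∏ i ∈ s, f i (x i) = ∏ i, (if i ∈ s then f i (x i) else 1) := by
    intro x; simp [Finset.prod_ite_mem]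
  simp only [h1]
  rw [expect_prodBern_prod q fun i b => if i ∈ s then f i b else 1, ← Finset.prod_subset
    (Finset.subset_univ s)]
  · exact Finset.prod_congr rfl fun i hi => by simp [hi]
  · intro i _ hi; simp [hi]

lemma expect_prodBern_single (q : ι → ℝ) (i : ι) (f : Bool → ℝ) :
    expect (prodBern q) (fun x => f (x i)) = q i * f true + (1 - q i) * f false := by
  simpa using expect_prodBern_prod_finset q {i} fun _ => f

lemma expect_prodBern_pair (q : ι → ℝ) {i j : ι} (hij : i ≠ j) (f g : Bool → ℝ) :
    expect (prodBern q) (fun x => f (x i) * g (x j)) =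
      (q i * f true + (1 - q i) * f false) * (q j * g true + (1 - q j) * g false) := by
  have := expect_prodBern_prod_finset q {i, j} fun k => if k = i then f else g
  simpa [Finset.prod_pair hij, hij.symm] using this

/-- Variance of a linear combination of independent bits. -/
lemma expect_prodBern_linear_sq (q w : ι → ℝ) :
    expect (prodBern q) (fun x => (∑ i, w i * (bit (x i) - q i)) ^ 2) =
      ∑ i, w i ^ 2 * (q i * (1 - q i)) := by
  simp only [sq, Finset.sum_mul_sum, expect_sum]
  refine Finset.sum_congr rfl fun i _ => ?_
  rw [Finset.sum_eq_single i]
  · rw [expect_prodBern_single q i fun b => w i * (bit b - q i) * (w i * (bit b - q i))]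
    simp [bit]; ring
  · intro j _ hj
    rw [expect_prodBern_pair q hj.symm (fun b => w i * (bit b - q i)) fun b => w j * (bit b - q j)]
    simp only [bit, if_true, Bool.false_eq_true, if_false]; ring
  · simp

/-- Image of a product law under a coordinatewise map. -/
lemma sum_prod_comp {κ γ δ : Type} [Fintype κ] [DecidableEq κ] [Fintype γ] [Fintype δ]
    [DecidableEq δ]
    (w : κ → γ → ℝ) (φ : γ → δ) (F : (κ → δ) → ℝ) :
    ∑ x : κ → γ, (∏ i, w i (x i)) * F (fun i => φ (x i)) =
      ∑ u : κ → δ, (∏ i, ∑ c : γ, if φ c = u i then w i c else 0) * F u := by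
  have h : ∀ u : κ → δ, (∏ i, ∑ c : γ, if φ c = u i then w i c else 0) =
      ∑ x : κ → γ, if (fun i => φ (x i)) = u then ∏ i, w i (x i) else 0 := by
    intro u
    rw [Finset.prod_univ_sum, Fintype.piFinset_univ]
    refine Finset.sum_congr rfl fun x _ => ?_
    split_ifs with hx
    · exact Finset.prod_congr rfl fun i _ => by simp [← hx]
    · obtain ⟨i, hi⟩ := Function.ne_iff.1 hx
      exact Finset.prod_eq_zero (Finset.mem_univ i) (by simp [hi])
  simp only [h, Finset.sum_mul]
  rw [Finset.sum_comm]
  refine Finset.sum_congr rfl fun x _ => ?_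
  simp [ite_mul]

end ProdBern

/-! ## Fourier expansion on the biased cube and the low-degree advantage -/

section Fourier

variable {ι : Type} [Fintype ι] [DecidableEq ι]

/-- The orthonormal characters of the product of `Ber(q)` laws. -/
def chi {ι : Type} (q : ℝ) (s : Finset ι) (x : ι → Bool) : ℝ :=
  ∏ i ∈ s, (bit (x i) - q) / √(q * (1 - q))

lemma sqrt_bern_variance_pos {q : ℝ} (h0 : 0 < q) (h1 : q < 1) : 0 < √(q * (1 - q)) :=
  Real.sqrt_pos.2 (mul_pos h0 (sub_pos.2 h1))

/-- By independence the expectation factorizes: a coordinate in exactly one of the two sets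
contributes the mean `0`, a coordinate in both contributes the variance `1`. -/
lemma expect_chi_mul_chi {q : ℝ} (h0 : 0 < q) (h1 : q < 1) (s t : Finset ι) :
    expect (prodBern fun _ : ι => q) (fun x => chi q s x * chi q t x) = if s = t then 1 else 0 := by
  have hσ := sqrt_bern_variance_pos h0 h1
  have hσ2 : √(q * (1 - q)) ^ 2 = q * (1 - q) :=
    Real.sq_sqrt (mul_pos h0 (sub_pos.2 h1)).le
  set σ := √(q * (1 - q)) with hσd
  let c : Bool → ℝ := fun b => (bit b - q) / σ
  have hprod : ∀ x : ι → Bool, chi q s x * chi q t x =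
      ∏ i, ((if i ∈ s then c (x i) else 1) * (if i ∈ t then c (x i) else 1)) := by
    intro x
    rw [Finset.prod_mul_distrib, Finset.prod_ite_mem, Finset.prod_ite_mem]
    simp [chi, c, ← hσd]
  simp only [hprod]
  rw [expect_prodBern_prod (fun _ => q)
    fun i b => (if i ∈ s then c b else 1) * (if i ∈ t then c b else 1)]
  have hc1 : q * c true + (1 - q) * c false = 0 := by
    simp only [c, bit]; field_simp; simp; ring
  have hc2 : q * (c true * c true) + (1 - q) * (c false * c false) = 1 := by
    have : q * (c true * c true) + (1 - q) * (c false * c false) = q * (1 - q) / σ ^ 2 := by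
      simp only [c, bit]; field_simp; simp; ring
    rw [this, hσ2, div_self (mul_pos h0 (sub_pos.2 h1)).ne']
  split_ifs with hst
  · subst hst
    refine Finset.prod_eq_one fun i _ => ?_
    by_cases hi : i ∈ s
    · simpa [hi] using hc2
    · simp [hi]
  · have : ∃ i, ¬ (i ∈ s ↔ i ∈ t) := by
      by_contra h
      push Not at h
      exact hst (Finset.ext h)
    obtain ⟨i, hi⟩ := this
    refine Finset.prod_eq_zero (Finset.mem_univ i) ?_
    by_cases his : i ∈ s
    · have hit : i ∉ t := fun h => hi (by simp [his, h])
      simpa [his, hit] using hc1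
    · have hit : i ∈ t := by by_contra h; exact hi (by simp [his, h])
      simpa [his, hit] using hc1

lemma expect_chi (q : ℝ) (d : ι → ℝ) (s : Finset ι) :
    expect (prodBern fun i => q + d i) (chi q s) = ∏ i ∈ s, d i / √(q * (1 - q)) := by
  have := expect_prodBern_prod_finset (fun i => q + d i) s
    fun _ b => (bit b - q) / √(q * (1 - q))
  unfold chi
  rw [this]
  refine Finset.prod_congr rfl fun i _ => ?_
  simp only [bit, if_true, Bool.false_eq_true, if_false]
  ring

/-- A polynomial of degree at most `D` is, on the cube, a combination of characters of degree at
most `D`. -/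
lemma exists_chi_expansion {q : ℝ} (h0 : 0 < q) (h1 : q < 1) {D : ℕ} (f : MvPolynomial ι ℝ)
    (hf : f.totalDegree ≤ D) :
    ∃ a : Finset ι → ℝ, ∀ x : ι → Bool, MvPolynomial.eval (fun i => bit (x i)) f =
      ∑ s with s.card ≤ D, a s * chi q s x := by
  have hσ := sqrt_bern_variance_pos h0 h1
  set σ := √(q * (1 - q)) with hσd
  refine ⟨fun s => ∑ d ∈ f.support, f.coeff d *
    (if s ⊆ d.support then σ ^ s.card * q ^ (d.support \ s).card else 0), fun x => ?_⟩
  rw [MvPolynomial.eval_eq]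
  simp only [Finset.sum_mul]
  rw [Finset.sum_comm]
  refine Finset.sum_congr rfl fun d hd => ?_
  -- On bits every positive power equals the bit itself, so only the support of the monomial
  -- matters; writing the bit as `σ · (bit - q)/σ + q` and expanding gives characters of subsets of
  -- the support.
  have hmon : ∏ i ∈ d.support, bit (x i) ^ d i =
      ∏ i ∈ d.support, (σ * ((bit (x i) - q) / σ) + q) := by
    refine Finset.prod_congr rfl fun i hi => ?_
    have hi' : d i ≠ 0 := Finsupp.mem_support_iff.1 hi
    rw [mul_div_cancel₀ _ hσ.ne', sub_add_cancel]
    cases x i <;> simp [bit, hi']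
  have hcard : d.support.card ≤ D := by
    refine le_trans ?_ ((MvPolynomial.le_totalDegree hd).trans hf)
    rw [Finsupp.sum, Finset.card_eq_sum_ones]
    exact Finset.sum_le_sum fun i hi => Nat.one_le_iff_ne_zero.2 (Finsupp.mem_support_iff.1 hi)
  rw [hmon, Finset.prod_add, Finset.mul_sum]
  have hsub : d.support.powerset ⊆ Finset.univ.filter fun s : Finset ι => s.card ≤ D := by
    intro s hs
    simp only [Finset.mem_filter, Finset.mem_univ, true_and]
    exact (Finset.card_le_card (Finset.mem_powerset.1 hs)).trans hcard
  rw [← Finset.sum_subset hsub]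
  · refine Finset.sum_congr rfl fun s hs => ?_
    rw [if_pos (Finset.mem_powerset.1 hs), Finset.prod_mul_distrib]
    simp only [chi, Finset.prod_const, ← hσd]
    ring
  · intro s _ hs
    rw [if_neg (fun h => hs (Finset.mem_powerset.2 h))]
    simp

/-- Sum of the squared expectations of the characters of degree at most `D`. -/
def lowDegreeSum (q : ℝ) (P : (ι → Bool) → ℝ) (D : ℕ) : ℝ :=
  ∑ s : Finset ι with s.card ≤ D, expect P (chi q s) ^ 2

/-- Expand the polynomial in orthonormal characters: the denominator becomes the norm of the
coefficient vector, and Cauchy–Schwarz bounds the ratio. Only this direction is needed. -/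
lemma adv_sq_le {q : ℝ} (h0 : 0 < q) (h1 : q < 1) (P : (ι → Bool) → ℝ) (D : ℕ) :
    adv P (prodBern fun _ => q) D ^ 2 ≤ ENNReal.ofReal (lowDegreeSum q P D) := by
  have hS : 0 ≤ lowDegreeSum q P D := Finset.sum_nonneg fun _ _ => sq_nonneg _
  suffices h : adv P (prodBern fun _ => q) D ≤ ENNReal.ofReal √(lowDegreeSum q P D) by
    calc adv P (prodBern fun _ => q) D ^ 2 ≤ ENNReal.ofReal √(lowDegreeSum q P D) ^ 2 := by gcongr
      _ = ENNReal.ofReal (lowDegreeSum q P D) := by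
        rw [← ENNReal.ofReal_pow (Real.sqrt_nonneg _), Real.sq_sqrt hS]
  refine iSup_le fun ⟨f, hf⟩ => ?_
  obtain ⟨a, ha⟩ := exists_chi_expansion h0 h1 f hf
  simp only [ha]
  have hP : expect P (fun x => ∑ s with s.card ≤ D, a s * chi q s x) =
      ∑ s with s.card ≤ D, a s * expect P (chi q s) := by
    rw [expect_sum]
    exact Finset.sum_congr rfl fun s _ => expect_const_mul _ _ _
  have hQ : expect (prodBern fun _ => q)
      (fun x => (∑ s with s.card ≤ D, a s * chi q s x) ^ 2) = ∑ s with s.card ≤ D, a s ^ 2 := by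
    simp only [sq, Finset.sum_mul_sum, expect_sum]
    refine Finset.sum_congr rfl fun s hs => ?_
    have : ∀ t : Finset ι, expect (prodBern fun _ => q)
        (fun x => a s * chi q s x * (a t * chi q t x)) = if s = t then a s * a s else 0 := by
      intro t
      have h : (fun x => a s * chi q s x * (a t * chi q t x)) =
          fun x : ι → Bool => (a s * a t) * (chi q s x * chi q t x) := by
        funext x; ring
      rw [h, expect_const_mul, expect_chi_mul_chi h0 h1]
      split_ifs with hst
      · rw [hst]; ring
      · simp
    simp only [this]
    rw [Finset.sum_ite_eq, if_pos hs]
  rw [hP, hQ]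
  refine ENNReal.div_le_of_le_mul ?_
  rw [← ENNReal.ofReal_mul (Real.sqrt_nonneg _)]
  refine ENNReal.ofReal_le_ofReal ?_
  rw [← Real.sqrt_mul hS]
  refine Real.le_sqrt_of_sq_le ?_
  rw [mul_comm]
  exact Finset.sum_mul_sq_le_sq_mul_sq _ _ _

lemma one_le_adv {P Q : (ι → Bool) → ℝ} (hP : IsLaw P) (hQ : IsLaw Q) (D : ℕ) :
    1 ≤ adv P Q D := by
  refine le_trans ?_ (le_iSup _ ⟨1, by simp⟩)
  simp [expect_const hP, expect_const hQ]

/-! ## The hidden informative sample problem -/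

/-- The null law of the hidden problem is again a product of equal Bernoulli laws, so the same
Fourier analysis applies to it. -/
lemma hiddenNull_prodBern {κ : Type} [Fintype κ] (M : ℕ) (q : ℝ) :
    hiddenNull M (prodBern fun _ : κ => q) = prodBern fun _ : Fin M × κ => q := by
  funext Y
  simp [hiddenNull, prodBern, Fintype.prod_prod_type]

lemma sum_hiddenTerm {M : ℕ} (R : Fin M → (ι → Bool) → ℝ) (g : Fin M → (ι → Bool) → ℝ) :
    ∑ Y : Fin M × ι → Bool, (∏ j, R j fun i => Y (j, i)) * ∏ j, g j (fun i => Y (j, i)) =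
      ∏ j, expect (R j) (g j) := by
  simp only [← Finset.prod_mul_distrib, expect]
  rw [Finset.prod_univ_sum, Fintype.piFinset_univ]
  exact Fintype.sum_equiv (Equiv.curry _ _ _) _ _ fun Y => rfl

/-- Expectation under the planted law of the hidden informative sample problem, as an average over
the position of the informative sample. -/
lemma expect_hiddenPlanted (M : ℕ) (P Q : (ι → Bool) → ℝ) (F : (Fin M × ι → Bool) → ℝ) :
    expect (hiddenPlanted M P Q) F = (M : ℝ)⁻¹ * ∑ κ : Fin M,
      expect (fun Y => ∏ j, (if j = κ then P else Q) fun i => Y (j, i)) F := by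
  simp only [expect, hiddenPlanted, Finset.mul_sum, Finset.sum_mul]
  rw [Finset.sum_comm]
  refine Finset.sum_congr rfl fun κ _ => Finset.sum_congr rfl fun Y _ => ?_
  rw [mul_assoc]
  congr 2
  exact Finset.prod_congr rfl fun j _ => by split_ifs <;> rfl

end Fourier

/-! ### Characters under the laws of the hidden sample problem -/

section HiddenFourier

variable {ι : Type} [Fintype ι] [DecidableEq ι]

/-- The part of a set of variables of the hidden sample problem that lies in the sample `j`. -/
def sampleSlice {M : ℕ} (s : Finset (Fin M × ι)) (j : Fin M) : Finset ι :=
  Finset.univ.filter fun i => (j, i) ∈ s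

lemma mem_sampleSlice {M : ℕ} {s : Finset (Fin M × ι)} {j : Fin M} {i : ι} :
    i ∈ sampleSlice s j ↔ (j, i) ∈ s := by simp [sampleSlice]

lemma chi_eq_prod_sampleSlice {M : ℕ} (q : ℝ) (s : Finset (Fin M × ι)) (Y : Fin M × ι → Bool) :
    chi q s Y = ∏ j, chi q (sampleSlice s j) fun i => Y (j, i) := by
  have h1 : chi q s Y = ∏ e, if e ∈ s then (bit (Y e) - q) / √(q * (1 - q)) else 1 := by
    simp [chi, Finset.prod_ite_mem]
  rw [h1, Fintype.prod_prod_type]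
  refine Finset.prod_congr rfl fun j _ => ?_
  rw [chi, sampleSlice, Finset.prod_filter]

lemma chi_empty {κ : Type} (q : ℝ) : chi q (∅ : Finset κ) = fun _ => 1 := by
  funext x; simp [chi]

lemma expect_null_chi {q : ℝ} (h0 : 0 < q) (h1 : q < 1) (s : Finset ι) :
    expect (prodBern fun _ => q) (chi q s) = if s = ∅ then 1 else 0 := by
  have h := expect_chi_mul_chi h0 h1 s ∅
  simp only [chi_empty, mul_one] at h
  exact h

/-- A character splits over the samples; a nonempty slice in an uninformative sample has mean zero,
which kills the whole product. -/
lemma expect_informative_chi {M : ℕ} {q : ℝ} (h0 : 0 < q) (h1 : q < 1) (P : (ι → Bool) → ℝ)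
    (κ : Fin M) (s : Finset (Fin M × ι)) :
    expect (fun Y => ∏ j, (if j = κ then P else prodBern fun _ => q) fun i => Y (j, i)) (chi q s) =
      if ∀ j, j ≠ κ → sampleSlice s j = ∅ then expect P (chi q (sampleSlice s κ)) else 0 := by
  have h := sum_hiddenTerm (fun j => if j = κ then P else prodBern fun _ => q)
    fun j => chi q (sampleSlice s j)
  rw [expect]
  simp only [chi_eq_prod_sampleSlice]
  rw [h]
  split_ifs with hs
  · rw [Finset.prod_eq_single κ]
    · simp
    · intro j _ hj
      rw [if_neg hj, hs j hj, expect_null_chi h0 h1, if_pos rfl]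
    · simp
  · push Not at hs
    obtain ⟨j, hj, hne⟩ := hs
    refine Finset.prod_eq_zero (Finset.mem_univ j) ?_
    rw [if_neg hj, expect_null_chi h0 h1, if_neg (Finset.nonempty_iff_ne_empty.1 hne)]

/-- Sets contained in the sample `κ` are determined by their slice there, and the slice is no larger
than the set. -/
lemma sum_sq_informative_le {M : ℕ} (D : ℕ) (F : Finset ι → ℝ)
    (κ : Fin M) :
    ∑ s : Finset (Fin M × ι) with s.card ≤ D,
      (if ∀ j, j ≠ κ → sampleSlice s j = ∅ then F (sampleSlice s κ) else 0) ^ 2 ≤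
      ∑ s : Finset ι with s.card ≤ D, F s ^ 2 := by
  have h1 : ∀ s : Finset (Fin M × ι),
      (if ∀ j, j ≠ κ → sampleSlice s j = ∅ then F (sampleSlice s κ) else 0) ^ 2 =
      if ∀ j, j ≠ κ → sampleSlice s j = ∅ then F (sampleSlice s κ) ^ 2 else 0 := by
    intro s; split_ifs <;> simp
  simp only [h1]
  rw [← Finset.sum_filter]
  have hinj : Set.InjOn (fun s : Finset (Fin M × ι) => sampleSlice s κ)
      (((Finset.univ.filter fun s : Finset (Fin M × ι) => s.card ≤ D).filter
        fun s => ∀ j, j ≠ κ → sampleSlice s j = ∅ : Finset (Finset (Fin M × ι))) :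
          Set (Finset (Fin M × ι))) := by
    intro s hs t ht hst
    simp only [Finset.coe_filter, Set.mem_ofPred_eq] at hs ht
    ext ⟨j, i⟩
    rw [← mem_sampleSlice, ← mem_sampleSlice]
    by_cases hj : j = κ
    · subst hj; rw [show sampleSlice s j = sampleSlice t j from hst]
    · rw [hs.2 j hj, ht.2 j hj]
  rw [← Finset.sum_image (f := fun s => F s ^ 2) hinj]
  refine Finset.sum_le_sum_of_subset_of_nonneg ?_ fun _ _ _ => sq_nonneg _
  intro t ht
  obtain ⟨s, hs, rfl⟩ := Finset.mem_image.1 ht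
  simp only [Finset.mem_filter, Finset.mem_univ, true_and] at hs ⊢
  refine le_trans ?_ hs.1
  refine Finset.card_le_card_of_injOn (fun i => (κ, i)) (fun i hi => mem_sampleSlice.1 hi) ?_
  intro a _ b _ hab
  exact (Prod.ext_iff.1 hab).2

/-- Hiding the informative sample among `M` ones divides the excess of the advantage by `M`. -/
lemma lowDegreeSum_hiddenPlanted_le {M : ℕ} (hM : 0 < M) {q : ℝ} (h0 : 0 < q) (h1 : q < 1)
    {P : (ι → Bool) → ℝ} (hP : IsLaw P) (D : ℕ) :
    lowDegreeSum q (hiddenPlanted M P (prodBern fun _ => q)) D ≤ 1 + lowDegreeSum q P D / M := by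
  have hM' : (0 : ℝ) < M := Nat.cast_pos.2 hM
  set t : Fin M → Finset (Fin M × ι) → ℝ := fun κ s =>
    if ∀ j, j ≠ κ → sampleSlice s j = ∅ then expect P (chi q (sampleSlice s κ)) else 0 with ht
  have hE : ∀ s : Finset (Fin M × ι), expect (hiddenPlanted M P (prodBern fun _ => q)) (chi q s) =
      (M : ℝ)⁻¹ * ∑ κ, t κ s := by
    intro s
    rw [expect_hiddenPlanted]
    simp only [expect_informative_chi h0 h1, ht]
  have hempty : ((M : ℝ)⁻¹ * ∑ κ, t κ ∅) ^ 2 = 1 := by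
    have : ∀ κ : Fin M, t κ ∅ = 1 := by
      intro κ
      have : ∀ j : Fin M, sampleSlice (∅ : Finset (Fin M × ι)) j = ∅ := fun j => by
        simp [sampleSlice]
      simp [ht, this, chi_empty, expect_const hP]
    simp [this, hM'.ne']
  -- A nonempty set lies inside at most one sample, so cross terms vanish. The square of the average
  -- then costs `M⁻²` with only `M` diagonal terms, which produces the gain `1/M`.
  have hne : ∀ s : Finset (Fin M × ι), s ≠ ∅ →
      ((M : ℝ)⁻¹ * ∑ κ, t κ s) ^ 2 = ((M : ℝ)⁻¹) ^ 2 * ∑ κ, t κ s ^ 2 := by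
    intro s hs
    rw [mul_pow]
    congr 1
    rw [sq, Finset.sum_mul_sum]
    refine Finset.sum_congr rfl fun κ _ => ?_
    rw [Finset.sum_eq_single κ]
    · ring
    · intro κ' _ hκ
      obtain ⟨⟨j, i⟩, hji⟩ := Finset.nonempty_iff_ne_empty.2 hs
      have hslice : sampleSlice s j ≠ ∅ :=
        Finset.nonempty_iff_ne_empty.1 ⟨i, mem_sampleSlice.2 hji⟩
      by_cases hj : j = κ
      · have : t κ' s = 0 := if_neg fun h => hslice (h j (hj ▸ hκ.symm))
        rw [this, mul_zero]
      · have : t κ s = 0 := if_neg fun h => hslice (h j hj)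
        rw [this, zero_mul]
    · simp
  unfold lowDegreeSum
  simp only [hE]
  have hmem : (∅ : Finset (Fin M × ι)) ∈ Finset.univ.filter fun s : Finset (Fin M × ι) =>
      s.card ≤ D := by simp
  rw [← Finset.add_sum_erase _ _ hmem, hempty]
  gcongr
  calc ∑ s ∈ (Finset.univ.filter fun s : Finset (Fin M × ι) => s.card ≤ D).erase ∅,
        ((M : ℝ)⁻¹ * ∑ κ, t κ s) ^ 2
      = ∑ s ∈ (Finset.univ.filter fun s : Finset (Fin M × ι) => s.card ≤ D).erase ∅,
        ((M : ℝ)⁻¹) ^ 2 * ∑ κ, t κ s ^ 2 :=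
        Finset.sum_congr rfl fun s hs => hne s (Finset.ne_of_mem_erase hs)
    _ ≤ ∑ s : Finset (Fin M × ι) with s.card ≤ D, ((M : ℝ)⁻¹) ^ 2 * ∑ κ, t κ s ^ 2 :=
        Finset.sum_le_sum_of_subset_of_nonneg (Finset.erase_subset _ _) fun s _ _ =>
          mul_nonneg (sq_nonneg _) (Finset.sum_nonneg fun _ _ => sq_nonneg _)
    _ = ((M : ℝ)⁻¹) ^ 2 * ∑ κ, ∑ s : Finset (Fin M × ι) with s.card ≤ D, t κ s ^ 2 := by
        rw [← Finset.mul_sum, Finset.sum_comm]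
    _ ≤ ((M : ℝ)⁻¹) ^ 2 * ∑ κ : Fin M, ∑ s : Finset ι with s.card ≤ D,
          expect P (chi q s) ^ 2 := by
        gcongr with κ
        exact sum_sq_informative_le D (fun s => expect P (chi q s)) κ
    _ = (∑ s : Finset ι with s.card ≤ D, expect P (chi q s) ^ 2) / M := by
        rw [Finset.sum_const, Finset.card_univ, Fintype.card_fin, nsmul_eq_mul]
        field_simp

end HiddenFourier

/-! ## The planted dense subgraph model: laws and overlaps -/

section Model

variable {n : ℕ}

/-- Indicator that both ends of the pair `e` are planted. -/
def pairBit (θ : Fin n → Bool) (e : Edge n) : ℝ := bit (θ e.1.1) * bit (θ e.1.2)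

/-- Number of planted vertices common to `θ` and `θ'`. -/
def overlap (θ θ' : Fin n → Bool) : ℝ := ∑ i, bit (θ i) * bit (θ' i)

lemma bit_nonneg (b : Bool) : 0 ≤ bit b := by cases b <;> simp [bit]

lemma bit_le_one (b : Bool) : bit b ≤ 1 := by cases b <;> simp [bit]

lemma bit_mul_self (b : Bool) : bit b * bit b = bit b := by cases b <;> simp [bit]

lemma pairBit_eq_zero_or_one (θ : Fin n → Bool) (e : Edge n) :
    pairBit θ e = 0 ∨ pairBit θ e = 1 := by
  unfold pairBit
  cases θ e.1.1 <;> cases θ e.1.2 <;> simp [bit]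

lemma pairBit_nonneg (θ : Fin n → Bool) (e : Edge n) : 0 ≤ pairBit θ e := by
  rcases pairBit_eq_zero_or_one θ e with h | h <;> simp [h]

lemma overlap_nonneg (θ θ' : Fin n → Bool) : 0 ≤ overlap θ θ' :=
  Finset.sum_nonneg fun _ _ => mul_nonneg (bit_nonneg _) (bit_nonneg _)

/-- A sum over all ordered pairs, split into the diagonal and the unordered pairs. -/
lemma sum_pairs_eq (f : Fin n → Fin n → ℝ) :
    ∑ i, ∑ j, f i j = ∑ i, f i i + ∑ e : Edge n, (f e.1.1 e.1.2 + f e.1.2 e.1.1) := by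
  have hE : ∀ g : Fin n × Fin n → ℝ,
      ∑ e : Edge n, g e.1 = ∑ p : Fin n × Fin n, if p.1 < p.2 then g p else 0 := by
    intro g
    rw [← Finset.sum_filter]
    exact (Finset.sum_subtype _ (fun p => by simp) g).symm
  have hD : ∑ i, f i i = ∑ p : Fin n × Fin n, if p.1 = p.2 then f p.1 p.2 else 0 := by
    rw [Fintype.sum_prod_type]
    exact Finset.sum_congr rfl fun i _ => by simp
  have hS : ∑ e : Edge n, f e.1.2 e.1.1 =
      ∑ p : Fin n × Fin n, if p.2 < p.1 then f p.1 p.2 else 0 := by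
    rw [hE fun p => f p.2 p.1]
    exact Fintype.sum_equiv (Equiv.prodComm _ _) _ _ fun p => rfl
  rw [Finset.sum_add_distrib, hE fun p => f p.1 p.2, hS, hD, ← Finset.sum_add_distrib,
    ← Finset.sum_add_distrib, ← Fintype.sum_prod_type']
  refine Finset.sum_congr rfl fun p _ => ?_
  rcases lt_trichotomy p.1 p.2 with h | h | h
  · simp [h, h.ne, h.not_gt]
  · simp [h]
  · simp [h, h.ne', h.not_gt]

/-- The sum counts unordered pairs of commonly planted vertices; the square of the overlap counts
ordered pairs, diagonal included. -/
lemma sum_pairBit_mul_le (θ θ' : Fin n → Bool) :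
    ∑ e : Edge n, pairBit θ e * pairBit θ' e ≤ overlap θ θ' ^ 2 := by
  have hnn : ∀ i j : Fin n, 0 ≤ (bit (θ i) * bit (θ' i)) * (bit (θ j) * bit (θ' j)) := fun i j =>
    mul_nonneg (mul_nonneg (bit_nonneg _) (bit_nonneg _))
      (mul_nonneg (bit_nonneg _) (bit_nonneg _))
  have h := sum_pairs_eq fun i j => (bit (θ i) * bit (θ' i)) * (bit (θ j) * bit (θ' j))
  rw [overlap, sq, Finset.sum_mul_sum, h]
  have h1 : ∑ e : Edge n, pairBit θ e * pairBit θ' e ≤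
      ∑ e : Edge n, ((bit (θ e.1.1) * bit (θ' e.1.1)) * (bit (θ e.1.2) * bit (θ' e.1.2)) +
        (bit (θ e.1.2) * bit (θ' e.1.2)) * (bit (θ e.1.1) * bit (θ' e.1.1))) := by
    refine Finset.sum_le_sum fun e _ => ?_
    have := hnn e.1.2 e.1.1
    simp only [pairBit]
    linarith
  have h2 : 0 ≤ ∑ i, (bit (θ i) * bit (θ' i)) * (bit (θ i) * bit (θ' i)) :=
    Finset.sum_nonneg fun i _ => hnn i i
  linarith

lemma isLaw_signal {ρ : ℝ} (h0 : 0 ≤ ρ) (h1 : ρ ≤ 1) : IsLaw (prodBern fun _ : Fin n => ρ) :=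
  isLaw_prodBern (fun _ => h0) fun _ => h1

lemma isLaw_graphLawGiven {p₀ p₁ : ℝ} (h0 : 0 ≤ p₀) (h01 : p₀ ≤ p₁) (h1 : p₁ ≤ 1)
    (θ : Fin n → Bool) : IsLaw (graphLawGiven p₀ p₁ θ) := by
  refine isLaw_prodBern (fun e => ?_) fun e => ?_ <;>
  · rcases pairBit_eq_zero_or_one θ e with h | h <;> rw [pairBit] at h <;> rw [h] <;> linarith

lemma expect_plantedLaw (p₀ p₁ ρ : ℝ) (f : (Edge n → Bool) → ℝ) :
    expect (plantedLaw p₀ p₁ ρ n) f =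
      expect (prodBern fun _ : Fin n => ρ) fun θ => expect (graphLawGiven p₀ p₁ θ) f := by
  simp only [expect, plantedLaw, Finset.sum_mul, Finset.mul_sum]
  rw [Finset.sum_comm]
  exact Finset.sum_congr rfl fun _ _ => Finset.sum_congr rfl fun _ _ => by ring

lemma isLaw_plantedLaw {p₀ p₁ ρ : ℝ} (h0 : 0 ≤ p₀) (h01 : p₀ ≤ p₁) (h1 : p₁ ≤ 1)
    (hρ0 : 0 ≤ ρ) (hρ1 : ρ ≤ 1) : IsLaw (plantedLaw p₀ p₁ ρ n) where
  nonneg Y := expect_nonneg (isLaw_signal hρ0 hρ1) fun θ =>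
    (isLaw_graphLawGiven h0 h01 h1 θ).nonneg Y
  sum_eq_one := by
    have h := expect_plantedLaw (n := n) p₀ p₁ ρ fun _ => 1
    simp only [expect_const (isLaw_graphLawGiven h0 h01 h1 _),
      expect_const (isLaw_signal hρ0 hρ1)] at h
    simpa [expect] using h

/-- Moment generating function of the overlap of two independent signals. -/
lemma expect_exp_overlap_le {ρ : ℝ} {t : ℝ} (ht : 0 ≤ t) :
    expect (prodBern fun _ : Fin n => ρ) (fun θ => expect (prodBern fun _ : Fin n => ρ) fun θ' =>
      Real.exp (t * overlap θ θ')) ≤ Real.exp (n * ρ ^ 2 * (Real.exp t - 1)) := by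
  have h1 : ∀ θ θ' : Fin n → Bool, Real.exp (t * overlap θ θ') =
      ∏ i, Real.exp (t * (bit (θ i) * bit (θ' i))) := by
    intro θ θ'
    rw [← Real.exp_sum, overlap, Finset.mul_sum]
  have h2 : ∀ θ : Fin n → Bool, expect (prodBern fun _ : Fin n => ρ) (fun θ' =>
      Real.exp (t * overlap θ θ')) = ∏ i, (ρ * Real.exp (t * bit (θ i)) + (1 - ρ)) := by
    intro θ
    simp only [h1]
    rw [expect_prodBern_prod (fun _ => ρ) fun i b => Real.exp (t * (bit (θ i) * bit b))]
    simp [bit]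
  simp only [h2]
  rw [expect_prodBern_prod (fun _ => ρ) fun i b => ρ * Real.exp (t * bit b) + (1 - ρ)]
  have h3 : ρ * (ρ * Real.exp (t * bit true) + (1 - ρ)) + (1 - ρ) *
      (ρ * Real.exp (t * bit false) + (1 - ρ)) = ρ ^ 2 * (Real.exp t - 1) + 1 := by
    simp [bit]; ring
  simp only [h3, Finset.prod_const, Finset.card_univ, Fintype.card_fin]
  have h4 : 0 ≤ ρ ^ 2 * (Real.exp t - 1) :=
    mul_nonneg (sq_nonneg _) (sub_nonneg.2 (Real.one_le_exp ht))
  calc (ρ ^ 2 * (Real.exp t - 1) + 1) ^ n ≤ Real.exp (ρ ^ 2 * (Real.exp t - 1)) ^ n := by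
        gcongr
        exact Real.add_one_le_exp _
    _ = _ := by rw [← Real.exp_nat_mul]; ring_nf

lemma exp_sub_one_le_two_mul {t : ℝ} (h0 : 0 ≤ t) (h1 : t ≤ 1) : Real.exp t - 1 ≤ 2 * t := by
  have h := Real.abs_exp_sub_one_le (x := t) (by rwa [abs_of_nonneg h0])
  rw [abs_of_nonneg h0] at h
  exact (le_abs_self _).trans h

/-- Moments of the overlap of two independent signals. -/
lemma expect_overlap_pow_le {ρ : ℝ} (h0 : 0 ≤ ρ) (h1 : ρ ≤ 1) (hμ : 0 < n * ρ ^ 2) (k : ℕ) :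
    expect (prodBern fun _ : Fin n => ρ) (fun θ => expect (prodBern fun _ : Fin n => ρ) fun θ' =>
      overlap θ θ' ^ k) ≤ (Real.exp 2 * max (n * ρ ^ 2) k) ^ k := by
  have hlaw := isLaw_signal (n := n) h0 h1
  rcases Nat.eq_zero_or_pos k with rfl | hk
  · simp [expect_const hlaw]
  have hk' : (0 : ℝ) < k := Nat.cast_pos.2 hk
  set μ : ℝ := n * ρ ^ 2 with hμd
  -- Moments are controlled by the exponential moment through `y^k ≤ k! e^y ≤ k^k e^y` at `y = t ·
  -- overlap`. The parameter is then `t = k/μ` when `k ≤ μ` and `t = 1` otherwise, so that `t ≤ 1`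
  -- always holds.
  have key : ∀ t : ℝ, 0 < t → t ≤ 1 →
      expect (prodBern fun _ : Fin n => ρ) (fun θ => expect (prodBern fun _ : Fin n => ρ) fun θ' =>
        overlap θ θ' ^ k) ≤ (k / t) ^ k * Real.exp (2 * (μ * t)) := by
    intro t ht ht1
    have hpt : ∀ θ θ' : Fin n → Bool, overlap θ θ' ^ k ≤
        (k / t) ^ k * Real.exp (t * overlap θ θ') := by
      intro θ θ'
      have hx := Real.pow_div_factorial_le_exp (t * overlap θ θ')
        (mul_nonneg ht.le (overlap_nonneg _ _)) k
      rw [div_le_iff₀ (by positivity), mul_pow] at hx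
      have hf : (k.factorial : ℝ) ≤ (k : ℝ) ^ k := by exact_mod_cast Nat.factorial_le_pow k
      rw [div_pow, div_mul_eq_mul_div, le_div_iff₀ (by positivity)]
      calc overlap θ θ' ^ k * t ^ k = t ^ k * overlap θ θ' ^ k := mul_comm _ _
        _ ≤ _ := hx
        _ ≤ Real.exp (t * overlap θ θ') * (k : ℝ) ^ k := by gcongr
        _ = _ := mul_comm _ _
    calc _ ≤ expect (prodBern fun _ : Fin n => ρ) (fun θ => expect (prodBern fun _ : Fin n => ρ)
          fun θ' => (k / t) ^ k * Real.exp (t * overlap θ θ')) :=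
          expect_mono hlaw fun θ => expect_mono hlaw fun θ' => hpt θ θ'
      _ = (k / t) ^ k * expect (prodBern fun _ : Fin n => ρ) (fun θ =>
          expect (prodBern fun _ : Fin n => ρ) fun θ' => Real.exp (t * overlap θ θ')) := by
          simp only [expect_const_mul]
      _ ≤ (k / t) ^ k * Real.exp (μ * (Real.exp t - 1)) := by
          gcongr
          exact expect_exp_overlap_le ht.le
      _ ≤ _ := by
          refine mul_le_mul_of_nonneg_left (Real.exp_le_exp.2 ?_) (by positivity)
          have := mul_le_mul_of_nonneg_left (exp_sub_one_le_two_mul ht.le ht1) hμ.le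
          linarith
  rcases le_total (k : ℝ) μ with hkμ | hkμ
  · refine (key (k / μ) (by positivity) ((div_le_one hμ).2 hkμ)).trans_eq ?_
    rw [max_eq_left hkμ, mul_div_cancel₀ _ hμ.ne', mul_pow, div_div_cancel₀ hk'.ne',
      ← Real.exp_nat_mul]
    ring_nf
  · refine (key 1 one_pos le_rfl).trans ?_
    rw [max_eq_right hkμ, mul_pow, ← Real.exp_nat_mul, div_one, mul_comm]
    exact mul_le_mul_of_nonneg_right (Real.exp_le_exp.2 (by linarith)) (by positivity)

end Model

/-! ## Low-degree advantage of the planted dense subgraph model -/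

section Advantage

/-- Only subsets of the support of `u` contribute, so the sum is a truncated binomial expansion, and
`choose m j ≤ m^j / j!`. -/
lemma sum_prod_indicator_le {ι : Type} [Fintype ι] [DecidableEq ι] {u : ι → ℝ}
    (hu : ∀ i, u i = 0 ∨ u i = 1) {a : ℝ} (ha : 0 ≤ a) (D : ℕ) :
    ∑ s : Finset ι with s.card ≤ D, ∏ i ∈ s, a * u i ≤
      ∑ j ∈ Finset.range (D + 1), (a * ∑ i, u i) ^ j / j.factorial := by
  set U : Finset ι := Finset.univ.filter fun i => u i = 1 with hU
  have hcard : ∑ i, u i = (U.card : ℝ) := by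
    rw [Finset.card_eq_sum_ones, hU, Finset.sum_filter]
    push_cast
    refine Finset.sum_congr rfl fun i _ => ?_
    rcases hu i with h | h <;> simp [h]
  have hterm : ∀ s : Finset ι, ∏ i ∈ s, a * u i = if s ⊆ U then a ^ s.card else 0 := by
    intro s
    split_ifs with hs
    · refine (Finset.prod_congr rfl fun i hi => ?_).trans (Finset.prod_const a)
      rw [(Finset.mem_filter.1 (hs hi)).2, mul_one]
    · obtain ⟨i, hi, hiU⟩ := Finset.not_subset.1 hs
      refine Finset.prod_eq_zero hi ?_
      rcases hu i with h | h
      · rw [h, mul_zero]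
      · exact absurd (by simp [hU, h]) hiU
  have h1 : ∑ s : Finset ι with s.card ≤ D, ∏ i ∈ s, a * u i =
      ∑ s ∈ U.powerset, if s.card ≤ D then a ^ s.card else 0 := by
    simp only [hterm]
    rw [← Finset.sum_filter, ← Finset.sum_filter]
    refine Finset.sum_congr ?_ fun _ _ => rfl
    ext s
    simp [and_comm]
  rw [h1, Finset.sum_powerset_apply_card (fun j => if j ≤ D then a ^ j else 0), hcard]
  have h2 : ∀ j, U.card.choose j • (if j ≤ D then a ^ j else 0) =
      if j ≤ D then (U.card.choose j : ℝ) * a ^ j else 0 := by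
    intro j; split_ifs <;> simp
  simp only [h2]
  rw [← Finset.sum_filter]
  refine (Finset.sum_le_sum_of_subset_of_nonneg (t := Finset.range (D + 1)) ?_ ?_).trans ?_
  · intro j hj
    simp only [Finset.mem_filter, Finset.mem_range] at hj ⊢
    omega
  · intro j _ _
    positivity
  · refine Finset.sum_le_sum fun j _ => ?_
    have := Nat.choose_le_pow_div (α := ℝ) j U.card
    rw [mul_pow, mul_comm, mul_div_assoc]
    gcongr

lemma expect_graphLawGiven_chi (p₀ p₁ : ℝ) {n : ℕ} (θ : Fin n → Bool) (s : Finset (Edge n)) :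
    expect (graphLawGiven p₀ p₁ θ) (chi p₀ s) = ∏ e ∈ s, snr p₀ p₁ * pairBit θ e := by
  rw [graphLawGiven, expect_chi p₀ fun e : Edge n => (p₁ - p₀) * (bit (θ e.1.1) * bit (θ e.1.2))]
  refine Finset.prod_congr rfl fun e _ => ?_
  rw [snr, pairBit]
  ring

/-- The square of an expectation over `θ` is an expectation over two independent copies `θ, θ'`; the
conditional means of a character then multiply edge by edge. -/
lemma lowDegreeSum_plantedLaw (p₀ p₁ ρ : ℝ) (n D : ℕ) :
    lowDegreeSum p₀ (plantedLaw p₀ p₁ ρ n) D =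
      expect (prodBern fun _ : Fin n => ρ) fun θ => expect (prodBern fun _ : Fin n => ρ) fun θ' =>
        ∑ s : Finset (Edge n) with s.card ≤ D,
          ∏ e ∈ s, snr p₀ p₁ ^ 2 * (pairBit θ e * pairBit θ' e) := by
  simp only [lowDegreeSum, expect_plantedLaw, expect_graphLawGiven_chi, expect_sum]
  refine Finset.sum_congr rfl fun s _ => ?_
  rw [sq, ← expect_mul_const]
  congr 1
  funext θ
  rw [← expect_const_mul]
  congr 1
  funext θ'
  rw [← Finset.prod_mul_distrib]
  exact Finset.prod_congr rfl fun e _ => by ring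

/-- Bound on the low-degree advantage of the planted dense subgraph model. -/
lemma lowDegreeSum_plantedLaw_le {p₀ p₁ ρ : ℝ} {n D : ℕ} (h0 : 0 ≤ ρ) (h1 : ρ ≤ 1)
    (hμ : 0 < n * ρ ^ 2) (hD : 1200 * (snr p₀ p₁ ^ 2 * D) ≤ 1) :
    lowDegreeSum p₀ (plantedLaw p₀ p₁ ρ n) D ≤
      Real.exp (55 * (snr p₀ p₁ ^ 2 * (n * ρ ^ 2) ^ 2)) + 2 := by
  have hlaw := isLaw_signal (n := n) h0 h1
  set a := snr p₀ p₁ ^ 2 with ha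
  have ha0 : 0 ≤ a := sq_nonneg _
  set μ : ℝ := n * ρ ^ 2 with hμd
  have he : Real.exp 1 < 2.7182818286 := Real.exp_one_lt_d9
  have he4 : Real.exp 2 ^ 2 ≤ 55 := by
    have : Real.exp 2 = Real.exp 1 ^ 2 := by rw [← Real.exp_nat_mul]; norm_num
    rw [this, ← pow_mul]
    calc Real.exp 1 ^ (2 * 2) ≤ 2.7182818286 ^ (2 * 2) := by gcongr
      _ ≤ 55 := by norm_num
  rw [lowDegreeSum_plantedLaw]
  have hpt : ∀ θ θ' : Fin n → Bool, ∑ s : Finset (Edge n) with s.card ≤ D,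
      ∏ e ∈ s, a * (pairBit θ e * pairBit θ' e) ≤
      ∑ j ∈ Finset.range (D + 1), a ^ j / j.factorial * overlap θ θ' ^ (2 * j) := by
    intro θ θ'
    refine (sum_prod_indicator_le (u := fun e => pairBit θ e * pairBit θ' e) (fun e => ?_) ha0
      D).trans ?_
    · rcases pairBit_eq_zero_or_one θ e with h | h <;>
        rcases pairBit_eq_zero_or_one θ' e with h' | h' <;> simp [h, h']
    · refine Finset.sum_le_sum fun j _ => ?_
      have hs : 0 ≤ ∑ e : Edge n, pairBit θ e * pairBit θ' e := Finset.sum_nonneg fun e _ =>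
        mul_nonneg (pairBit_nonneg _ _) (pairBit_nonneg _ _)
      rw [mul_pow, pow_mul, div_mul_eq_mul_div]
      gcongr
      exact sum_pairBit_mul_le θ θ'
  refine (expect_mono hlaw fun θ => expect_mono hlaw fun θ' => hpt θ θ').trans ?_
  simp only [expect_sum, expect_const_mul]
  have hterm : ∀ j ∈ Finset.range (D + 1), a ^ j / j.factorial *
      expect (prodBern fun _ : Fin n => ρ) (fun θ => expect (prodBern fun _ : Fin n => ρ) fun θ' =>
        overlap θ θ' ^ (2 * j)) ≤ (55 * (a * μ ^ 2)) ^ j / j.factorial + (1 / 2) ^ j := by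
    intro j hj
    have hjD : (j : ℝ) ≤ D := by exact_mod_cast Nat.lt_succ_iff.1 (Finset.mem_range.1 hj)
    have hm := expect_overlap_pow_le (n := n) h0 h1 hμ (2 * j)
    -- The maximum is replaced by the sum of both alternatives, with `e⁴ ≤ 55` and `4 · 55 = 220`.
    -- The first part will sum to an exponential series, the second to a geometric one.
    have hmax : (Real.exp 2 * max (n * ρ ^ 2) ((2 * j : ℕ) : ℝ)) ^ (2 * j) ≤
        (55 * μ ^ 2) ^ j + (220 * (j : ℝ) ^ 2) ^ j := by
      rw [pow_mul, mul_pow]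
      rcases max_choice (n * ρ ^ 2) ((2 * j : ℕ) : ℝ) with h | h <;> rw [h]
      · have : (Real.exp 2 ^ 2 * μ ^ 2) ^ j ≤ (55 * μ ^ 2) ^ j := by gcongr
        have h' : (0 : ℝ) ≤ (220 * (j : ℝ) ^ 2) ^ j := by positivity
        linarith
      · have : (Real.exp 2 ^ 2 * ((2 * j : ℕ) : ℝ) ^ 2) ^ j ≤ (220 * (j : ℝ) ^ 2) ^ j := by
          apply pow_le_pow_left₀ (by positivity)
          push_cast
          nlinarith [sq_nonneg (j : ℝ)]
        have h' : (0 : ℝ) ≤ (55 * μ ^ 2) ^ j := by positivity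
        linarith
    have hjj : (j : ℝ) ^ j / j.factorial ≤ Real.exp 1 ^ j := by
      have := Real.pow_div_factorial_le_exp (j : ℝ) (Nat.cast_nonneg j) j
      rwa [← Real.exp_nat_mul, mul_one]
    calc a ^ j / j.factorial * _ ≤ a ^ j / j.factorial *
          ((55 * μ ^ 2) ^ j + (220 * (j : ℝ) ^ 2) ^ j) := by
          gcongr
          exact hm.trans hmax
      _ = (55 * (a * μ ^ 2)) ^ j / j.factorial +
          (220 * (a * j)) ^ j * ((j : ℝ) ^ j / j.factorial) := by
          simp only [mul_pow]; ring
      _ ≤ (55 * (a * μ ^ 2)) ^ j / j.factorial + (220 * (a * j)) ^ j * Real.exp 1 ^ j := by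
          gcongr
      _ ≤ _ := by
          have h3 : a * j ≤ a * D := by gcongr
          have h4 : 0 ≤ a * j := by positivity
          -- This is the origin of the constant 1200: `220 e / 1200 < 1/2`, where the factor `e`
          -- comes from `j^j / j! ≤ e^j`.
          have h5 : 220 * (a * j) * Real.exp 1 ≤ 1 / 2 := by nlinarith [Real.exp_pos 1]
          have h6 := pow_le_pow_left₀ (by positivity) h5 j
          rw [mul_pow] at h6
          linarith
  refine (Finset.sum_le_sum hterm).trans ?_
  rw [Finset.sum_add_distrib]
  gcongr
  · exact Real.sum_le_exp_of_nonneg (by positivity) _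
  · exact sum_geometric_two_le _

end Advantage

/-! ## Information-theoretic bound on the correlation of an estimator -/

section Information

variable {n : ℕ}

/-- Number of planted vertices. -/
def plantedSize (θ : Fin n → Bool) : ℝ := ∑ i, bit (θ i)

lemma plantedSize_nonneg (θ : Fin n → Bool) : 0 ≤ plantedSize θ :=
  Finset.sum_nonneg fun _ _ => bit_nonneg _

lemma frobInner_self_nonneg (X : Matrix (Fin n) (Fin n) ℝ) : 0 ≤ frobInner X X :=
  Finset.sum_nonneg fun _ _ => Finset.sum_nonneg fun _ _ => mul_self_nonneg _

lemma frobNorm_nonneg (X : Matrix (Fin n) (Fin n) ℝ) : 0 ≤ frobNorm X := Real.sqrt_nonneg _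

lemma frobNorm_sq (X : Matrix (Fin n) (Fin n) ℝ) : frobNorm X ^ 2 = ∑ i, ∑ j, X i j ^ 2 := by
  rw [frobNorm, Real.sq_sqrt (frobInner_self_nonneg X), frobInner]
  simp only [sq]

lemma frobNorm_signal {p₀ p₁ : ℝ} (h : p₀ ≤ p₁) (θ : Fin n → Bool) :
    frobNorm (signal p₀ p₁ θ) = (p₁ - p₀) * plantedSize θ := by
  have h1 : frobInner (signal p₀ p₁ θ) (signal p₀ p₁ θ) = ((p₁ - p₀) * plantedSize θ) ^ 2 := by
    have h2 : ((p₁ - p₀) * plantedSize θ) ^ 2 =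
        (p₁ - p₀) ^ 2 * ((∑ i, bit (θ i)) * ∑ i, bit (θ i)) := by rw [plantedSize]; ring
    rw [h2, Finset.sum_mul_sum, Finset.mul_sum, frobInner]
    refine Finset.sum_congr rfl fun i _ => ?_
    rw [Finset.mul_sum]
    refine Finset.sum_congr rfl fun j _ => ?_
    calc signal p₀ p₁ θ i j * signal p₀ p₁ θ i j
        = (p₁ - p₀) ^ 2 * ((bit (θ i) * bit (θ i)) * (bit (θ j) * bit (θ j))) := by
          rw [signal]; ring
      _ = _ := by rw [bit_mul_self, bit_mul_self]
  rw [frobNorm, h1, Real.sqrt_sq (mul_nonneg (sub_nonneg.2 h) (plantedSize_nonneg θ))]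

lemma corr_signal_self (p : ℝ) (X : Matrix (Fin n) (Fin n) ℝ) (θ : Fin n → Bool) :
    corr X (signal p p θ) = 0 := by
  rw [corr, frobNorm_signal le_rfl]; simp

lemma corr_signal {p₀ p₁ : ℝ} (h : p₀ < p₁) (X : Matrix (Fin n) (Fin n) ℝ) (θ : Fin n → Bool) :
    corr X (signal p₀ p₁ θ) =
      ∑ i, ∑ j, X i j / frobNorm X * (bit (θ i) * bit (θ j) / plantedSize θ) := by
  have hd : p₁ - p₀ ≠ 0 := (sub_pos.2 h).ne'
  rw [corr, frobNorm_signal h.le, frobInner, Finset.sum_div]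
  refine Finset.sum_congr rfl fun i _ => ?_
  rw [Finset.sum_div]
  refine Finset.sum_congr rfl fun j _ => ?_
  rw [signal, show X i j * ((p₁ - p₀) * (bit (θ i) * bit (θ j))) =
    (p₁ - p₀) * (X i j * (bit (θ i) * bit (θ j))) by ring,
    show frobNorm X * ((p₁ - p₀) * plantedSize θ) =
    (p₁ - p₀) * (frobNorm X * plantedSize θ) by ring, mul_div_mul_left _ _ hd]
  rw [div_mul_div_comm]

/-- Only an inequality, because a zero matrix is normalized to zero. -/
lemma sum_sq_normalized_le_one (X : Matrix (Fin n) (Fin n) ℝ) :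
    ∑ i, ∑ j, (X i j / frobNorm X) ^ 2 ≤ 1 := by
  simp only [div_pow, ← Finset.sum_div, ← frobNorm_sq]
  exact div_self_le_one _

lemma sq_double_sum_le (f g : Fin n → Fin n → ℝ) :
    (∑ i, ∑ j, f i j * g i j) ^ 2 ≤ (∑ i, ∑ j, f i j ^ 2) * ∑ i, ∑ j, g i j ^ 2 := by
  simp only [← Fintype.sum_prod_type']
  exact Finset.sum_mul_sq_le_sq_mul_sq _ _ _

/-- Cauchy–Schwarz for iterated expectations. -/
lemma sq_expect_expect_mul_le {α β : Type} [Fintype α] [Fintype β] {P : α → ℝ} {Q : β → ℝ}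
    (hP : IsLaw P) (hQ : IsLaw Q) (f g : α → β → ℝ) :
    expect P (fun x => expect Q fun y => f x y * g x y) ^ 2 ≤
      expect P (fun x => expect Q fun y => f x y ^ 2) *
        expect P fun x => expect Q fun y => g x y ^ 2 := by
  have hprod : ∀ F : α → β → ℝ, expect P (fun x => expect Q fun y => F x y) =
      expect (fun z : α × β => P z.1 * Q z.2) fun z => F z.1 z.2 := by
    intro F
    simp only [expect, Fintype.sum_prod_type, Finset.mul_sum, mul_assoc]
  have hlaw : IsLaw fun z : α × β => P z.1 * Q z.2 :=
    ⟨fun z => mul_nonneg (hP.nonneg _) (hQ.nonneg _), by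
      rw [Fintype.sum_prod_type]
      simp [← Finset.mul_sum, hQ.sum_eq_one, hP.sum_eq_one]⟩
  rw [hprod, hprod, hprod]
  exact sq_expect_mul_le hlaw _ _

/-- Likelihood ratio of the graph given `θ` with respect to the Erdős–Rényi law. -/
def likelihood (p₀ p₁ : ℝ) (θ : Fin n → Bool) (Y : Edge n → Bool) : ℝ :=
  ∏ e, bern (p₀ + (p₁ - p₀) * pairBit θ e) (Y e) / bern p₀ (Y e)

lemma graphLawGiven_eq {p₀ : ℝ} (h0 : 0 < p₀) (h1 : p₀ < 1) (p₁ : ℝ) (θ : Fin n → Bool)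
    (Y : Edge n → Bool) :
    graphLawGiven p₀ p₁ θ Y = nullLaw p₀ n Y * likelihood p₀ p₁ θ Y := by
  rw [graphLawGiven, nullLaw, prodBern, prodBern, likelihood, ← Finset.prod_mul_distrib]
  refine Finset.prod_congr rfl fun e _ => ?_
  have hb : bern p₀ (Y e) ≠ 0 := by
    cases Y e <;> simp [bern, h0.ne', (sub_pos.2 h1).ne']
  rw [mul_div_cancel₀ _ hb, pairBit]

/-- Under the null law the edges are independent, and each centred likelihood factor has covariance
`λ²` times the two indicators. -/
lemma expect_likelihood_mul {p₀ : ℝ} (h0 : 0 < p₀) (h1 : p₀ < 1) (p₁ : ℝ)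
    (θ θ' : Fin n → Bool) :
    expect (nullLaw p₀ n) (fun Y => likelihood p₀ p₁ θ Y * likelihood p₀ p₁ θ' Y) =
      ∏ e, (1 + snr p₀ p₁ ^ 2 * (pairBit θ e * pairBit θ' e)) := by
  simp only [likelihood, ← Finset.prod_mul_distrib]
  rw [nullLaw, expect_prodBern_prod (fun _ => p₀) fun e b =>
    bern (p₀ + (p₁ - p₀) * pairBit θ e) b / bern p₀ b *
      (bern (p₀ + (p₁ - p₀) * pairBit θ' e) b / bern p₀ b)]
  refine Finset.prod_congr rfl fun e _ => ?_
  have h1' : 1 - p₀ ≠ 0 := (sub_pos.2 h1).ne'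
  rw [snr, div_pow, Real.sq_sqrt (mul_pos h0 (sub_pos.2 h1)).le]
  simp only [bern, if_true, Bool.false_eq_true, if_false]
  field_simp
  ring

lemma overlap_le_plantedSize (θ θ' : Fin n → Bool) : overlap θ θ' ≤ plantedSize θ :=
  Finset.sum_le_sum fun _ _ => mul_le_of_le_one_right (bit_nonneg _) (bit_le_one _)

lemma overlap_comm (θ θ' : Fin n → Bool) : overlap θ θ' = overlap θ' θ :=
  Finset.sum_congr rfl fun _ _ => mul_comm _ _

lemma plantedSize_le (θ : Fin n → Bool) : plantedSize θ ≤ n :=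
  (Finset.sum_le_sum fun _ _ => bit_le_one _).trans_eq (by simp)

/-- No estimator correlates with the signal when `λ ρ n` is bounded. -/
lemma meanCorr_pow_four_le {p₀ p₁ ρ : ℝ} (A : Estimator n) (h0 : 0 < p₀) (h01 : p₀ ≤ p₁)
    (h1 : p₁ < 1) (hρ0 : 0 ≤ ρ) (hρ1 : ρ ≤ 1) (hA : IsLaw A.prog.coinLaw)
    (hsnr : 2 * (snr p₀ p₁ ^ 2 * n) ≤ 1) :
    A.meanCorr p₀ p₁ ρ ^ 4 ≤ ρ * Real.exp (4 * (snr p₀ p₁ ^ 2 * n ^ 2 * ρ ^ 2)) := by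
  have hp0 : p₀ < 1 := h01.trans_lt h1
  have hθ := isLaw_signal (n := n) hρ0 hρ1
  rcases h01.eq_or_lt with rfl | hlt
  · have : A.meanCorr p₀ p₀ ρ = 0 := by
      simp [Estimator.meanCorr, corr_signal_self, expect]
    rw [this, zero_pow four_ne_zero]
    positivity
  have hQ : IsLaw (nullLaw p₀ n) := isLaw_prodBern (fun _ => h0.le) fun _ => hp0.le
  set Pθ := prodBern fun _ : Fin n => ρ with hPθ
  set a := snr p₀ p₁ ^ 2 with ha
  have ha0 : 0 ≤ a := sq_nonneg _
  let v : (Fin n → Bool) → Fin n → Fin n → ℝ := fun θ i j => bit (θ i) * bit (θ j) / plantedSize θ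
  let H : (Edge n → Bool) → Fin n → Fin n → ℝ := fun Y i j =>
    expect Pθ fun θ => likelihood p₀ p₁ θ Y * v θ i j
  let X : (Edge n → Bool) → (Fin A.prog.time → Bool) → Fin n → Fin n → ℝ := fun Y ω i j =>
    A.output Y ω i j / frobNorm (A.output Y ω)
  -- A change of measure to the null law: the estimator then sees a graph independent of `θ`, and
  -- all dependence on the signal sits in the likelihood-weighted average `H` of the normalized
  -- signals.
  have hmean : A.meanCorr p₀ p₁ ρ = expect (nullLaw p₀ n) fun Y =>
      expect A.prog.coinLaw fun ω => ∑ i, ∑ j, X Y ω i j * H Y i j := by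
    have e1 : A.meanCorr p₀ p₁ ρ = expect Pθ fun θ => expect (nullLaw p₀ n) fun Y =>
        expect A.prog.coinLaw fun ω =>
          ∑ i, ∑ j, X Y ω i j * (likelihood p₀ p₁ θ Y * v θ i j) := by
      rw [Estimator.meanCorr]
      congr 1; funext θ
      rw [expect, expect]
      refine Finset.sum_congr rfl fun Y _ => ?_
      rw [graphLawGiven_eq h0 hp0, mul_assoc]
      congr 1
      rw [← expect_const_mul]
      congr 1; funext ω
      rw [corr_signal hlt, Finset.mul_sum]
      refine Finset.sum_congr rfl fun i _ => ?_
      rw [Finset.mul_sum]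
      exact Finset.sum_congr rfl fun j _ => by simp only [X, v]; ring
    rw [e1, expect_comm]
    congr 1; funext Y
    rw [expect_comm]
    congr 1; funext ω
    simp only [expect_sum, expect_const_mul, H]
  -- The normalized output has norm at most `1`, so by Cauchy–Schwarz no estimator does better than
  -- the norm of `H`.
  have hsq : A.meanCorr p₀ p₁ ρ ^ 2 ≤ expect (nullLaw p₀ n) fun Y => ∑ i, ∑ j, H Y i j ^ 2 := by
    rw [hmean]
    refine (sq_expect_le hQ _).trans (expect_mono hQ fun Y => ?_)
    refine (sq_expect_le hA _).trans (expect_le_of_le hA fun ω => ?_)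
    refine (sq_double_sum_le _ _).trans (mul_le_of_le_one_left ?_ (sum_sq_normalized_le_one _))
    exact Finset.sum_nonneg fun _ _ => Finset.sum_nonneg fun _ _ => sq_nonneg _
  have hH : expect (nullLaw p₀ n) (fun Y => ∑ i, ∑ j, H Y i j ^ 2) =
      expect Pθ fun θ => expect Pθ fun θ' =>
        (∏ e, (1 + a * (pairBit θ e * pairBit θ' e))) *
          (overlap θ θ' ^ 2 / (plantedSize θ * plantedSize θ')) := by
    have e1 : ∀ Y, ∑ i, ∑ j, H Y i j ^ 2 = expect Pθ fun θ => expect Pθ fun θ' =>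
        (likelihood p₀ p₁ θ Y * likelihood p₀ p₁ θ' Y) * ∑ i, ∑ j, v θ i j * v θ' i j := by
      intro Y
      simp only [Finset.mul_sum, expect_sum]
      refine Finset.sum_congr rfl fun i _ => Finset.sum_congr rfl fun j _ => ?_
      simp only [H]
      rw [sq, ← expect_mul_const]
      congr 1; funext θ
      rw [← expect_const_mul]
      congr 1; funext θ'
      ring
    simp only [e1]
    rw [expect_comm]
    congr 1; funext θ
    rw [expect_comm]
    congr 1; funext θ'
    rw [expect_mul_const, expect_likelihood_mul h0 hp0]
    congr 1
    simp only [v, overlap, sq, Finset.sum_mul_sum, Finset.sum_div]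
    exact Finset.sum_congr rfl fun i _ => Finset.sum_congr rfl fun j _ => by
      rw [div_mul_div_comm]; ring
  set r : (Fin n → Bool) → (Fin n → Bool) → ℝ := fun θ θ' => overlap θ θ' / plantedSize θ with hr
  have hr0 : ∀ θ θ', 0 ≤ r θ θ' := fun θ θ' =>
    div_nonneg (overlap_nonneg _ _) (plantedSize_nonneg _)
  have hr1 : ∀ θ θ', r θ θ' ≤ 1 := fun θ θ' =>
    div_le_one_of_le₀ (overlap_le_plantedSize _ _) (plantedSize_nonneg _)
  have hpt : ∀ θ θ' : Fin n → Bool, (∏ e, (1 + a * (pairBit θ e * pairBit θ' e))) *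
      (overlap θ θ' ^ 2 / (plantedSize θ * plantedSize θ')) ≤
      Real.exp (a * n * overlap θ θ') * r θ θ' := by
    intro θ θ'
    have hov := overlap_nonneg θ θ'
    have b1 : ∏ e, (1 + a * (pairBit θ e * pairBit θ' e)) ≤ Real.exp (a * n * overlap θ θ') := by
      calc ∏ e, (1 + a * (pairBit θ e * pairBit θ' e))
          ≤ ∏ e, Real.exp (a * (pairBit θ e * pairBit θ' e)) := by
            refine Finset.prod_le_prod (fun e _ => ?_) fun e _ => ?_
            · have := mul_nonneg ha0 (mul_nonneg (pairBit_nonneg θ e) (pairBit_nonneg θ' e))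
              linarith
            · linarith [Real.add_one_le_exp (a * (pairBit θ e * pairBit θ' e))]
        _ = Real.exp (a * ∑ e, pairBit θ e * pairBit θ' e) := by
            rw [← Real.exp_sum, Finset.mul_sum]
        _ ≤ _ := by
            refine Real.exp_le_exp.2 ?_
            rw [mul_assoc]
            refine mul_le_mul_of_nonneg_left ?_ ha0
            refine (sum_pairBit_mul_le θ θ').trans ?_
            rw [sq]
            exact mul_le_mul_of_nonneg_right
              ((overlap_le_plantedSize _ _).trans (plantedSize_le _)) hov
    have b2 : overlap θ θ' ^ 2 / (plantedSize θ * plantedSize θ') ≤ r θ θ' := by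
      rw [sq, ← div_mul_div_comm]
      refine mul_le_of_le_one_right (hr0 θ θ') ?_
      rw [overlap_comm]
      exact hr1 θ' θ
    exact mul_le_mul b1 b2 (div_nonneg (sq_nonneg _)
      (mul_nonneg (plantedSize_nonneg _) (plantedSize_nonneg _))) (Real.exp_pos _).le
  have hB : A.meanCorr p₀ p₁ ρ ^ 2 ≤ expect Pθ fun θ => expect Pθ fun θ' =>
      Real.exp (a * n * overlap θ θ') * r θ θ' :=
    (hsq.trans_eq hH).trans (expect_mono hθ fun θ => expect_mono hθ fun θ' => hpt θ θ')
  -- Since `0 ≤ r ≤ 1`, the second moment is at most the mean. Given `θ`, the fraction of its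
  -- planted vertices shared with `θ'` has mean at most `ρ`; it is zero by convention when `θ` is
  -- empty.
  have hr2 : expect Pθ (fun θ => expect Pθ fun θ' => r θ θ' ^ 2) ≤ ρ := by
    refine expect_le_of_le hθ fun θ => ?_
    have e1 : expect Pθ (fun θ' => r θ θ') = ρ * (plantedSize θ / plantedSize θ) := by
      simp only [hr, overlap, Finset.sum_div, expect_sum]
      rw [plantedSize, Finset.sum_div, Finset.mul_sum]
      refine Finset.sum_congr rfl fun i _ => ?_
      rw [hPθ, expect_prodBern_single (fun _ => ρ) i
        fun b => bit (θ i) * bit b / ∑ i, bit (θ i)]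
      simp [bit]
    calc expect Pθ (fun θ' => r θ θ' ^ 2) ≤ expect Pθ (fun θ' => r θ θ') :=
          expect_mono hθ fun θ' => pow_le_of_le_one (hr0 _ _) (hr1 _ _) two_ne_zero
      _ = _ := e1
      _ ≤ ρ := mul_le_of_le_one_right hρ0 (div_self_le_one _)
  have hexp : expect Pθ (fun θ => expect Pθ fun θ' => Real.exp (a * n * overlap θ θ') ^ 2) ≤
      Real.exp (4 * (a * n ^ 2 * ρ ^ 2)) := by
    have e1 : ∀ θ θ' : Fin n → Bool, Real.exp (a * n * overlap θ θ') ^ 2 =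
        Real.exp (2 * (a * n) * overlap θ θ') := by
      intro θ θ'
      rw [← Real.exp_nat_mul]; push_cast; ring_nf
    simp only [e1]
    have ht : 0 ≤ 2 * (a * n) := by positivity
    refine (expect_exp_overlap_le ht).trans (Real.exp_le_exp.2 ?_)
    have := mul_le_mul_of_nonneg_left (exp_sub_one_le_two_mul ht hsnr)
      (show 0 ≤ n * ρ ^ 2 by positivity)
    linarith
  have hB0 : 0 ≤ A.meanCorr p₀ p₁ ρ ^ 2 := sq_nonneg _
  calc A.meanCorr p₀ p₁ ρ ^ 4 = (A.meanCorr p₀ p₁ ρ ^ 2) ^ 2 := by ring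
    _ ≤ (expect Pθ fun θ => expect Pθ fun θ' =>
        Real.exp (a * n * overlap θ θ') * r θ θ') ^ 2 := pow_le_pow_left₀ hB0 hB 2
    _ ≤ _ := sq_expect_expect_mul_le hθ hθ _ _
    _ ≤ Real.exp (4 * (a * n ^ 2 * ρ ^ 2)) * ρ :=
        mul_le_mul hexp hr2 (expect_nonneg hθ fun _ => expect_nonneg hθ fun _ => sq_nonneg _)
          (Real.exp_pos _).le
    _ = _ := mul_comm _ _

end Information

/-! ## Composition of programs -/

section Programs

variable {ι κ : Type}

lemma Instr.bias_nonneg (I : Instr ι) : 0 ≤ I.bias := by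
  cases I with
  | coin q => exact q.2.1
  | _ => exact le_rfl

lemma Instr.bias_le_one (I : Instr ι) : I.bias ≤ 1 := by
  cases I with
  | coin q => exact q.2.2
  | _ => exact zero_le_one

lemma Program.isLaw_coinLaw (C : Program ι) : IsLaw C.coinLaw :=
  isLaw_prodBern (fun _ => Instr.bias_nonneg _) fun _ => Instr.bias_le_one _

/-- Append a block of instructions to a program. -/
def Program.append (C : Program ι) {t : ℕ} (f : Fin t → Instr ι) : Program ι :=
  ⟨C.time + t, Fin.append C.instr f⟩

/-- The coin outcomes of the first instructions. -/
def restrictCoins {s t : ℕ} (h : s ≤ t) (ω : Fin t → Bool) : Fin s → Bool :=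
  fun i => ω (Fin.castLE h i)

lemma Program.result_of_le (C : Program ι) (x : ι → Bool) (ω : Fin C.time → Bool) {t : ℕ}
    (h : C.time ≤ t) : C.result x ω t = 0 := by
  rw [Program.result, dif_neg (not_lt.2 h)]

lemma Program.result_of_lt (C : Program ι) (x : ι → Bool) (ω : Fin C.time → Bool) {t : ℕ}
    (h : t < C.time) : C.result x ω t = (C.instr ⟨t, h⟩).eval x (ω ⟨t, h⟩)
      (fun j => if _hj : j < t then C.result x ω j else 0) := by
  rw [Program.result, dif_pos h]

lemma Program.result_append_left (C : Program ι) {t : ℕ} (f : Fin t → Instr ι) (x : ι → Bool)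
    (ω : Fin (C.time + t) → Bool) :
    ∀ s, s < C.time → (C.append f).result x ω s =
      C.result x (restrictCoins (Nat.le_add_right _ _) ω) s := by
  intro s
  induction s using Nat.strong_induction_on with
  | _ s ih =>
    intro hs
    rw [C.result_of_lt x _ hs]
    refine ((C.append f).result_of_lt x ω (show s < C.time + t by omega)).trans ?_
    have hi : (C.append f).instr ⟨s, show s < C.time + t by omega⟩ = C.instr ⟨s, hs⟩ :=
      Fin.append_left C.instr f ⟨s, hs⟩
    rw [hi]
    have hmem : (fun j => if _hj : j < s then (C.append f).result x ω j else 0) =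
        fun j => if _hj : j < s then
          C.result x (restrictCoins (Nat.le_add_right _ _) ω) j else 0 := by
      funext j
      split_ifs with hj
      · exact ih j hj (hj.trans hs)
      · rfl
    rw [hmem]
    rfl

/-- Appended instructions read the memory of the combined program, not a fresh one; relocation of
references compensates for this shift. -/
lemma Program.result_append_right (C : Program ι) {t : ℕ} (f : Fin t → Instr ι) (x : ι → Bool)
    (ω : Fin (C.time + t) → Bool) (s : Fin t) :
    (C.append f).result x ω (C.time + s) = (f s).eval x (ω (Fin.natAdd C.time s))
      (fun j => if j < C.time + s then (C.append f).result x ω j else 0) := by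
  refine ((C.append f).result_of_lt x ω (show C.time + (s : ℕ) < C.time + t by omega)).trans ?_
  have hi : (C.append f).instr ⟨C.time + s, show C.time + (s : ℕ) < C.time + t by omega⟩ = f s :=
    Fin.append_right C.instr f s
  rw [hi]
  rfl

lemma Program.expect_coinLaw_append (C : Program ι) {t : ℕ} (f : Fin t → Instr ι)
    (F : (Fin (C.time + t) → Bool) → ℝ) :
    expect (C.append f).coinLaw F = expect C.coinLaw fun ω₁ =>
      expect (prodBern fun s => (f s).bias) fun ω₂ => F (Fin.append ω₁ ω₂) := by
  simp only [expect, Finset.mul_sum]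
  rw [← Fintype.sum_prod_type']
  refine (Fintype.sum_equiv (Fin.appendEquiv C.time t) _ _ fun z => ?_).symm
  obtain ⟨ω₁, ω₂⟩ := z
  have h : (C.append f).coinLaw (Fin.append ω₁ ω₂ : Fin (C.time + t) → Bool) =
      C.coinLaw ω₁ * prodBern (fun s => (f s).bias) ω₂ := by
    have h1 : (C.append f).coinLaw (Fin.append ω₁ ω₂ : Fin (C.time + t) → Bool) =
      ∏ s : Fin (C.time + t), bern ((Fin.append C.instr f s).bias) (Fin.append ω₁ ω₂ s) := rfl
    rw [h1, Fin.prod_univ_add]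
    simp [Program.coinLaw, prodBern]
  rw [← mul_assoc, ← h]
  rfl

lemma restrictCoins_append {s t : ℕ} (ω₁ : Fin s → Bool) (ω₂ : Fin t → Bool) :
    restrictCoins (Nat.le_add_right s t) (Fin.append ω₁ ω₂) = ω₁ := by
  funext i
  exact Fin.append_left ω₁ ω₂ i

/-- Shift the references of an instruction by `off` and replace its inputs. -/
def Instr.relocate (off : ℕ) (g : ι → Instr κ) : Instr ι → Instr κ
  | const a => const a
  | input i => g i
  | coin q => coin q
  | add j k => add (off + j) (off + k)
  | sub j k => sub (off + j) (off + k)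
  | mul j k => mul (off + j) (off + k)
  | div j k => div (off + j) (off + k)
  | le j k => le (off + j) (off + k)

lemma Instr.bias_relocate (off : ℕ) {g : ι → Instr κ} (hg : ∀ i, (g i).bias = 0) (I : Instr ι) :
    (I.relocate off g).bias = I.bias := by
  cases I with
  | input i => exact hg i
  | _ => rfl

/-- Append a second program whose inputs are computed from the results of the first one. -/
def Program.appendProgram (C : Program κ) (B : Program ι) (g : ι → Instr κ) : Program κ :=
  C.append fun s => (B.instr s).relocate C.time g

/-- The hypothesis `hg` asks only that each replaced input instruction produce the right bit
whenever the memory agrees with the first program on its own range. Strong induction on time then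
matches the relocated program with the original one. -/
lemma Program.result_appendProgram (C : Program κ) (B : Program ι) (g : ι → Instr κ)
    (x : κ → Bool) (x' : ι → Bool) (ω : Fin (C.time + B.time) → Bool)
    (hg : ∀ i b mem, (∀ j, j < C.time → mem j =
      C.result x (restrictCoins (Nat.le_add_right _ _) ω) j) → (g i).eval x b mem = bit (x' i)) :
    ∀ s, (C.appendProgram B g).result x ω (C.time + s) =
      B.result x' (fun i => ω (Fin.natAdd C.time i)) s := by
  intro s
  induction s using Nat.strong_induction_on with
  | _ s ih =>
    by_cases hs : s < B.time
    · have h := C.result_append_right (fun s => (B.instr s).relocate C.time g) x ω ⟨s, hs⟩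
      refine h.trans (Eq.trans ?_ (B.result_of_lt x' _ hs).symm)
      have hmem : ∀ j, (if C.time + j < C.time + s then
          (C.append fun s => (B.instr s).relocate C.time g).result x ω (C.time + j) else 0) =
          if _hj : j < s then B.result x' (fun i => ω (Fin.natAdd C.time i)) j else 0 := by
        intro j
        by_cases hj : j < s
        · rw [if_pos (by omega), dif_pos hj]; exact ih j hj
        · rw [if_neg (by omega), dif_neg hj]
      cases hI : B.instr ⟨s, hs⟩ with
      | const a => rfl
      | input i =>
        refine hg i _ _ fun j hj => ?_
        rw [if_pos (by simp; omega)]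
        exact C.result_append_left _ x ω j hj
      | coin q => rfl
      | add j k => exact congrArg₂ (fun a b : ℝ => a + b) (hmem j) (hmem k)
      | sub j k => exact congrArg₂ (fun a b : ℝ => a - b) (hmem j) (hmem k)
      | mul j k => exact congrArg₂ (fun a b : ℝ => a * b) (hmem j) (hmem k)
      | div j k => exact congrArg₂ (fun a b : ℝ => a / b) (hmem j) (hmem k)
      | le j k =>
        exact congrArg₂ (fun a b : ℝ => if a ≤ b then (1 : ℝ) else 0) (hmem j) (hmem k)
    · rw [B.result_of_le _ _ (not_lt.1 hs)]
      exact Program.result_of_le _ _ _ (show C.time + B.time ≤ C.time + s by omega)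

lemma Program.expect_coinLaw_appendProgram (C : Program κ) (B : Program ι) {g : ι → Instr κ}
    (hg : ∀ i, (g i).bias = 0) (F : (Fin (C.time + B.time) → Bool) → ℝ) :
    expect (C.appendProgram B g).coinLaw F = expect C.coinLaw fun ω₁ =>
      expect B.coinLaw fun ω₂ => F (Fin.append ω₁ ω₂) := by
  refine (C.expect_coinLaw_append _ F).trans ?_
  simp only [Instr.bias_relocate _ hg]
  rfl

/-- `C'` extends `C` by further instructions. -/
structure Program.Extends (C C' : Program ι) : Prop where
  le : C.time ≤ C'.time
  result_eq : ∀ x (ω : Fin C'.time → Bool) j, j < C.time →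
    C'.result x ω j = C.result x (restrictCoins le ω) j
  expect_eq : ∀ F : (Fin C.time → Bool) → ℝ,
    expect C'.coinLaw (fun ω => F (restrictCoins le ω)) = expect C.coinLaw F

lemma Program.Extends.refl (C : Program ι) : C.Extends C :=
  ⟨le_rfl, fun _ _ _ _ => rfl, fun _ => rfl⟩

lemma Program.Extends.trans {C₁ C₂ C₃ : Program ι} (h : C₁.Extends C₂)
    (h' : C₂.Extends C₃) : C₁.Extends C₃ :=
  ⟨h.le.trans h'.le,
    fun x ω j hj => (h'.result_eq x ω j (hj.trans_le h.le)).trans (h.result_eq x _ j hj),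
    fun F => (h'.expect_eq fun ω => F (restrictCoins h.le ω)).trans (h.expect_eq F)⟩

/-- Appending one instruction. -/
lemma Program.exists_extends_instr (C : Program ι) (I : Instr ι) :
    ∃ C' : Program ι, C.Extends C' ∧ C'.time = C.time + 1 ∧
      ∀ x (ω : Fin C'.time → Bool), ∃ b, C'.result x ω C.time =
        I.eval x b (fun j => if j < C.time then C'.result x ω j else 0) := by
  refine ⟨C.append fun _ : Fin 1 => I, ⟨Nat.le_add_right _ _, ?_, ?_⟩, rfl, ?_⟩
  · exact fun x ω j hj => C.result_append_left _ x ω j hj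
  · intro F
    refine (C.expect_coinLaw_append (fun _ : Fin 1 => I) _).trans ?_
    congr 1
    funext ω₁
    have hlaw : IsLaw (prodBern fun _ : Fin 1 => I.bias) :=
      isLaw_prodBern (fun _ => I.bias_nonneg) fun _ => I.bias_le_one
    refine Eq.trans ?_ (expect_const hlaw (F ω₁))
    congr 1
    funext ω₂
    exact congrArg F (restrictCoins_append ω₁ ω₂)
  · intro x ω
    exact ⟨_, C.result_append_right (fun _ : Fin 1 => I) x ω 0⟩

/-- Arithmetic expressions in the results of earlier instructions. -/
inductive Arith : Type
  | loc (t : ℕ)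
  | const (a : ℝ)
  | add (e f : Arith)
  | sub (e f : Arith)
  | mul (e f : Arith)
  | le (e f : Arith)

namespace Arith

/-- Value of an expression. -/
def eval (mem : ℕ → ℝ) : Arith → ℝ
  | loc t => mem t
  | const a => a
  | add e f => e.eval mem + f.eval mem
  | sub e f => e.eval mem - f.eval mem
  | mul e f => e.eval mem * f.eval mem
  | le e f => if e.eval mem ≤ f.eval mem then 1 else 0

/-- Number of instructions that compute an expression. -/
def size : Arith → ℕ
  | loc _ => 0
  | const _ => 1
  | add e f => e.size + f.size + 1
  | sub e f => e.size + f.size + 1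
  | mul e f => e.size + f.size + 1
  | le e f => e.size + f.size + 1

/-- All references of the expression are below `T`. -/
def Bounded (T : ℕ) : Arith → Prop
  | loc t => t < T
  | const _ => True
  | add e f => e.Bounded T ∧ f.Bounded T
  | sub e f => e.Bounded T ∧ f.Bounded T
  | mul e f => e.Bounded T ∧ f.Bounded T
  | le e f => e.Bounded T ∧ f.Bounded T

lemma Bounded.mono {T T' : ℕ} (h : T ≤ T') : ∀ {e : Arith}, e.Bounded T → e.Bounded T'
  | loc _, he => lt_of_lt_of_le he h
  | const _, _ => trivial
  | add _ _, he => ⟨he.1.mono h, he.2.mono h⟩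
  | sub _ _, he => ⟨he.1.mono h, he.2.mono h⟩
  | mul _ _, he => ⟨he.1.mono h, he.2.mono h⟩
  | le _ _, he => ⟨he.1.mono h, he.2.mono h⟩

lemma eval_congr {T : ℕ} {m m' : ℕ → ℝ} (h : ∀ j, j < T → m j = m' j) :
    ∀ {e : Arith}, e.Bounded T → e.eval m = e.eval m'
  | loc _, he => h _ he
  | const _, _ => rfl
  | add _ _, he => by simp only [eval, eval_congr h he.1, eval_congr h he.2]
  | sub _ _, he => by simp only [eval, eval_congr h he.1, eval_congr h he.2]
  | mul _ _, he => by simp only [eval, eval_congr h he.1, eval_congr h he.2]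
  | le _ _, he => by simp only [eval, eval_congr h he.1, eval_congr h he.2]

end Arith

/-- `C'` extends `C` and computes the expression `e` at the place `out`. -/
structure Program.Computes (C C' : Program ι) (e : Arith) (out : ℕ) : Prop where
  ext : C.Extends C'
  time_eq : C'.time = C.time + e.size
  out_lt : out < C'.time
  result_eq : ∀ x (ω : Fin C'.time → Bool),
    C'.result x ω out = e.eval (C.result x (restrictCoins ext.le ω))

/-- The common induction step of all binary operations: compute `e`, then `f` after it, then
combine. The value of `f` is unaffected since it refers only to the original program. -/
lemma Program.exists_computes_binary (C : Program ι) {e f : Arith}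
    (he : e.Bounded C.time) (hf : f.Bounded C.time)
    (ihe : ∀ C : Program ι, e.Bounded C.time → ∃ C' out, C.Computes C' e out)
    (ihf : ∀ C : Program ι, f.Bounded C.time → ∃ C' out, C.Computes C' f out)
    (I : ℕ → ℕ → Instr ι)
    (op : ℝ → ℝ → ℝ) (hop : ∀ j k x b mem, (I j k).eval x b mem = op (mem j) (mem k)) :
    ∃ (C' : Program ι) (out : ℕ) (h : C.Extends C'), C'.time = C.time + (e.size + f.size + 1) ∧
      out < C'.time ∧ ∀ x (ω : Fin C'.time → Bool), C'.result x ω out =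
        op (e.eval (C.result x (restrictCoins h.le ω)))
          (f.eval (C.result x (restrictCoins h.le ω))) := by
  obtain ⟨C₁, o₁, h₁⟩ := ihe C he
  obtain ⟨C₂, o₂, h₂⟩ := ihf C₁ (hf.mono h₁.ext.le)
  obtain ⟨C₃, h₃, ht₃, hr₃⟩ := C₂.exists_extends_instr (I o₁ o₂)
  refine ⟨C₃, C₂.time, (h₁.ext.trans h₂.ext).trans h₃, ?_, by omega, fun x ω => ?_⟩
  · rw [ht₃, h₂.time_eq, h₁.time_eq]; omega
  · obtain ⟨b, hb⟩ := hr₃ x ω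
    have ho₁ : o₁ < C₂.time := h₁.out_lt.trans_le h₂.ext.le
    rw [hb, hop, if_pos ho₁, if_pos h₂.out_lt, h₃.result_eq x ω o₁ ho₁,
      h₃.result_eq x ω o₂ h₂.out_lt, h₂.result_eq, h₂.ext.result_eq x _ o₁ h₁.out_lt, h₁.result_eq]
    congr 1
    exact Arith.eval_congr (fun j hj => h₁.ext.result_eq x _ j hj) hf

/-- Every expression can be computed. -/
lemma Program.exists_computes (e : Arith) :
    ∀ C : Program ι, e.Bounded C.time → ∃ C' out, C.Computes C' e out := by
  induction e with
  | loc t => exact fun C ht => ⟨C, t, .refl C, rfl, ht, fun _ _ => rfl⟩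
  | const a =>
    intro C _
    obtain ⟨C', h, ht, hr⟩ := C.exists_extends_instr (Instr.const a)
    refine ⟨C', C.time, h, ht, by omega, fun x ω => ?_⟩
    obtain ⟨b, hb⟩ := hr x ω
    exact hb
  | add e f ihe ihf =>
    intro C h
    obtain ⟨C', out, hx, ht, ho, hr⟩ := C.exists_computes_binary h.1 h.2 ihe ihf Instr.add
      (fun a b => a + b) fun _ _ _ _ _ => rfl
    exact ⟨C', out, hx, ht, ho, hr⟩
  | sub e f ihe ihf =>
    intro C h
    obtain ⟨C', out, hx, ht, ho, hr⟩ := C.exists_computes_binary h.1 h.2 ihe ihf Instr.sub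
      (fun a b => a - b) fun _ _ _ _ _ => rfl
    exact ⟨C', out, hx, ht, ho, hr⟩
  | mul e f ihe ihf =>
    intro C h
    obtain ⟨C', out, hx, ht, ho, hr⟩ := C.exists_computes_binary h.1 h.2 ihe ihf Instr.mul
      (fun a b => a * b) fun _ _ _ _ _ => rfl
    exact ⟨C', out, hx, ht, ho, hr⟩
  | le e f ihe ihf =>
    intro C h
    obtain ⟨C', out, hx, ht, ho, hr⟩ := C.exists_computes_binary h.1 h.2 ihe ihf Instr.le
      (fun a b => if a ≤ b then 1 else 0) fun _ _ _ _ _ => rfl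
    exact ⟨C', out, hx, ht, ho, hr⟩

end Programs

/-! ## Testing all samples of the hidden sample problem -/

section HiddenTest

variable {ι : Type}

/-- Probability, over the coins, that the test outputs `1` on the input `x`. -/
def Test.coinAccept (B : Test ι) (x : ι → Bool) : ℝ :=
  expect B.prog.coinLaw fun ω => if B.prog.result x ω B.out = 1 then 1 else 0

lemma Test.coinAccept_nonneg (B : Test ι) (x : ι → Bool) : 0 ≤ B.coinAccept x :=
  expect_nonneg B.prog.isLaw_coinLaw fun ω => by positivity

lemma Test.coinAccept_le_one (B : Test ι) (x : ι → Bool) : B.coinAccept x ≤ 1 :=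
  expect_le_of_le B.prog.isLaw_coinLaw fun ω => by split_ifs <;> norm_num

/-- The test is applied to the first `j` samples; the result is `1` if it always outputs `0`. -/
lemma Test.exists_rejection_program (B : Test ι) (hB : B.out < B.prog.time) (M : ℕ) :
    ∀ j, j ≤ M → ∃ (C : Program (Fin M × ι)) (out : ℕ), out < C.time ∧
      C.time = j * (B.prog.time + 8) + 1 ∧
      (∀ x ω, C.result x ω out = 0 ∨ C.result x ω out = 1) ∧
      ∀ x, expect C.coinLaw (fun ω => C.result x ω out) =
        ∏ i : Fin M with i.val < j, (1 - B.coinAccept fun e => x (i, e)) := by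
  intro j
  induction j with
  | zero =>
    intro _
    have hres : ∀ x ω, Program.result (⟨1, fun _ => Instr.const 1⟩ : Program (Fin M × ι)) x ω 0 =
        1 := fun x ω => (Program.result_of_lt _ x ω Nat.zero_lt_one)
    refine ⟨⟨1, fun _ => Instr.const 1⟩, 0, Nat.zero_lt_one, by simp, fun x ω => Or.inr (hres x ω),
      fun x => ?_⟩
    simp only [hres, expect_const (Program.isLaw_coinLaw _)]
    simp
  | succ j ih =>
    intro hj
    obtain ⟨C, out, ho, ht, h01, hE⟩ := ih (by omega)
    let jj : Fin M := ⟨j, by omega⟩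
    let g : ι → Instr (Fin M × ι) := fun i => Instr.input (jj, i)
    set C₁ := C.appendProgram B.prog g with hC₁
    have hC₁t : C₁.time = C.time + B.prog.time := rfl
    let r := C.time + B.out
    -- The running flag is multiplied by one minus the indicator that the answer on the new sample
    -- equals `1`. Equality is tested by two comparisons; the expression takes eight instructions,
    -- whence the `+ 8` per sample.
    let e : Arith := .mul (.loc out) (.sub (.const 1)
      (.mul (.le (.loc r) (.const 1)) (.le (.const 1) (.loc r))))
    have heb : e.Bounded C₁.time := by
      have h1 : out < C₁.time := by omega
      have h2 : r < C₁.time := by omega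
      exact ⟨h1, trivial, ⟨h2, trivial⟩, trivial, h2⟩
    have hev : ∀ mem : ℕ → ℝ, e.eval mem = mem out * (1 - if mem r = 1 then 1 else 0) := by
      intro mem
      simp only [e, Arith.eval]
      congr 2
      rcases lt_trichotomy (mem r) 1 with h | h | h
      · simp [h.le, h.ne, h.not_ge]
      · simp [h]
      · simp [h.ne', h.not_ge]
    obtain ⟨C₂, o, h₂⟩ := Program.exists_computes e C₁ heb
    have hleft : ∀ x (ω : Fin (C.time + B.prog.time) → Bool), C₁.result x ω out =
        C.result x (restrictCoins (Nat.le_add_right _ _) ω) out := fun x ω =>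
      C.result_append_left _ x ω out ho
    have hright : ∀ x (ω : Fin (C.time + B.prog.time) → Bool), C₁.result x ω r =
        B.prog.result (fun i => x (jj, i)) (fun i => ω (Fin.natAdd C.time i)) B.out := fun x ω =>
      C.result_appendProgram B.prog g x (fun i => x (jj, i)) ω (fun _ _ _ _ => rfl) B.out
    refine ⟨C₂, o, h₂.out_lt, ?_, fun x ω => ?_, fun x => ?_⟩
    · rw [h₂.time_eq, hC₁t, ht]
      have : e.size = 8 := rfl
      rw [this]; ring
    · have h : C₁.result x (restrictCoins h₂.ext.le ω) out = 0 ∨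
          C₁.result x (restrictCoins h₂.ext.le ω) out = 1 :=
        (h01 x _).imp (hleft x _).trans (hleft x _).trans
      rw [h₂.result_eq, hev]
      rcases h with h | h
      · left; rw [h, zero_mul]
      · rw [h, one_mul]
        split_ifs <;> simp
    · simp only [h₂.result_eq]
      rw [h₂.ext.expect_eq fun ω => e.eval (C₁.result x ω)]
      simp only [hev]
      refine (C.expect_coinLaw_appendProgram B.prog (g := g) (fun _ => rfl) _).trans ?_
      have hfil : (Finset.univ.filter fun i : Fin M => i.val < j + 1) =
          insert jj (Finset.univ.filter fun i : Fin M => i.val < j) := by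
        ext i
        simp only [Finset.mem_filter, Finset.mem_univ, true_and, Finset.mem_insert, jj, Fin.ext_iff]
        omega
      rw [hfil, Finset.prod_insert (by simp [jj]), ← hE x, mul_comm, ← expect_mul_const]
      congr 1
      funext ω₁
      have hω : ∀ ω₂ : Fin B.prog.time → Bool,
          C₁.result x (Fin.append ω₁ ω₂ : Fin (C.time + B.prog.time) → Bool) out *
            (1 - if C₁.result x (Fin.append ω₁ ω₂ : Fin (C.time + B.prog.time) → Bool) r = 1
              then 1 else 0) =
          C.result x ω₁ out *
            (1 - if B.prog.result (fun i => x (jj, i)) ω₂ B.out = 1 then 1 else 0) := by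
        intro ω₂
        rw [hleft, hright, restrictCoins_append]
        have : (fun i => Fin.append ω₁ ω₂ (Fin.natAdd C.time i)) = ω₂ :=
          funext fun i => Fin.append_right ω₁ ω₂ i
        rw [this]
      refine (congrArg (expect B.prog.coinLaw) (funext hω)).trans ?_
      rw [expect_const_mul, expect_sub, expect_const B.prog.isLaw_coinLaw]
      rfl

variable [Fintype ι] [DecidableEq ι]

lemma Test.rejectProb_eq (B : Test ι) (P : (ι → Bool) → ℝ) :
    B.rejectProb P = expect P fun x => 1 - B.coinAccept x := by
  rw [Test.rejectProb]
  congr 1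
  funext x
  rw [Test.coinAccept, ← expect_const B.prog.isLaw_coinLaw 1, ← expect_sub]
  congr 1
  funext ω
  rw [expect_const B.prog.isLaw_coinLaw 1]
  split_ifs <;> simp

/-- A test of `P` against `Q` gives a test of the hidden sample problem. -/
lemma Test.exists_hidden_test (B : Test ι) (hB : B.out < B.prog.time) {M : ℕ} (hM : 0 < M)
    {P Q : (ι → Bool) → ℝ} (hP : IsLaw P) (hQ : IsLaw Q) :
    ∃ A : Test (Fin M × ι), A.prog.time = M * (B.prog.time + 8) + 3 ∧
      A.error (hiddenPlanted M P Q) (hiddenNull M Q) ≤ M * B.acceptProb Q + B.rejectProb P := by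
  obtain ⟨C, out, ho, ht, h01, hE⟩ := B.exists_rejection_program hB M M le_rfl
  obtain ⟨C', o, h'⟩ := Program.exists_computes (.sub (.const 1) (.loc out)) C
    (by simpa [Arith.Bounded] using ho)
  have hM' : (0 : ℝ) < M := Nat.cast_pos.2 hM
  set a := B.coinAccept with ha
  have hrej : ∀ x, 1 - (⟨C', o⟩ : Test (Fin M × ι)).coinAccept x =
      ∏ i : Fin M, (1 - a fun e => x (i, e)) := by
    intro x
    have hfil : (Finset.univ.filter fun i : Fin M => i.val < M) = Finset.univ := by
      ext i; simp
    have h := hE x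
    rw [hfil] at h
    rw [← h, Test.coinAccept]
    simp only [h'.result_eq, Arith.eval]
    rw [h'.ext.expect_eq fun ω => if 1 - C.result x ω out = 1 then 1 else 0,
      ← expect_const C.isLaw_coinLaw 1, ← expect_sub]
    congr 1
    funext ω
    rw [expect_const C.isLaw_coinLaw 1]
    rcases h01 x ω with h | h <;> simp [h]
  have hprod : ∀ R : Fin M → (ι → Bool) → ℝ,
      expect (fun Y => ∏ j, R j fun i => Y (j, i))
        (fun Y : Fin M × ι → Bool => ∏ i : Fin M, (1 - a fun e => Y (i, e))) =
      ∏ j, expect (R j) fun x => 1 - a x := fun R =>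
    sum_hiddenTerm R fun _ x => 1 - a x
  have hQa : expect Q (fun x => 1 - a x) = 1 - B.acceptProb Q := by
    rw [expect_sub, expect_const hQ]; rfl
  have hα0 : 0 ≤ B.acceptProb Q := expect_nonneg hQ fun x => B.coinAccept_nonneg x
  have hα1 : B.acceptProb Q ≤ 1 := expect_le_of_le hQ fun x => B.coinAccept_le_one x
  have hmass : ∑ Y : Fin M × ι → Bool, hiddenNull M Q Y = 1 := by
    have := sum_hiddenTerm (fun _ : Fin M => Q) fun _ _ => (1 : ℝ)
    simpa [hiddenNull, expect_const hQ] using this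
  refine ⟨⟨C', o⟩, ?_, ?_⟩
  · change C'.time = _
    rw [h'.time_eq, ht]
    rfl
  rw [Test.error]
  refine add_le_add ?_ ?_
  · have e1 : (⟨C', o⟩ : Test (Fin M × ι)).acceptProb (hiddenNull M Q) =
        1 - (1 - B.acceptProb Q) ^ M := by
      have e2 : (⟨C', o⟩ : Test (Fin M × ι)).acceptProb (hiddenNull M Q) =
          expect (hiddenNull M Q) fun Y => 1 - ∏ i : Fin M, (1 - a fun e => Y (i, e)) := by
        rw [Test.acceptProb]
        congr 1
        funext Y
        rw [← hrej Y]
        exact (sub_sub_cancel _ _).symm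
      rw [e2, expect_sub]
      congr 1
      · simp [expect, hmass]
      · refine (hprod fun _ => Q).trans ?_
        rw [hQa]; simp
    rw [e1]
    -- Bernoulli's inequality, i.e. the union bound over the `M` null samples.
    have := one_add_mul_le_pow (a := -B.acceptProb Q) (by linarith) M
    rw [← sub_eq_add_neg] at this
    linarith
  · rw [Test.rejectProb_eq, Test.rejectProb_eq]
    simp only [hrej]
    rw [expect_hiddenPlanted]
    -- Rejecting all samples requires rejecting the informative one; the remaining factors are
    -- probabilities.
    have hterm : ∀ κ : Fin M, expect (fun Y => ∏ j, (if j = κ then P else Q) fun i => Y (j, i))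
        (fun Y : Fin M × ι → Bool => ∏ i : Fin M, (1 - a fun e => Y (i, e))) ≤
        expect P fun x => 1 - a x := by
      intro κ
      rw [hprod fun j => if j = κ then P else Q, ← Finset.mul_prod_erase _ _ (Finset.mem_univ κ),
        if_pos rfl]
      refine mul_le_of_le_one_right (expect_nonneg hP fun x =>
        sub_nonneg.2 (B.coinAccept_le_one x)) (Finset.prod_le_one (fun j hj => ?_) fun j hj => ?_)
      · rw [if_neg (Finset.ne_of_mem_erase hj), hQa]; linarith
      · rw [if_neg (Finset.ne_of_mem_erase hj), hQa]; linarith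
    calc (M : ℝ)⁻¹ * ∑ κ : Fin M, _ ≤ (M : ℝ)⁻¹ * ∑ _κ : Fin M, expect P fun x => 1 - a x := by
          gcongr with κ; exact hterm κ
      _ = _ := by
          rw [Finset.sum_const, Finset.card_univ, Fintype.card_fin, nsmul_eq_mul, inv_mul_cancel_left₀ hM'.ne']

end HiddenTest

/-! ## The scan test built from an estimator -/

namespace Arith

/-- Sum of a family of expressions. -/
def sumOver {α : Type} [Fintype α] (f : α → Arith) : Arith :=
  (Finset.univ.toList.map f).foldr Arith.add (.const 0)

variable {α : Type} [Fintype α]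

lemma eval_sumOver (mem : ℕ → ℝ) (f : α → Arith) :
    (sumOver f).eval mem = ∑ a, (f a).eval mem := by
  have h : ∀ l : List α, ((l.map f).foldr Arith.add (.const 0)).eval mem =
      (l.map fun a => (f a).eval mem).sum := by
    intro l
    induction l with
    | nil => rfl
    | cons a l ih => simp only [List.map_cons, List.foldr_cons, List.sum_cons, ← ih]; rfl
  rw [sumOver, h, Finset.sum_map_toList]

lemma size_sumOver_le {f : α → Arith} {s : ℕ} (hf : ∀ a, (f a).size ≤ s) :
    (sumOver f).size ≤ Fintype.card α * (s + 1) + 1 := by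
  have h : ∀ l : List α, ((l.map f).foldr Arith.add (.const 0)).size ≤ l.length * (s + 1) + 1 := by
    intro l
    induction l with
    | nil => simp [size]
    | cons a l ih =>
      simp only [List.map_cons, List.foldr_cons, List.length_cons, size]
      have := hf a
      rw [Nat.succ_mul]
      omega
  simpa [sumOver] using h Finset.univ.toList

lemma bounded_sumOver {f : α → Arith} {T : ℕ} (hf : ∀ a, (f a).Bounded T) :
    (sumOver f).Bounded T := by
  have h : ∀ l : List α, ((l.map f).foldr Arith.add (.const 0)).Bounded T := by
    intro l
    induction l with
    | nil => trivial
    | cons a l ih => exact ⟨hf a, ih⟩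
  exact h _

end Arith

section Scan

variable {n : ℕ}

/-- Remove the entries of `X` that exceed `b` times its Frobenius norm. -/
def truncate (b : ℝ) (X : Matrix (Fin n) (Fin n) ℝ) : Matrix (Fin n) (Fin n) ℝ :=
  fun i j => if X i j * X i j ≤ b ^ 2 * frobInner X X then X i j else 0

/-- Weight of the pair `e` in the scan statistic: pairs with an edge in `Y` have weight zero. -/
def scanWeight (b : ℝ) (X : Matrix (Fin n) (Fin n) ℝ) (Y : Edge n → Bool) (e : Edge n) : ℝ :=
  (1 - bit (Y e)) * (truncate b X e.1.1 e.1.2 + truncate b X e.1.2 e.1.1)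

/-- Correlation of the truncated matrix with the centered edges of `Z` outside `Y`. -/
def scanStat (b q : ℝ) (X : Matrix (Fin n) (Fin n) ℝ) (Y Z : Edge n → Bool) : ℝ :=
  ∑ e, scanWeight b X Y e * (bit (Z e) - q)

/-- The scan test accepts if the scan statistic exceeds `τ` times the norm of `X`. -/
def scanAccept (b q τ : ℝ) (X : Matrix (Fin n) (Fin n) ℝ) (Y Z : Edge n → Bool) : ℝ :=
  if 0 < scanStat b q X Y Z ∧ τ ^ 2 * frobInner X X ≤ scanStat b q X Y Z * scanStat b q X Y Z
  then 1 else 0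

/-- Expression for the squared norm. -/
def normExpr (X : Fin n → Fin n → Arith) : Arith :=
  .sumOver fun i => .sumOver fun j => .mul (X i j) (X i j)

/-- Expression for the truncated matrix. -/
def truncateExpr (b : ℝ) (X : Fin n → Fin n → Arith) (i j : Fin n) : Arith :=
  .mul (.le (.mul (X i j) (X i j)) (.mul (.const (b ^ 2)) (normExpr X))) (X i j)

/-- Expression for the scan statistic. -/
def scanExpr (b q : ℝ) (X : Fin n → Fin n → Arith) (y z : Edge n → Arith) : Arith :=
  .sumOver fun e => .mul (.mul (.sub (.const 1) (y e))
    (.add (truncateExpr b X e.1.1 e.1.2) (truncateExpr b X e.1.2 e.1.1)))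
    (.sub (z e) (.const q))

/-- Expression for the answer of the scan test. -/
def acceptExpr (b q τ : ℝ) (X : Fin n → Fin n → Arith) (y z : Edge n → Arith) : Arith :=
  .mul (.sub (.const 1) (.le (scanExpr b q X y z) (.const 0)))
    (.le (.mul (.const (τ ^ 2)) (normExpr X)) (.mul (scanExpr b q X y z) (scanExpr b q X y z)))

/-- Norms enter only through their squares, because programs have no square root; the sign condition
on the statistic makes the squared comparison equivalent to the intended one for nonnegative `τ`. -/
lemma eval_acceptExpr (b q τ : ℝ) {X : Fin n → Fin n → Arith} {y z : Edge n → Arith}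
    {mem : ℕ → ℝ} {X' : Matrix (Fin n) (Fin n) ℝ} {Y Z : Edge n → Bool}
    (hX : ∀ i j, (X i j).eval mem = X' i j) (hy : ∀ e, (y e).eval mem = bit (Y e))
    (hz : ∀ e, (z e).eval mem = bit (Z e)) :
    (acceptExpr b q τ X y z).eval mem = scanAccept b q τ X' Y Z := by
  have hnorm : (normExpr X).eval mem = frobInner X' X' := by
    simp only [normExpr, Arith.eval_sumOver, Arith.eval, hX, frobInner]
  have htr : ∀ i j, (truncateExpr b X i j).eval mem = truncate b X' i j := by
    intro i j
    simp only [truncateExpr, Arith.eval, hX, hnorm, truncate, ite_mul, one_mul, zero_mul]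
  have hscan : (scanExpr b q X y z).eval mem = scanStat b q X' Y Z := by
    simp only [scanExpr, Arith.eval_sumOver, Arith.eval, htr, hy, hz, scanStat, scanWeight]
  simp only [acceptExpr, Arith.eval, hnorm, hscan, scanAccept]
  by_cases h : 0 < scanStat b q X' Y Z
  · simp [h, h.not_ge]
  · simp [h, not_lt.1 h]

lemma card_edge_le (n : ℕ) : Fintype.card (Edge n) ≤ n ^ 2 :=
  (Fintype.card_subtype_le _).trans (by simp [sq])

/-- The squared norm is recomputed for every truncated entry, which costs order `n²` for each of at
most `n²` pairs. A polynomial cost is all that is required. -/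
lemma size_acceptExpr_le (b q τ : ℝ) {X : Fin n → Fin n → Arith} {y z : Edge n → Arith}
    (hX : ∀ i j, (X i j).size ≤ 1) (hy : ∀ e, (y e).size ≤ 1) (hz : ∀ e, (z e).size ≤ 1) :
    (acceptExpr b q τ X y z).size ≤ 300 * (n ^ 4 + 1) := by
  have hrow : ∀ i, (Arith.sumOver fun j => .mul (X i j) (X i j)).size ≤ n * (3 + 1) + 1 := by
    intro i
    refine (Arith.size_sumOver_le (s := 3) fun j => ?_).trans_eq (by simp)
    simp only [Arith.size]
    have := hX i j
    omega
  have hnorm : (normExpr X).size ≤ n * (n * (3 + 1) + 1 + 1) + 1 :=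
    (Arith.size_sumOver_le hrow).trans_eq (by simp)
  have htr : ∀ i j, (truncateExpr b X i j).size ≤ n * (n * (3 + 1) + 1 + 1) + 10 := by
    intro i j
    simp only [truncateExpr, Arith.size]
    have := hX i j
    omega
  have hscan : (scanExpr b q X y z).size ≤
      n ^ 2 * (2 * (n * (n * (3 + 1) + 1 + 1) + 10) + 9 + 1) + 1 := by
    refine (Arith.size_sumOver_le (s := 2 * (n * (n * (3 + 1) + 1 + 1) + 10) + 9)
      fun e => ?_).trans ?_
    · simp only [Arith.size]
      have h1 := htr e.1.1 e.1.2
      have h2 := htr e.1.2 e.1.1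
      have h3 := hy e
      have h4 := hz e
      omega
    · gcongr
      exact card_edge_le n
  have hsize : (acceptExpr b q τ X y z).size ≤
      3 * (n ^ 2 * (2 * (n * (n * (3 + 1) + 1 + 1) + 10) + 9 + 1) + 1) +
        (n * (n * (3 + 1) + 1 + 1) + 1) + 10 := by
    simp only [acceptExpr, Arith.size]
    omega
  refine hsize.trans ?_
  have h1 : n ≤ n ^ 2 := Nat.le_self_pow two_ne_zero n
  have h2 : n ^ 2 ≤ n ^ 4 := by
    rcases Nat.eq_zero_or_pos n with rfl | h
    · simp
    · exact Nat.pow_le_pow_right h (by norm_num)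
  have h3 : n ^ 3 ≤ n ^ 4 := by
    rcases Nat.eq_zero_or_pos n with rfl | h
    · simp
    · exact Nat.pow_le_pow_right h (by norm_num)
  ring_nf
  omega

lemma bounded_acceptExpr (b q τ : ℝ) {X : Fin n → Fin n → Arith} {y z : Edge n → Arith} {T : ℕ}
    (hX : ∀ i j, (X i j).Bounded T) (hy : ∀ e, (y e).Bounded T) (hz : ∀ e, (z e).Bounded T) :
    (acceptExpr b q τ X y z).Bounded T := by
  have hnorm : (normExpr X).Bounded T :=
    Arith.bounded_sumOver fun i => Arith.bounded_sumOver fun j => ⟨hX i j, hX i j⟩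
  have htr : ∀ i j, (truncateExpr b X i j).Bounded T := fun i j =>
    ⟨⟨⟨hX i j, hX i j⟩, trivial, hnorm⟩, hX i j⟩
  have hscan : (scanExpr b q X y z).Bounded T :=
    Arith.bounded_sumOver fun e => ⟨⟨⟨trivial, hy e⟩, htr _ _, htr _ _⟩, hz e, trivial⟩
  exact ⟨⟨trivial, hscan, trivial⟩, ⟨trivial, hnorm⟩, hscan, hscan⟩

lemma bit_and (a b : Bool) : bit (a && b) = bit b * bit a := by
  cases a <;> cases b <;> simp [bit]

/-- The scan test on the graph `x`: thin `x` with fair coins, run the estimator on the thinned graph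
and compute the scan statistic. -/
lemma Estimator.exists_scan_test (A : Estimator n) (b q τ : ℝ) :
    ∃ B : Test (Edge n), B.out < B.prog.time ∧
      B.prog.time ≤ A.prog.time + 302 * (n ^ 4 + 1) ∧
      ∀ x, B.coinAccept x = expect (prodBern fun _ : Edge n => 1 / 2) fun a =>
        expect A.prog.coinLaw fun ω =>
          scanAccept b q τ (A.output (fun e => x e && a e) ω) (fun e => x e && a e) x := by
  set N := Fintype.card (Edge n) with hN
  let ε : Edge n ≃ Fin N := Fintype.equivFin (Edge n)
  -- The first `N` instructions toss the thinning coins and the next `N` read the graph. The input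
  -- `e` of the estimator is replaced by the product of its coin and its edge bit.
  let K : Program (Edge n) := ⟨N, fun _ => .coin ⟨1 / 2, by norm_num, by norm_num⟩⟩
  let f : Fin N → Instr (Edge n) := fun i => .input (ε.symm i)
  let C₀ := K.append f
  let g : Edge n → Instr (Edge n) := fun e => .mul (ε e) (N + ε e)
  let C₁ := C₀.appendProgram A.prog g
  have ht₀ : C₀.time = N + N := rfl
  have ht₁ : C₁.time = N + N + A.prog.time := rfl
  have hcoin : ∀ x (ω : Fin (N + N) → Bool) (i : Fin N),
      C₀.result x ω i = bit (ω (Fin.castAdd N i)) := fun x ω i =>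
    (K.result_append_left f x ω i i.2).trans (K.result_of_lt x _ i.2)
  have hin : ∀ x (ω : Fin (N + N) → Bool) (i : Fin N),
      C₀.result x ω (N + i) = bit (x (ε.symm i)) := fun x ω i =>
    K.result_append_right f x ω i
  have hA : ∀ x (ω₀ : Fin (N + N) → Bool) (ω₁ : Fin A.prog.time → Bool) s,
      C₁.result x (Fin.append ω₀ ω₁ : Fin (N + N + A.prog.time) → Bool) (N + N + s) =
      A.prog.result (fun e => x e && ω₀ (Fin.castAdd N (ε e))) ω₁ s := by
    intro x ω₀ ω₁ s
    refine (C₀.result_appendProgram A.prog g x (fun e => x e && ω₀ (Fin.castAdd N (ε e)))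
      (Fin.append ω₀ ω₁ : Fin (N + N + A.prog.time) → Bool) (fun e _ mem hmem => ?_) s).trans ?_
    · change mem (ε e) * mem (N + ε e) = _
      have hr : restrictCoins (Nat.le_add_right _ _)
          (Fin.append ω₀ ω₁ : Fin (N + N + A.prog.time) → Bool) = ω₀ := restrictCoins_append ω₀ ω₁
      rw [hmem _ (show (ε e : ℕ) < N + N by omega), hmem _ (show N + (ε e : ℕ) < N + N by omega)]
      have e1 : C₀.result x ω₀ (ε e) = _ := hcoin x ω₀ (ε e)
      have e2 : C₀.result x ω₀ (N + ε e) = _ := hin x ω₀ (ε e)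
      rw [bit_and]
      refine congrArg₂ (fun a b : ℝ => a * b) ?_ ?_
      · exact (congrArg (fun ω => C₀.result x ω (ε e)) hr).trans e1
      · refine (congrArg (fun ω => C₀.result x ω (N + ε e)) hr).trans (e2.trans ?_)
        rw [Equiv.symm_apply_apply]
    · exact congrArg (fun ω => A.prog.result _ ω s)
        (funext fun i => Fin.append_right ω₀ ω₁ i)
  have h₀₁ : ∀ x (ω₀ : Fin (N + N) → Bool) (ω₁ : Fin A.prog.time → Bool) j, j < N + N →
      C₁.result x (Fin.append ω₀ ω₁ : Fin (N + N + A.prog.time) → Bool) j = C₀.result x ω₀ j := by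
    intro x ω₀ ω₁ j hj
    refine (C₀.result_append_left _ x _ j hj).trans ?_
    exact congrArg (fun ω => C₀.result x ω j) (restrictCoins_append ω₀ ω₁)
  -- A reference of the estimator beyond its own running time must evaluate to `0`; after
  -- concatenation that place may hold something else, so a constant is used instead.
  let X : Fin n → Fin n → Arith := fun i j =>
    if A.out i j < A.prog.time then .loc (N + N + A.out i j) else .const 0
  let y : Edge n → Arith := fun e => .mul (.loc (ε e)) (.loc (N + ε e))
  let z : Edge n → Arith := fun e => .loc (N + ε e)
  have hbd : (acceptExpr b q τ X y z).Bounded C₁.time := by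
    refine bounded_acceptExpr b q τ (fun i j => ?_) (fun e => ?_) fun e => ?_
    · by_cases h : A.out i j < A.prog.time
      · simp only [X, if_pos h]
        change _ < _
        omega
      · simp only [X, if_neg h]
        trivial
    · exact ⟨show (ε e : ℕ) < _ by omega, show N + (ε e : ℕ) < _ by omega⟩
    · exact show N + (ε e : ℕ) < _ by omega
  obtain ⟨C₂, o, h₂⟩ := Program.exists_computes _ C₁ hbd
  have hsize : (acceptExpr b q τ X y z).size ≤ 300 * (n ^ 4 + 1) := by
    refine size_acceptExpr_le b q τ (fun i j => ?_) (fun e => ?_) fun e => ?_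
    · simp only [X]; split_ifs <;> simp [Arith.size]
    · simp [y, Arith.size]
    · simp [z, Arith.size]
  refine ⟨⟨C₂, o⟩, h₂.out_lt, ?_, fun x => ?_⟩
  · change C₂.time ≤ _
    rw [h₂.time_eq, ht₁]
    have hN4 : N ≤ n ^ 4 := by
      refine (card_edge_le n).trans ?_
      rcases Nat.eq_zero_or_pos n with h | h
      · simp [h]
      · exact Nat.pow_le_pow_right h (by norm_num)
    omega
  · rw [Test.coinAccept]
    simp only [h₂.result_eq]
    rw [h₂.ext.expect_eq fun ω =>
      if (acceptExpr b q τ X y z).eval (C₁.result x ω) = 1 then 1 else 0]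
    refine (C₀.expect_coinLaw_appendProgram A.prog (fun _ => rfl) _).trans ?_
    refine (K.expect_coinLaw_append f _).trans ?_
    have hval : ∀ (ω : Fin N → Bool) (ω' : Fin N → Bool) (ω₁ : Fin A.prog.time → Bool),
        (acceptExpr b q τ X y z).eval (C₁.result x
          (Fin.append (Fin.append ω ω') ω₁ : Fin (N + N + A.prog.time) → Bool)) =
        scanAccept b q τ (A.output (fun e => x e && ω (ε e)) ω₁) (fun e => x e && ω (ε e)) x := by
      intro ω ω' ω₁
      have hap : ∀ i, (Fin.append ω ω' : Fin (N + N) → Bool) (Fin.castAdd N i) = ω i := fun i =>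
        Fin.append_left ω ω' i
      have hz : ∀ e, C₁.result x (Fin.append (Fin.append ω ω') ω₁ :
          Fin (N + N + A.prog.time) → Bool) (N + ε e) = bit (x e) := by
        intro e
        refine (h₀₁ x _ ω₁ (N + ε e) (by omega)).trans ((hin x _ (ε e)).trans ?_)
        rw [Equiv.symm_apply_apply]
      refine eval_acceptExpr b q τ (fun i j => ?_) (fun e => ?_) hz
      · by_cases h : A.out i j < A.prog.time
        · simp only [X, if_pos h]
          refine (hA x (Fin.append ω ω') ω₁ (A.out i j)).trans ?_
          simp only [hap]
          rfl
        · simp only [X, if_neg h]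
          exact (A.prog.result_of_le _ _ (not_lt.1 h)).symm
      · rw [bit_and]
        refine congrArg₂ (fun a b : ℝ => a * b) ?_ (hz e)
        refine (h₀₁ x _ ω₁ (ε e) (by omega)).trans ((hcoin x _ (ε e)).trans ?_)
        rw [hap]
    have hone : ∀ (a : Edge n → Bool) (ω₁ : Fin A.prog.time → Bool),
        (if scanAccept b q τ (A.output (fun e => x e && a e) ω₁) (fun e => x e && a e) x = 1
          then (1 : ℝ) else 0) =
        scanAccept b q τ (A.output (fun e => x e && a e) ω₁) (fun e => x e && a e) x := by
      intro a ω₁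
      rw [scanAccept]
      split_ifs <;> simp_all
    have hlaw : IsLaw (prodBern fun s => (f s).bias) :=
      isLaw_prodBern (fun _ => Instr.bias_nonneg _) fun _ => Instr.bias_le_one _
    have hstep : ∀ ω : Fin N → Bool, expect (prodBern fun s => (f s).bias) (fun ω' =>
        expect A.prog.coinLaw fun ω₁ => if (acceptExpr b q τ X y z).eval (C₁.result x
          (Fin.append (Fin.append ω ω') ω₁ : Fin (N + N + A.prog.time) → Bool)) = 1
          then (1 : ℝ) else 0) =
        expect A.prog.coinLaw fun ω₁ =>
          scanAccept b q τ (A.output (fun e => x e && ω (ε e)) ω₁) (fun e => x e && ω (ε e)) x := by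
      intro ω
      simp only [hval]
      rw [expect_const hlaw]
      simp only [hone]
    refine (congrArg (expect K.coinLaw) (funext hstep)).trans ?_
    rw [expect, expect]
    refine Fintype.sum_equiv (Equiv.arrowCongr ε.symm (Equiv.refl Bool)) _ _ fun ω => ?_
    have hw : K.coinLaw ω = prodBern (fun _ : Edge n => (1 / 2 : ℝ))
        (Equiv.arrowCongr ε.symm (Equiv.refl Bool) ω) := by
      simp only [Program.coinLaw, prodBern]
      exact (Fintype.prod_equiv ε _ _ fun e => rfl).symm
    rw [hw]
    rfl

end Scan

/-! ## Thinning -/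

section Thinning

variable {ι : Type} [Fintype ι] [DecidableEq ι]

lemma expect_expect_prodBern_comp (q q' : ι → ℝ) (φ : Bool × Bool → Bool × Bool)
    (F : (ι → Bool × Bool) → ℝ) :
    expect (prodBern q) (fun y => expect (prodBern q') fun a => F fun i => φ (y i, a i)) =
      ∑ u : ι → Bool × Bool, (∏ i, ∑ c : Bool × Bool,
        if φ c = u i then bern (q i) c.1 * bern (q' i) c.2 else 0) * F u := by
  rw [← sum_prod_comp (fun i c => bern (q i) c.1 * bern (q' i) c.2) φ F]
  simp only [expect, Finset.mul_sum]
  rw [← Fintype.sum_prod_type']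
  refine (Fintype.sum_equiv (Equiv.arrowProdEquivProdArrow ι (fun _ => Bool) fun _ => Bool) _ _
    fun x => ?_).symm
  rw [Finset.prod_mul_distrib, mul_assoc]
  rfl

/-- Splitting the edges of a graph by fair coins: the thinned graph `Y` has density `p`, and given
`Y` the remaining edges outside `Y` are independent of density `p / (1 - p)`. -/
lemma expect_thinning {p : ι → ℝ} (hp : ∀ i, p i < 1) (G : (ι → Bool) → (ι → Bool) → ℝ) :
    expect (prodBern fun i => 2 * p i) (fun x => expect (prodBern fun _ => 1 / 2) fun a =>
      G (fun i => x i && a i) x) =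
    expect (prodBern p) fun y => expect (prodBern fun i => p i / (1 - p i)) fun z =>
      G y fun i => y i || z i := by
  -- Both sides are expectations over independent pairs of bits, one pair per coordinate. It
  -- suffices that the laws of a single pair agree: weight `p` on `(1,1)`, `p` on `(0,1)` and `1 -
  -- 2p` on `(0,0)`.
  have h1 := expect_expect_prodBern_comp (fun i => 2 * p i) (fun _ => 1 / 2)
    (fun c => (c.1 && c.2, c.1)) fun u => G (fun i => (u i).1) fun i => (u i).2
  have h2 := expect_expect_prodBern_comp p (fun i => p i / (1 - p i))
    (fun c => (c.1, c.1 || c.2)) fun u => G (fun i => (u i).1) fun i => (u i).2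
  refine h1.trans (Eq.trans ?_ h2.symm)
  refine Finset.sum_congr rfl fun u _ => ?_
  congr 1
  refine Finset.prod_congr rfl fun i _ => ?_
  have hpi : 1 - p i ≠ 0 := (sub_pos.2 (hp i)).ne'
  rcases u i with ⟨_ | _, _ | _⟩ <;>
    simp [Fintype.sum_prod_type, bern] <;> field_simp <;> ring

end Thinning

/-! ## The scan test under the null law -/

section Null

variable {n : ℕ}

/-- Pairs in `Y` have weight zero, so the statistic sees only the part of the graph that is fresh
given `Y`. -/
lemma scanStat_or (b q : ℝ) (X : Matrix (Fin n) (Fin n) ℝ) (Y Z : Edge n → Bool) :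
    scanStat b q X Y (fun e => Y e || Z e) = scanStat b q X Y Z := by
  refine Finset.sum_congr rfl fun e _ => ?_
  rw [scanWeight]
  cases h : Y e <;> simp [bit, h]

lemma scanAccept_or (b q τ : ℝ) (X : Matrix (Fin n) (Fin n) ℝ) (Y Z : Edge n → Bool) :
    scanAccept b q τ X Y (fun e => Y e || Z e) = scanAccept b q τ X Y Z := by
  simp only [scanAccept, scanStat_or]

lemma frobInner_self_eq (X : Matrix (Fin n) (Fin n) ℝ) : frobInner X X = frobNorm X ^ 2 :=
  (Real.sq_sqrt (frobInner_self_nonneg X)).symm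

lemma sum_edge_sq_le (f : Fin n → Fin n → ℝ) :
    ∑ e : Edge n, (f e.1.1 e.1.2 + f e.1.2 e.1.1) ^ 2 ≤ 2 * ∑ i, ∑ j, f i j ^ 2 := by
  have h := sum_pairs_eq fun i j => f i j ^ 2
  have h0 : 0 ≤ ∑ i, f i i ^ 2 := Finset.sum_nonneg fun _ _ => sq_nonneg _
  have h1 : ∑ e : Edge n, (f e.1.1 e.1.2 + f e.1.2 e.1.1) ^ 2 ≤
      ∑ e : Edge n, 2 * (f e.1.1 e.1.2 ^ 2 + f e.1.2 e.1.1 ^ 2) :=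
    Finset.sum_le_sum fun e _ => by nlinarith [sq_nonneg (f e.1.1 e.1.2 - f e.1.2 e.1.1)]
  rw [← Finset.mul_sum] at h1
  linarith

lemma truncate_sq_le (b : ℝ) (X : Matrix (Fin n) (Fin n) ℝ) (i j : Fin n) :
    truncate b X i j ^ 2 ≤ X i j ^ 2 := by
  rw [truncate]
  split_ifs
  · exact le_rfl
  · simpa using sq_nonneg (X i j)

lemma abs_truncate_le {b : ℝ} (hb : 0 ≤ b) (X : Matrix (Fin n) (Fin n) ℝ) (i j : Fin n) :
    |truncate b X i j| ≤ b * frobNorm X := by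
  rw [truncate]
  split_ifs with h
  · refine abs_le_of_sq_le_sq ?_ (mul_nonneg hb (frobNorm_nonneg X))
    rw [frobInner_self_eq] at h
    nlinarith
  · simpa using mul_nonneg hb (frobNorm_nonneg X)

lemma scanWeight_sq_le (b : ℝ) (X : Matrix (Fin n) (Fin n) ℝ) (Y : Edge n → Bool) (e : Edge n) :
    scanWeight b X Y e ^ 2 ≤ (truncate b X e.1.1 e.1.2 + truncate b X e.1.2 e.1.1) ^ 2 := by
  rw [scanWeight]
  cases Y e <;> simp [bit, sq_nonneg]

lemma abs_scanWeight_le {b : ℝ} (hb : 0 ≤ b) (X : Matrix (Fin n) (Fin n) ℝ) (Y : Edge n → Bool)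
    (e : Edge n) : |scanWeight b X Y e| ≤ 2 * (b * frobNorm X) := by
  have h1 : |scanWeight b X Y e| ≤ |truncate b X e.1.1 e.1.2 + truncate b X e.1.2 e.1.1| :=
    sq_le_sq.1 (scanWeight_sq_le b X Y e)
  refine h1.trans ((abs_add_le _ _).trans ?_)
  linarith [abs_truncate_le hb X e.1.1 e.1.2, abs_truncate_le hb X e.1.2 e.1.1]

lemma sum_scanWeight_sq_le (b : ℝ) (X : Matrix (Fin n) (Fin n) ℝ) (Y : Edge n → Bool) :
    ∑ e, scanWeight b X Y e ^ 2 ≤ 2 * frobNorm X ^ 2 := by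
  refine (Finset.sum_le_sum fun e _ => scanWeight_sq_le b X Y e).trans
    ((sum_edge_sq_le (truncate b X)).trans ?_)
  rw [frobNorm_sq]
  exact mul_le_mul_of_nonneg_left (Finset.sum_le_sum fun i _ => Finset.sum_le_sum fun j _ =>
    truncate_sq_le b X i j) two_pos.le

/-- A Bernstein-type bound: from `1 + x ≤ e^x` and `e^u - 1 - u ≤ u²` on `|u| ≤ 1`. The factor `q`
in the exponent, rather than a constant, is what exploits sparsity. -/
lemma bern_exp_le {q u : ℝ} (hq : 0 ≤ q) (hu : |u| ≤ 1) :
    q * Real.exp (u * (1 - q)) + (1 - q) * Real.exp (u * (0 - q)) ≤ Real.exp (q * u ^ 2) := by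
  have h1 : Real.exp (u * (1 - q)) = Real.exp (u * (0 - q)) * Real.exp u := by
    rw [← Real.exp_add]; ring_nf
  have h2 := (abs_le.1 (Real.abs_exp_sub_one_sub_id_le hu)).2
  calc q * Real.exp (u * (1 - q)) + (1 - q) * Real.exp (u * (0 - q))
      = Real.exp (u * (0 - q)) * (q * (Real.exp u - 1) + 1) := by rw [h1]; ring
    _ ≤ Real.exp (u * (0 - q)) * Real.exp (q * (Real.exp u - 1)) := by
        gcongr
        exact Real.add_one_le_exp _
    _ = Real.exp (q * (Real.exp u - 1 - u)) := by rw [← Real.exp_add]; ring_nf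
    _ ≤ _ := Real.exp_le_exp.2 (mul_le_mul_of_nonneg_left h2 hq)

/-- Chernoff bound for the scan test. -/
lemma expect_scanAccept_le {b q τ t : ℝ} (hb : 0 ≤ b) (hq0 : 0 ≤ q) (hq1 : q ≤ 1)
    (ht : 0 ≤ t) (htb : 2 * (t * b) ≤ 1) (htq : 4 * (t * q) ≤ τ)
    (X : Matrix (Fin n) (Fin n) ℝ) (Y : Edge n → Bool) :
    expect (prodBern fun _ => q) (fun Z => scanAccept b q τ X Y Z) ≤ Real.exp (-(t * τ / 2)) := by
  have hlaw : IsLaw (prodBern fun _ : Edge n => q) :=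
    isLaw_prodBern (fun _ => hq0) fun _ => hq1
  have hτ : 0 ≤ τ := le_trans (by positivity) htq
  rcases (frobNorm_nonneg X).eq_or_lt with hX | hX
  · have hw : ∀ e, scanWeight b X Y e = 0 := by
      intro e
      have h := abs_scanWeight_le hb X Y e
      rw [← hX, mul_zero, mul_zero] at h
      exact abs_nonpos_iff.1 h
    have h0 : ∀ Z, scanAccept b q τ X Y Z = 0 := by
      intro Z
      have hs : scanStat b q X Y Z = 0 := by simp [scanStat, hw]
      simp [scanAccept, hs]
    simp only [h0, expect_const hlaw]
    positivity
  set r := frobNorm X with hr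
  -- The exponential tilt with parameter `t`. Truncation gives `|u| ≤ 2tb ≤ 1`, and the total square
  -- is at most `2t²`; then `2qt² ≤ tτ/2` absorbs half of the exponent `tτ`.
  let u : Edge n → ℝ := fun e => t * scanWeight b X Y e / r
  have hu : ∀ e, |u e| ≤ 1 := by
    intro e
    simp only [u]
    rw [abs_div, abs_mul, abs_of_nonneg ht, abs_of_pos hX, div_le_one hX]
    have h := mul_le_mul_of_nonneg_left (abs_scanWeight_le hb X Y e) ht
    have h2 := mul_le_mul_of_nonneg_right htb hX.le
    rw [← hr] at h
    linarith
  have hu2 : ∑ e, u e ^ 2 ≤ 2 * t ^ 2 := by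
    have h := sum_scanWeight_sq_le b X Y
    have : ∑ e, u e ^ 2 = t ^ 2 * (∑ e, scanWeight b X Y e ^ 2) / r ^ 2 := by
      rw [Finset.mul_sum, Finset.sum_div]
      exact Finset.sum_congr rfl fun e _ => by simp only [u]; ring
    rw [this, div_le_iff₀ (by positivity)]
    rw [← hr] at h
    nlinarith [sq_nonneg t]
  have hpt : ∀ Z, scanAccept b q τ X Y Z ≤
      Real.exp (-(t * τ)) * ∏ e, Real.exp (u e * (bit (Z e) - q)) := by
    intro Z
    rw [scanAccept]
    split_ifs with h
    · have hS : τ * r ≤ scanStat b q X Y Z := by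
        refine abs_le_of_sq_le_sq' ?_ h.1.le |>.2
        rw [frobInner_self_eq] at h
        nlinarith [h.2]
      have hsum : ∑ e, u e * (bit (Z e) - q) = t * scanStat b q X Y Z / r := by
        rw [scanStat, Finset.mul_sum, Finset.sum_div]
        exact Finset.sum_congr rfl fun e _ => by simp only [u]; ring
      rw [← Real.exp_sum, hsum, ← Real.exp_add, Real.one_le_exp_iff]
      have : t * τ ≤ t * scanStat b q X Y Z / r := by
        rw [le_div_iff₀ hX, mul_assoc]
        exact mul_le_mul_of_nonneg_left hS ht
      linarith
    · positivity
  calc expect (prodBern fun _ => q) (fun Z => scanAccept b q τ X Y Z)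
      ≤ expect (prodBern fun _ => q) (fun Z =>
          Real.exp (-(t * τ)) * ∏ e, Real.exp (u e * (bit (Z e) - q))) := expect_mono hlaw hpt
    _ = Real.exp (-(t * τ)) *
          ∏ e, (q * Real.exp (u e * (1 - q)) + (1 - q) * Real.exp (u e * (0 - q))) := by
        rw [expect_const_mul, expect_prodBern_prod (fun _ => q)
          fun e c => Real.exp (u e * (bit c - q))]
        simp [bit]
    _ ≤ Real.exp (-(t * τ)) * ∏ e, Real.exp (q * u e ^ 2) := by
        refine mul_le_mul_of_nonneg_left (Finset.prod_le_prod (fun e _ => ?_) fun e _ =>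
          bern_exp_le hq0 (hu e)) (Real.exp_pos _).le
        have := sub_nonneg.2 hq1
        positivity
    _ = Real.exp (-(t * τ) + q * ∑ e, u e ^ 2) := by
        rw [← Real.exp_sum, ← Real.exp_add, Finset.mul_sum]
    _ ≤ _ := by
        refine Real.exp_le_exp.2 ?_
        have h1 := mul_le_mul_of_nonneg_left hu2 hq0
        have h2 := mul_le_mul_of_nonneg_left htq ht
        nlinarith

end Null

/-! ## The scan test under the planted law -/

section Planted

variable {n : ℕ}

lemma bit_sq (b : Bool) : bit b ^ 2 = bit b := by rw [sq, bit_mul_self]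

lemma pairBit_sq (θ : Fin n → Bool) (e : Edge n) : pairBit θ e ^ 2 = pairBit θ e := by
  rcases pairBit_eq_zero_or_one θ e with h | h <;> simp [h]

lemma sum_sq_outer (θ : Fin n → Bool) :
    ∑ i, ∑ j, (bit (θ i) * bit (θ j)) ^ 2 = plantedSize θ ^ 2 := by
  rw [plantedSize, sq, Finset.sum_mul_sum]
  exact Finset.sum_congr rfl fun i _ => Finset.sum_congr rfl fun j _ => by
    rw [mul_pow, bit_sq, bit_sq]

lemma corr_signal_le_one {p₀ p₁ : ℝ} (h : p₀ < p₁) (X : Matrix (Fin n) (Fin n) ℝ)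
    (θ : Fin n → Bool) : corr X (signal p₀ p₁ θ) ≤ 1 := by
  rw [corr_signal h]
  refine (abs_le_of_sq_le_sq' ?_ zero_le_one).2
  rw [one_pow]
  refine (sq_double_sum_le (fun i j => X i j / frobNorm X) _).trans
    (mul_le_one₀ (sum_sq_normalized_le_one X)
      (Finset.sum_nonneg fun _ _ => Finset.sum_nonneg fun _ _ => sq_nonneg _) ?_)
  simp only [div_pow, ← Finset.sum_div, sum_sq_outer]
  exact div_self_le_one _

lemma mul_le_weighted_sq {a y η : ℝ} (hη : 0 < η) : a * y ≤ η * a ^ 2 + y ^ 2 / (4 * η) := by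
  have h : 0 ≤ (2 * η * a - y) ^ 2 / (4 * η) := by positivity
  have e : (2 * η * a - y) ^ 2 / (4 * η) = η * a ^ 2 + y ^ 2 / (4 * η) - a * y := by
    field_simp; ring
  linarith

/-- The entries removed by truncation have a small sum. -/
lemma sum_abs_sub_truncate_le {b : ℝ} (hb : 0 < b) (X : Matrix (Fin n) (Fin n) ℝ) :
    ∑ i, ∑ j, |X i j - truncate b X i j| ≤ frobNorm X / b := by
  rcases (frobNorm_nonneg X).eq_or_lt with hX | hX
  · have h0 : ∀ i j, X i j - truncate b X i j = 0 := by
      intro i j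
      have h : ∑ i, ∑ j, X i j ^ 2 = 0 := by rw [← frobNorm_sq, ← hX]; simp
      have h1 := (Finset.sum_eq_zero_iff_of_nonneg fun i _ =>
        Finset.sum_nonneg fun j _ => sq_nonneg (X i j)).1 h i (Finset.mem_univ i)
      have h2 := (Finset.sum_eq_zero_iff_of_nonneg fun j _ => sq_nonneg (X i j)).1 h1 j
        (Finset.mem_univ j)
      have h3 : X i j = 0 := by simpa using h2
      rw [truncate, h3]; simp
    simp [h0, ← hX]
  -- A removed entry exceeds `b` times the norm, so its absolute value is at most its square divided
  -- by that threshold.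
  · have hpt : ∀ i j, |X i j - truncate b X i j| ≤ X i j ^ 2 / (b * frobNorm X) := by
      intro i j
      rw [truncate]
      split_ifs with h
      · simp only [sub_self, abs_zero]; positivity
      · rw [sub_zero, le_div_iff₀ (by positivity)]
        rw [frobInner_self_eq, not_le] at h
        have h1 : b * frobNorm X ≤ |X i j| := by
          refine (abs_le_of_sq_le_sq' ?_ (abs_nonneg _)).2
          rw [sq_abs]; nlinarith
        calc |X i j| * (b * frobNorm X) ≤ |X i j| * |X i j| := by gcongr
          _ = X i j ^ 2 := by rw [← sq, sq_abs]
    calc ∑ i, ∑ j, |X i j - truncate b X i j| ≤ ∑ i, ∑ j, X i j ^ 2 / (b * frobNorm X) :=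
          Finset.sum_le_sum fun i _ => Finset.sum_le_sum fun j _ => hpt i j
      _ = frobNorm X ^ 2 / (b * frobNorm X) := by simp only [← Finset.sum_div, frobNorm_sq]
      _ = frobNorm X / b := by field_simp

/-- Fluctuation of the normalized scan statistic. -/
def scanNoise (b : ℝ) (X : Matrix (Fin n) (Fin n) ℝ) (Y : Edge n → Bool) (q : Edge n → ℝ)
    (Z : Edge n → Bool) : ℝ :=
  ∑ e, scanWeight b X Y e / frobNorm X * (bit (Z e) - q e)

/-- Number of edges of `Y` inside the planted set. -/
def plantedEdges (θ : Fin n → Bool) (Y : Edge n → Bool) : ℝ := ∑ e, bit (Y e) * pairBit θ e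

/-- The inner product of `X` with the signal is essentially the mean of the scan statistic. -/
lemma sum_outer_le {b η ζ : ℝ} (hb : 0 < b) (hη : 0 < η) (hζ : 0 < ζ)
    {X : Matrix (Fin n) (Fin n) ℝ} (hX : 0 < frobNorm X) (θ : Fin n → Bool) (Y : Edge n → Bool) :
    ∑ i, ∑ j, X i j / frobNorm X * (bit (θ i) * bit (θ j)) ≤
      ∑ e, scanWeight b X Y e / frobNorm X * pairBit θ e + 1 / b +
        (2 * η + plantedEdges θ Y / (4 * η)) + (ζ + plantedSize θ / (4 * ζ)) := by
  set r := frobNorm X with hr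
  set x : Fin n → Fin n → ℝ := fun i j => X i j / r with hx
  have hx1 : ∑ i, ∑ j, x i j ^ 2 ≤ 1 := sum_sq_normalized_le_one X
  have hdiag : ∑ i, x i i * (bit (θ i) * bit (θ i)) ≤ ζ + plantedSize θ / (4 * ζ) := by
    calc ∑ i, x i i * (bit (θ i) * bit (θ i))
        ≤ ∑ i, (ζ * x i i ^ 2 + bit (θ i) / (4 * ζ)) := by
          refine Finset.sum_le_sum fun i _ => ?_
          rw [bit_mul_self]
          have := mul_le_weighted_sq (a := x i i) (y := bit (θ i)) hζ
          rwa [bit_sq] at this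
      _ = ζ * ∑ i, x i i ^ 2 + plantedSize θ / (4 * ζ) := by
          rw [Finset.sum_add_distrib, ← Finset.mul_sum, ← Finset.sum_div, plantedSize]
      _ ≤ ζ * 1 + plantedSize θ / (4 * ζ) := by
          refine add_le_add (mul_le_mul_of_nonneg_left ?_ hζ.le) le_rfl
          refine le_trans (Finset.sum_le_sum fun i _ => ?_) hx1
          exact Finset.single_le_sum (f := fun j => x i j ^ 2) (fun j _ => sq_nonneg _)
            (Finset.mem_univ i)
      _ = _ := by rw [mul_one]
  have hedge : ∀ e : Edge n, x e.1.1 e.1.2 * (bit (θ e.1.1) * bit (θ e.1.2)) +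
      x e.1.2 e.1.1 * (bit (θ e.1.2) * bit (θ e.1.1)) ≤
      scanWeight b X Y e / r * pairBit θ e +
      (η * (x e.1.1 e.1.2 + x e.1.2 e.1.1) ^ 2 + bit (Y e) * pairBit θ e / (4 * η)) +
      (|X e.1.1 e.1.2 - truncate b X e.1.1 e.1.2| + |X e.1.2 e.1.1 - truncate b X e.1.2 e.1.1|) /
        r := by
    intro e
    have h1 := mul_le_weighted_sq (a := x e.1.1 e.1.2 + x e.1.2 e.1.1)
      (y := bit (Y e) * pairBit θ e) hη
    rw [mul_pow, bit_sq, pairBit_sq] at h1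
    set d := (X e.1.1 e.1.2 - truncate b X e.1.1 e.1.2) +
      (X e.1.2 e.1.1 - truncate b X e.1.2 e.1.1) with hd
    -- Three contributions of a pair: the part seen by the scan, the part lost because the pair is
    -- already an edge of `Y`, and the part lost by truncation outside `Y`.
    have h2 : x e.1.1 e.1.2 * (bit (θ e.1.1) * bit (θ e.1.2)) +
        x e.1.2 e.1.1 * (bit (θ e.1.2) * bit (θ e.1.1)) =
        scanWeight b X Y e / r * pairBit θ e +
        (x e.1.1 e.1.2 + x e.1.2 e.1.1) * (bit (Y e) * pairBit θ e) +
        (1 - bit (Y e)) * pairBit θ e * d / r := by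
      simp only [scanWeight, hd, hx, pairBit]; ring
    have h3 : (1 - bit (Y e)) * pairBit θ e * d ≤
        |X e.1.1 e.1.2 - truncate b X e.1.1 e.1.2| +
          |X e.1.2 e.1.1 - truncate b X e.1.2 e.1.1| := by
      have h4 : d ≤ _ := (le_abs_self d).trans (abs_add_le _ _)
      have h5 := abs_nonneg (X e.1.1 e.1.2 - truncate b X e.1.1 e.1.2)
      have h6 := abs_nonneg (X e.1.2 e.1.1 - truncate b X e.1.2 e.1.1)
      rcases pairBit_eq_zero_or_one θ e with h | h <;> cases Y e <;> simp [h, bit] <;> linarith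
    have h7 := div_le_div_of_nonneg_right h3 hX.le
    linarith
  have hsum := Finset.sum_le_sum fun e (_ : e ∈ Finset.univ) => hedge e
  simp only [Finset.sum_add_distrib (s := (Finset.univ : Finset (Edge n))), ← Finset.mul_sum,
    ← Finset.sum_div] at hsum
  have htr : (∑ e : Edge n, |X e.1.1 e.1.2 - truncate b X e.1.1 e.1.2| +
      ∑ e : Edge n, |X e.1.2 e.1.1 - truncate b X e.1.2 e.1.1|) / r ≤ 1 / b := by
    have h1 := sum_pairs_eq fun i j => |X i j - truncate b X i j|
    have h2 : 0 ≤ ∑ i, |X i i - truncate b X i i| := Finset.sum_nonneg fun _ _ => abs_nonneg _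
    have h3 := sum_abs_sub_truncate_le hb X
    rw [Finset.sum_add_distrib] at h1
    rw [div_le_div_iff₀ hX hb, one_mul, ← le_div_iff₀ hb]
    linarith
  have hsq : η * ∑ e : Edge n, (x e.1.1 e.1.2 + x e.1.2 e.1.1) ^ 2 ≤ 2 * η := by
    have := mul_le_mul_of_nonneg_left ((sum_edge_sq_le x).trans
      (mul_le_mul_of_nonneg_left hx1 two_pos.le)) hη.le
    linarith
  have hpair := sum_pairs_eq fun i j => x i j * (bit (θ i) * bit (θ j))
  rw [Finset.sum_add_distrib] at hpair
  rw [plantedEdges]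
  linarith

/-- Correlation with the signal forces the scan test to accept, up to small errors. -/
lemma corr_le_scanAccept {p₀ p₁ b q d τ c R : ℝ} (hp : p₀ < p₁) (hb : 0 < b) (hτ : 0 < τ)
    (hd : 0 < d) (hc : 0 < c) (hR : 0 < R) (hbR : 8 ≤ c * (b * R)) (hdτ : 16 * τ ≤ d * (c * R))
    (X : Matrix (Fin n) (Fin n) ℝ) (θ : Fin n → Bool) (Y Z : Edge n → Bool) :
    corr X (signal p₀ p₁ θ) ≤ scanAccept b q τ X Y Z + 3 * c / 4 +
      4 / R ^ 2 * (plantedSize θ - R) ^ 2 + 4 / (c * R) + 16 / (c * R ^ 2) * plantedEdges θ Y +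
      1 / τ ^ 2 * scanNoise b X Y (fun e => q + d * pairBit θ e) Z ^ 2 := by
  have hacc : 0 ≤ scanAccept b q τ X Y Z := by rw [scanAccept]; positivity
  have hE : 0 ≤ plantedEdges θ Y := Finset.sum_nonneg fun e _ =>
    mul_nonneg (bit_nonneg _) (pairBit_nonneg _ _)
  have t1 : 0 ≤ 4 / R ^ 2 * (plantedSize θ - R) ^ 2 := by positivity
  have t2 : 0 ≤ 4 / (c * R) := by positivity
  have t3 : 0 ≤ 16 / (c * R ^ 2) * plantedEdges θ Y := by positivity
  have t4 : 0 ≤ 1 / τ ^ 2 * scanNoise b X Y (fun e => q + d * pairBit θ e) Z ^ 2 := by positivity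
  rcases (frobNorm_nonneg X).eq_or_lt with hX | hX
  · have : corr X (signal p₀ p₁ θ) = 0 := by rw [corr, ← hX]; simp
    rw [this]; positivity
  have hle := corr_signal_le_one hp X θ
  -- The correlation is at most `1`, so each bad event may be paid for by a term of the bound that
  -- is at least `1` there: an undersized planted set, then a large fluctuation, then acceptance
  -- itself. Expectations later turn these terms into Chebyshev bounds.
  rcases lt_or_ge (plantedSize θ) (R / 2) with hs | hs
  · have : 1 ≤ 4 / R ^ 2 * (plantedSize θ - R) ^ 2 := by
      rw [div_mul_eq_mul_div, one_le_div (by positivity)]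
      nlinarith
    linarith
  rcases le_or_gt τ |scanNoise b X Y (fun e => q + d * pairBit θ e) Z| with hN | hN
  · have : 1 ≤ 1 / τ ^ 2 * scanNoise b X Y (fun e => q + d * pairBit θ e) Z ^ 2 := by
      rw [one_div, ← div_eq_inv_mul, one_le_div (by positivity), ← sq_abs (scanNoise _ _ _ _ _)]
      gcongr
    linarith
  by_cases hA : 0 < scanStat b q X Y Z ∧
      τ ^ 2 * frobInner X X ≤ scanStat b q X Y Z * scanStat b q X Y Z
  · have : scanAccept b q τ X Y Z = 1 := if_pos hA
    linarith
  have hS : scanStat b q X Y Z < τ * frobNorm X := by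
    by_contra h
    rw [not_lt] at h
    have hpos : 0 < τ * frobNorm X := by positivity
    refine hA ⟨hpos.trans_le h, ?_⟩
    rw [frobInner_self_eq]
    calc τ ^ 2 * frobNorm X ^ 2 = (τ * frobNorm X) * (τ * frobNorm X) := by ring
      _ ≤ _ := mul_le_mul h h hpos.le (hpos.le.trans h)
  set G := ∑ e, scanWeight b X Y e / frobNorm X * pairBit θ e with hG
  have hdec : scanStat b q X Y Z / frobNorm X =
      scanNoise b X Y (fun e => q + d * pairBit θ e) Z + d * G := by
    rw [scanStat, scanNoise, hG, Finset.sum_div, Finset.mul_sum, ← Finset.sum_add_distrib]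
    exact Finset.sum_congr rfl fun e _ => by ring
  have hGd : d * G < 2 * τ := by
    have h1 : scanStat b q X Y Z / frobNorm X < τ := (div_lt_iff₀ hX).2 hS
    have h2 := (abs_lt.1 hN).1
    linarith
  -- Without acceptance and with fluctuation above `-τ`, the mean part satisfies `dG < 2τ`, and `16τ
  -- ≤ dcR`.
  have hGR : G < c * R / 8 := by
    by_contra h
    rw [not_lt] at h
    have := mul_le_mul_of_nonneg_left h hd.le
    linarith
  -- The weights balance the losses against `plantedSize θ ≥ R/2`: the scan and truncation terms
  -- cost `c/4` each, and the terms in `η` and `ζ` cost `c/8` each, which makes `3c/4`.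
  have hmain := sum_outer_le hb (η := c * R / 32) (ζ := 2 / c) (by positivity) (by positivity) hX θ Y
  have hsz : 0 < plantedSize θ := by linarith
  have hcorr : corr X (signal p₀ p₁ θ) =
      (∑ i, ∑ j, X i j / frobNorm X * (bit (θ i) * bit (θ j))) / plantedSize θ := by
    rw [corr_signal hp]
    simp only [Finset.sum_div, mul_div_assoc]
  have hb1 : 1 / b ≤ c * R / 8 := by
    rw [div_le_iff₀ hb]; linarith
  rw [← hG] at hmain
  have hrw : 2 * (c * R / 32) + plantedEdges θ Y / (4 * (c * R / 32)) +
      (2 / c + plantedSize θ / (4 * (2 / c))) =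
      c * R / 16 + 8 / (c * R) * plantedEdges θ Y + 2 / c + c / 8 * plantedSize θ := by
    field_simp; ring
  have hfin : corr X (signal p₀ p₁ θ) ≤ 3 * c / 4 + 4 / (c * R) +
      16 / (c * R ^ 2) * plantedEdges θ Y := by
    rw [hcorr, div_le_iff₀ hsz]
    have k1 : c * R / 8 ≤ c / 4 * plantedSize θ := by nlinarith
    have k2 : c * R / 16 ≤ c / 8 * plantedSize θ := by nlinarith
    have k3 : 8 / (c * R) * plantedEdges θ Y ≤
        16 / (c * R ^ 2) * plantedEdges θ Y * plantedSize θ := by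
      have : 8 / (c * R) * plantedEdges θ Y = 16 / (c * R ^ 2) * plantedEdges θ Y * (R / 2) := by
        field_simp; ring
      rw [this]
      gcongr
    have k4 : 2 / c ≤ 4 / (c * R) * plantedSize θ := by
      have : 2 / c = 4 / (c * R) * (R / 2) := by field_simp; ring
      rw [this]
      gcongr
    nlinarith
  linarith

end Planted

/-! ## Errors of the scan test -/

section ScanErrors

variable {n : ℕ}

lemma expect_plantedSize_sub_sq_le {ρ : ℝ} (h0 : 0 ≤ ρ) :
    expect (prodBern fun _ : Fin n => ρ) (fun θ => (plantedSize θ - n * ρ) ^ 2) ≤ n * ρ := by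
  have h := expect_prodBern_linear_sq (fun _ : Fin n => ρ) fun _ => 1
  have e : ∀ θ : Fin n → Bool, ∑ i, (1 : ℝ) * (bit (θ i) - ρ) = plantedSize θ - n * ρ := by
    intro θ
    simp [plantedSize, Finset.sum_sub_distrib]
  simp only [e] at h
  rw [h]
  simp only [one_pow, one_mul, Finset.sum_const, Finset.card_univ, Fintype.card_fin, nsmul_eq_mul]
  gcongr
  nlinarith

lemma expect_plantedEdges_le {p₀ p₁ ρ : ℝ} (hp1 : 0 ≤ p₁) :
    expect (prodBern fun _ : Fin n => ρ) (fun θ => expect (graphLawGiven p₀ p₁ θ) fun Y =>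
      plantedEdges θ Y) ≤ p₁ * (n * ρ) ^ 2 := by
  have h1 : ∀ θ : Fin n → Bool, expect (graphLawGiven p₀ p₁ θ) (fun Y => plantedEdges θ Y) =
      ∑ e, p₁ * pairBit θ e := by
    intro θ
    simp only [plantedEdges, expect_sum, expect_mul_const]
    refine Finset.sum_congr rfl fun e _ => ?_
    rw [graphLawGiven, expect_prodBern_single _ e bit]
    rcases pairBit_eq_zero_or_one θ e with h | h
    · simp [h]
    · rw [h]; rw [pairBit] at h; rw [h]; simp [bit]
  simp only [h1, expect_sum, expect_const_mul]
  have h2 : ∀ e : Edge n, expect (prodBern fun _ : Fin n => ρ) (fun θ => pairBit θ e) = ρ ^ 2 := by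
    intro e
    simp only [pairBit]
    rw [expect_prodBern_pair (fun _ => ρ) e.2.ne bit bit]
    simp [bit, sq]
  simp only [h2, Finset.sum_const, Finset.card_univ, nsmul_eq_mul]
  have h3 : (Fintype.card (Edge n) : ℝ) ≤ (n : ℝ) ^ 2 := by exact_mod_cast card_edge_le n
  calc (Fintype.card (Edge n) : ℝ) * (p₁ * ρ ^ 2) ≤ (n : ℝ) ^ 2 * (p₁ * ρ ^ 2) := by gcongr
    _ = _ := by ring

/-- The noise is a linear form in independent centred bits, with weights of total square at most `2`
and variances at most `Q`. Truncation plays no role here. -/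
lemma expect_scanNoise_sq_le {b Q : ℝ} (X : Matrix (Fin n) (Fin n) ℝ) (Y : Edge n → Bool)
    {q : Edge n → ℝ} (hq0 : ∀ e, 0 ≤ q e) (hQ : ∀ e, q e ≤ Q) (hQ0 : 0 ≤ Q) :
    expect (prodBern q) (fun Z => scanNoise b X Y q Z ^ 2) ≤ 2 * Q := by
  simp only [scanNoise]
  rw [expect_prodBern_linear_sq]
  have h1 : ∑ e, (scanWeight b X Y e / frobNorm X) ^ 2 ≤ 2 := by
    simp only [div_pow, ← Finset.sum_div]
    exact div_le_of_le_mul₀ (sq_nonneg _) two_pos.le (sum_scanWeight_sq_le b X Y)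
  calc ∑ e, (scanWeight b X Y e / frobNorm X) ^ 2 * (q e * (1 - q e))
      ≤ ∑ e, (scanWeight b X Y e / frobNorm X) ^ 2 * Q := by
        refine Finset.sum_le_sum fun e _ => mul_le_mul_of_nonneg_left ?_ (sq_nonneg _)
        nlinarith [hq0 e, hQ e]
    _ = (∑ e, (scanWeight b X Y e / frobNorm X) ^ 2) * Q := by rw [Finset.sum_mul]
    _ ≤ 2 * Q := mul_le_mul_of_nonneg_right h1 hQ0

/-- An estimator for the parameters `p₀, p₁, ρ` gives a test for the parameters `2p₀, 2p₁, ρ`. -/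
lemma Estimator.exists_test (A : Estimator n) {p₀ p₁ ρ c t : ℝ} (h0 : 0 < p₀) (h01 : p₀ < p₁)
    (h1 : p₁ ≤ 1 / 4) (hρ0 : 0 < ρ) (hρ1 : ρ ≤ 1) (hn : 0 < n) (hc : 0 < c) (ht0 : 0 ≤ t)
    (htb : 16 * t ≤ c * (n * ρ)) (htq : 128 * (t * p₀) ≤ c * ((p₁ - p₀) * (n * ρ))) :
    ∃ B : Test (Edge n), B.out < B.prog.time ∧
      B.prog.time ≤ A.prog.time + 302 * (n ^ 4 + 1) ∧
      B.acceptProb (nullLaw (2 * p₀) n) ≤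
        Real.exp (-(t * (c * ((p₁ - p₀) * (n * ρ))) / 32)) ∧
      B.rejectProb (plantedLaw (2 * p₀) (2 * p₁) ρ n) ≤ 1 - (A.meanCorr p₀ p₁ ρ - 3 * c / 4 -
        (4 / (n * ρ) + 4 / (c * (n * ρ)) + 16 * p₁ / c +
          1024 * p₁ / (c * ((p₁ - p₀) * (n * ρ))) ^ 2)) := by
  have hn' : (0 : ℝ) < n := Nat.cast_pos.2 hn
  set R : ℝ := n * ρ with hRd
  have hR : 0 < R := by positivity
  set τ : ℝ := c * ((p₁ - p₀) * R) / 16 with hτd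
  have hδ : 0 < p₁ - p₀ := sub_pos.2 h01
  have hτ : 0 < τ := by positivity
  set b : ℝ := 8 / (c * R) with hbd
  have hb : 0 < b := by positivity
  set q₀ := p₀ / (1 - p₀) with hq₀
  set q₁ := p₁ / (1 - p₁) with hq₁
  have hp0' : 0 < 1 - p₀ := by linarith
  have hp1' : 0 < 1 - p₁ := by linarith
  have hq₀0 : 0 ≤ q₀ := by positivity
  have hq₀2 : q₀ ≤ 2 * p₀ := by rw [hq₀, div_le_iff₀ hp0']; nlinarith
  have hq₁2 : q₁ ≤ 2 * p₁ := by rw [hq₁, div_le_iff₀ hp1']; nlinarith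
  -- The fresh edges have densities `p/(1-p)`, and this map does not shrink the gap between planted
  -- and null densities.
  have hd : p₁ - p₀ ≤ q₁ - q₀ := by
    have e : q₁ - q₀ = (p₁ - p₀) / ((1 - p₁) * (1 - p₀)) := by rw [hq₁, hq₀]; field_simp; ring
    rw [e, le_div_iff₀ (by positivity)]
    have : (1 - p₁) * (1 - p₀) ≤ 1 := by nlinarith
    nlinarith
  have hd0 : 0 < q₁ - q₀ := hδ.trans_le hd
  have hq₁0 : 0 ≤ q₁ := by linarith
  obtain ⟨B, hBo, hBt, hBa⟩ := A.exists_scan_test b q₀ τ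
  have hcoin := A.prog.isLaw_coinLaw
  have hsig := isLaw_signal (n := n) hρ0.le hρ1
  refine ⟨B, hBo, hBt, ?_, ?_⟩
  · have e1 : B.acceptProb (nullLaw (2 * p₀) n) =
        expect (prodBern fun _ : Edge n => p₀) fun y => expect (prodBern fun _ => q₀) fun z =>
          expect A.prog.coinLaw fun ω => scanAccept b q₀ τ (A.output y ω) y z := by
      have h := expect_thinning (ι := Edge n) (p := fun _ => p₀) (fun _ => by linarith)
        fun y x => expect A.prog.coinLaw fun ω => scanAccept b q₀ τ (A.output y ω) y x
      simp only [scanAccept_or] at h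
      rw [← h]
      change expect (nullLaw (2 * p₀) n) B.coinAccept = _
      rw [nullLaw]
      congr 1
      funext x
      exact hBa x
    rw [e1]
    have hY : IsLaw (prodBern fun _ : Edge n => p₀) :=
      isLaw_prodBern (fun _ => h0.le) fun _ => by linarith
    refine expect_le_of_le hY fun y => ?_
    -- Given `y` and the coins, the output of the estimator is fixed while `z` is still random, so
    -- the Chernoff bound applies to `z` alone.
    rw [expect_comm]
    refine expect_le_of_le hcoin fun ω => ?_
    refine (expect_scanAccept_le (t := t) hb.le hq₀0 (by linarith) ht0 ?_ ?_ _ y).trans ?_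
    · rw [hbd, mul_div_assoc', mul_div_assoc', div_le_one (by positivity)]
      linarith
    · rw [hτd]
      have := mul_le_mul_of_nonneg_left hq₀2 ht0
      linarith
    · refine Real.exp_le_exp.2 (le_of_eq ?_)
      rw [hτd]; ring
  · have hq : ∀ θ : Fin n → Bool, ∀ e, (p₀ + (p₁ - p₀) * pairBit θ e) /
        (1 - (p₀ + (p₁ - p₀) * pairBit θ e)) = q₀ + (q₁ - q₀) * pairBit θ e := by
      intro θ e
      rcases pairBit_eq_zero_or_one θ e with h | h
      · rw [h]; simp [hq₀]
      · rw [h, mul_one, mul_one, add_sub_cancel, add_sub_cancel]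
    let S : (Fin n → Bool) → (Edge n → Bool) → ℝ := fun θ y =>
      expect (prodBern fun e => q₀ + (q₁ - q₀) * pairBit θ e) fun z =>
          expect A.prog.coinLaw fun ω => scanAccept b q₀ τ (A.output y ω) y z
    have e1 : expect (plantedLaw (2 * p₀) (2 * p₁) ρ n) B.coinAccept =
        expect (prodBern fun _ : Fin n => ρ) fun θ => expect (graphLawGiven p₀ p₁ θ) fun y =>
          S θ y := by
      rw [expect_plantedLaw]
      congr 1
      funext θ
      have hlt : ∀ e, p₀ + (p₁ - p₀) * pairBit θ e < 1 := by
        intro e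
        rcases pairBit_eq_zero_or_one θ e with h | h <;> rw [h] <;> linarith
      have h := expect_thinning (ι := Edge n) hlt
        fun y x => expect A.prog.coinLaw fun ω => scanAccept b q₀ τ (A.output y ω) y x
      simp only [scanAccept_or, hq] at h
      refine Eq.trans ?_ h
      have hg : graphLawGiven (2 * p₀) (2 * p₁) θ =
          prodBern fun e => 2 * (p₀ + (p₁ - p₀) * pairBit θ e) := by
        rw [graphLawGiven]
        congr 1
        funext e
        rw [pairBit]; ring
      rw [hg]
      congr 1
      funext x
      exact hBa x
    have hP : IsLaw (plantedLaw (2 * p₀) (2 * p₁) ρ n) :=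
      isLaw_plantedLaw (by linarith) (by linarith) (by linarith) hρ0.le hρ1
    rw [Test.rejectProb_eq, expect_sub, expect_const hP, e1]
    refine sub_le_sub_left ?_ 1
    have hpt : ∀ θ : Fin n → Bool, ∀ y, expect A.prog.coinLaw (fun ω =>
        corr (A.output y ω) (signal p₀ p₁ θ)) ≤ S θ y + 3 * c / 4 +
        4 / R ^ 2 * (plantedSize θ - R) ^ 2 + 4 / (c * R) + 16 / (c * R ^ 2) * plantedEdges θ y +
        1 / τ ^ 2 * (2 * q₁) := by
      intro θ y
      have hq0' : ∀ e, 0 ≤ q₀ + (q₁ - q₀) * pairBit θ e := fun e =>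
        add_nonneg hq₀0 (mul_nonneg hd0.le (pairBit_nonneg θ e))
      have hq1' : ∀ e, q₀ + (q₁ - q₀) * pairBit θ e ≤ q₁ := by
        intro e
        rcases pairBit_eq_zero_or_one θ e with h | h <;> rw [h] <;> linarith
      have hZ : IsLaw (prodBern fun e => q₀ + (q₁ - q₀) * pairBit θ e) :=
        isLaw_prodBern hq0' fun e => (hq1' e).trans (by linarith)
      have hS : S θ y = expect A.prog.coinLaw fun ω =>
          expect (prodBern fun e => q₀ + (q₁ - q₀) * pairBit θ e) fun z =>
            scanAccept b q₀ τ (A.output y ω) y z := expect_comm _ _ _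
      have hω : ∀ ω, corr (A.output y ω) (signal p₀ p₁ θ) ≤
          expect (prodBern fun e => q₀ + (q₁ - q₀) * pairBit θ e) (fun z =>
            scanAccept b q₀ τ (A.output y ω) y z) + (3 * c / 4 +
          4 / R ^ 2 * (plantedSize θ - R) ^ 2 + 4 / (c * R) +
          16 / (c * R ^ 2) * plantedEdges θ y + 1 / τ ^ 2 * (2 * q₁)) := by
        intro ω
        have hbR : 8 ≤ c * (b * R) := by
          refine le_of_eq ?_
          rw [hbd]; field_simp
        have hdτ : 16 * τ ≤ (q₁ - q₀) * (c * R) := by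
          have := mul_le_mul_of_nonneg_right hd (mul_pos hc hR).le
          rw [hτd]; linarith
        have h := expect_mono hZ fun z => corr_le_scanAccept (q := q₀) h01 hb hτ hd0 hc hR hbR hdτ
          (A.output y ω) θ y z
        rw [expect_const hZ] at h
        simp only [expect_add, expect_const hZ, expect_const_mul] at h
        have hN := mul_le_mul_of_nonneg_left (expect_scanNoise_sq_le (b := b) (A.output y ω) y
          hq0' hq1' hq₁0) (show 0 ≤ 1 / τ ^ 2 by positivity)
        linarith
      have h := expect_mono hcoin hω
      rw [expect_add, expect_const hcoin, ← hS] at h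
      linarith
    have hgl : ∀ θ : Fin n → Bool, IsLaw (graphLawGiven p₀ p₁ θ) := fun θ =>
      isLaw_graphLawGiven h0.le h01.le (by linarith) θ
    have hmean : A.meanCorr p₀ p₁ ρ ≤ _ :=
      expect_mono hsig fun θ => expect_mono (hgl θ) fun y => hpt θ y
    simp only [expect_add, expect_const (hgl _), expect_const hsig, expect_const_mul] at hmean
    have hv := mul_le_mul_of_nonneg_left (expect_plantedSize_sub_sq_le (n := n) hρ0.le)
      (show 0 ≤ 4 / R ^ 2 by positivity)
    have he := mul_le_mul_of_nonneg_left (expect_plantedEdges_le (n := n) (ρ := ρ) (p₀ := p₀) (p₁ := p₁)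
      (by linarith)) (show 0 ≤ 16 / (c * R ^ 2) by positivity)
    have w1 : 4 / R ^ 2 * R = 4 / R := by field_simp
    have w2 : 16 / (c * R ^ 2) * (p₁ * R ^ 2) = 16 * p₁ / c := by field_simp
    have w3 : 1 / τ ^ 2 * (2 * q₁) ≤ 1024 * p₁ / (c * ((p₁ - p₀) * R)) ^ 2 := by
      have : 1 / τ ^ 2 * (2 * q₁) = 512 * q₁ / (c * ((p₁ - p₀) * R)) ^ 2 := by
        rw [hτd]; field_simp; ring
      rw [this]
      gcongr ?_ / _
      linarith
    rw [← hRd, w1] at hv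
    rw [← hRd, w2] at he
    linarith

end ScanErrors

/-! ## Consequences of the parameter regime -/

lemma snr_nonneg {p₀ p₁ : ℝ} (h : p₀ ≤ p₁) : 0 ≤ snr p₀ p₁ :=
  div_nonneg (sub_nonneg.2 h) (Real.sqrt_nonneg _)

lemma snr_sq {p₀ p₁ : ℝ} (h0 : 0 < p₀) (h1 : p₀ < 1) :
    snr p₀ p₁ ^ 2 = (p₁ - p₀) ^ 2 / (p₀ * (1 - p₀)) := by
  rw [snr, div_pow, Real.sq_sqrt (mul_pos h0 (sub_pos.2 h1)).le]

/-- Doubling both densities multiplies the squared gap by four and does not decrease the variance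
`p(1-p)` when `p₀ ≤ 1/4`; a constant loss is harmless in the regime. -/
lemma snr_two_mul_sq_le {p₀ : ℝ} (h0 : 0 < p₀) (h1 : p₀ ≤ 1 / 4) (p₁ : ℝ) :
    snr (2 * p₀) (2 * p₁) ^ 2 ≤ 4 * snr p₀ p₁ ^ 2 := by
  rw [snr_sq (by linarith) (by linarith), snr_sq h0 (by linarith), mul_div_assoc',
    div_le_div_iff₀ (mul_pos (by linarith) (by linarith)) (mul_pos h0 (by linarith))]
  have h2 : 0 ≤ (p₁ - p₀) ^ 2 * p₀ := by positivity
  nlinarith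

lemma sq_sub_ge {p₀ : ℝ} (h0 : 0 < p₀) (h1 : p₀ ≤ 1 / 4) (p₁ : ℝ) :
    3 / 4 * (snr p₀ p₁ ^ 2 * p₀) ≤ (p₁ - p₀) ^ 2 := by
  rw [snr_sq h0 (by linarith)]
  have hp : 0 < 1 - p₀ := by linarith
  have e : (p₁ - p₀) ^ 2 / (p₀ * (1 - p₀)) * p₀ = (p₁ - p₀) ^ 2 / (1 - p₀) := by field_simp
  rw [e, mul_div_assoc', div_le_iff₀ hp]
  nlinarith [sq_nonneg (p₁ - p₀)]

section Regime

variable {p₀ p₁ ρ : ℕ → ℝ}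

lemma tendsto_log_natCast : Tendsto (fun n : ℕ => Real.log n) atTop atTop :=
  Real.tendsto_log_atTop.comp tendsto_natCast_atTop_atTop

lemma Regime.eventually_p₀ (h : Regime (fun n => n) p₀ p₁ ρ) :
    ∀ᶠ n in atTop, 0 < p₀ n ∧ 1 / (n : ℝ) ≤ p₀ n := by
  filter_upwards [h.p₀_large.bound one_pos, eventually_gt_atTop 0] with n hn hpos
  have hn' : (0 : ℝ) < n := Nat.cast_pos.2 hpos
  have h1 : 0 < 1 / (n : ℝ) := by positivity
  rw [one_mul, Real.norm_of_nonneg h1.le, Real.norm_of_nonneg (h.p₀_nonneg n)] at hn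
  exact ⟨h1.trans_le hn, hn⟩

lemma Regime.tendsto_p₁ (h : Regime (fun n => n) p₀ p₁ ρ) : Tendsto p₁ atTop (𝓝 0) :=
  (isLittleO_one_iff ℝ).1 h.p₁_small

lemma Regime.tendsto_ρ (h : Regime (fun n => n) p₀ p₁ ρ) : Tendsto ρ atTop (𝓝 0) := by
  refine (isLittleO_one_iff ℝ).1 (h.ρ_small.trans_isBigO ?_)
  refine ((isLittleO_one_iff ℝ).2 ?_).isBigO
  simp only [one_div]
  exact tendsto_log_natCast.inv_tendsto_atTop

lemma Regime.eventually_ρ (h : Regime (fun n => n) p₀ p₁ ρ) :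
    ∀ᶠ n : ℕ in atTop, Real.log n ^ 2 ≤ ρ n * √n := by
  filter_upwards [h.ρ_large.bound one_pos, eventually_gt_atTop 0] with n hn hpos
  have hn' : (0 : ℝ) < n := Nat.cast_pos.2 hpos
  rw [one_mul, Real.norm_of_nonneg (by positivity), Real.norm_of_nonneg (h.ρ_nonneg n),
    div_le_iff₀ (Real.sqrt_pos.2 hn')] at hn
  exact hn

lemma Regime.tendsto_snr (h : Regime (fun n => n) p₀ p₁ ρ) :
    Tendsto (fun n : ℕ => snr (p₀ n) (p₁ n) ^ 2 * ρ n ^ 2 * n * Real.log n ^ 2) atTop (𝓝 0) := by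
  have := h.snr_small.tendsto_div_nhds_zero
  simpa only [one_div, div_inv_eq_mul] using this

lemma Regime.tendsto_ρ_mul_sqrt (h : Regime (fun n => n) p₀ p₁ ρ) :
    Tendsto (fun n : ℕ => ρ n * √n) atTop atTop := by
  refine tendsto_atTop_mono' _ h.eventually_ρ ?_
  exact (tendsto_pow_atTop two_ne_zero).comp tendsto_log_natCast

lemma Regime.tendsto_mean (h : Regime (fun n => n) p₀ p₁ ρ) :
    Tendsto (fun n : ℕ => (n : ℝ) * ρ n) atTop atTop := by
  refine tendsto_atTop_mono' _ ?_ h.tendsto_ρ_mul_sqrt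
  filter_upwards [eventually_ge_atTop 1] with n hn
  have hn' : (1 : ℝ) ≤ n := Nat.one_le_cast.2 hn
  rw [mul_comm]
  refine mul_le_mul_of_nonneg_right ?_ (h.ρ_nonneg n)
  exact Real.sqrt_le_self_iff.2 (Or.inr hn')

/-- Weak recovery is impossible unless `λ ρ n → ∞`. -/
lemma WeakRecovery.tendsto_snr_mul (h : Regime (fun n => n) p₀ p₁ ρ) {A : ∀ n, Estimator n}
    (hA : WeakRecovery p₀ p₁ ρ A) :
    Tendsto (fun n : ℕ => snr (p₀ n) (p₁ n) * (n * ρ n)) atTop atTop := by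
  obtain ⟨c, hc, hcorr⟩ := hA
  rw [tendsto_atTop]
  intro K
  have h1 : ∀ᶠ n : ℕ in atTop, ρ n * Real.exp (4 * K ^ 2) < c ^ 4 := by
    have : Tendsto (fun n => ρ n * Real.exp (4 * K ^ 2)) atTop (𝓝 0) := by
      simpa using h.tendsto_ρ.mul_const (Real.exp (4 * K ^ 2))
    exact this.eventually_lt_const (by positivity)
  have h2 : ∀ᶠ n : ℕ in atTop, 2 * K ^ 2 ≤ ρ n * √n :=
    h.tendsto_ρ_mul_sqrt.eventually_ge_atTop _
  filter_upwards [hcorr, h1, h2, h.eventually_p₀, h.tendsto_p₁.eventually_lt_const one_pos,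
    h.tendsto_ρ_mul_sqrt.eventually_ge_atTop 1, eventually_gt_atTop 0]
    with n hn h1 h2 hp0 hp1 hg hpos
  by_contra hK
  rw [not_le] at hK
  have hn' : (0 : ℝ) < n := Nat.cast_pos.2 hpos
  have hl := snr_nonneg (h.p₀_le_p₁ n)
  set l := snr (p₀ n) (p₁ n) with hld
  have hρ0 : 0 ≤ ρ n := h.ρ_nonneg n
  have hsq : (l * (n * ρ n)) ^ 2 ≤ K ^ 2 := by
    gcongr
  have hs : √(n : ℝ) ^ 2 = n := Real.sq_sqrt hn'.le
  have hg2 : 2 * K ^ 2 ≤ n * ρ n ^ 2 := by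
    calc 2 * K ^ 2 ≤ (ρ n * √n) * 1 := by linarith
      _ ≤ (ρ n * √n) * (ρ n * √n) := by gcongr
      _ = ρ n ^ 2 * √(n : ℝ) ^ 2 := by ring
      _ = n * ρ n ^ 2 := by rw [hs]; ring
  -- If `λR < K`, then `2λ²n · nρ² ≤ 2K² ≤ nρ²`. The information bound is thus applicable and gives
  -- `c⁴ ≤ ρ e^{4K²}`, which fails for large `n` since `ρ → 0`.
  have hsnr : 2 * (l ^ 2 * n) ≤ 1 := by
    have hμ : 0 < n * ρ n ^ 2 := by
      have : 0 < ρ n := by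
        rcases hρ0.eq_or_lt with h0 | h0
        · rw [← h0] at hg; norm_num at hg
        · exact h0
      positivity
    have h3 : 2 * (l ^ 2 * n) * (n * ρ n ^ 2) ≤ 1 * (n * ρ n ^ 2) := by
      calc 2 * (l ^ 2 * n) * (n * ρ n ^ 2) = 2 * (l * (n * ρ n)) ^ 2 := by ring
        _ ≤ 2 * K ^ 2 := by linarith
        _ ≤ _ := by linarith
    exact le_of_mul_le_mul_right h3 hμ
  have hb := meanCorr_pow_four_le (A n) hp0.1 (h.p₀_le_p₁ n) hp1 hρ0 (h.ρ_le_one n)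
    (A n).prog.isLaw_coinLaw hsnr
  have h4 : c ^ 4 ≤ (A n).meanCorr (p₀ n) (p₁ n) (ρ n) ^ 4 := by gcongr
  have h5 : ρ n * Real.exp (4 * (l ^ 2 * n ^ 2 * ρ n ^ 2)) ≤ ρ n * Real.exp (4 * K ^ 2) := by
    refine mul_le_mul_of_nonneg_left (Real.exp_le_exp.2 ?_) hρ0
    have : l ^ 2 * n ^ 2 * ρ n ^ 2 = (l * (n * ρ n)) ^ 2 := by ring
    rw [this]; linarith
  linarith

/-- Exponent of the lower bound on the running time. -/
def timeExponent (p₀ p₁ : ℝ) (n : ℕ) : ℝ := (snr p₀ p₁ ^ 2)⁻¹ * (Real.log n ^ 4)⁻¹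

/-- Exponent of the bound on the low-degree advantage. -/
def advExponent (p₀ p₁ ρ : ℝ) (n : ℕ) : ℝ := 220 * (snr p₀ p₁ ^ 2 * (n * ρ ^ 2) ^ 2) + 2

/-- The lower bound on `ρ` reads `(log n)⁴ ≤ ρ²n`; it converts smallness of `λ²ρ²n` into smallness
of `λ²` against powers of the logarithm. -/
lemma Regime.eventually_snr_log (h : Regime (fun n => n) p₀ p₁ ρ) :
    ∀ᶠ n : ℕ in atTop, snr (p₀ n) (p₁ n) ^ 2 * Real.log n ^ 6 ≤
      snr (p₀ n) (p₁ n) ^ 2 * ρ n ^ 2 * n * Real.log n ^ 2 := by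
  filter_upwards [h.eventually_ρ] with n hn
  have hs : √(n : ℝ) ^ 2 = n := Real.sq_sqrt (Nat.cast_nonneg n)
  have h1 : Real.log n ^ 4 ≤ ρ n ^ 2 * n := by
    calc Real.log n ^ 4 = (Real.log n ^ 2) ^ 2 := by ring
      _ ≤ (ρ n * √n) ^ 2 := by gcongr
      _ = ρ n ^ 2 * √(n : ℝ) ^ 2 := by ring
      _ = _ := by rw [hs]
  calc snr (p₀ n) (p₁ n) ^ 2 * Real.log n ^ 6
      = snr (p₀ n) (p₁ n) ^ 2 * Real.log n ^ 2 * Real.log n ^ 4 := by ring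
    _ ≤ snr (p₀ n) (p₁ n) ^ 2 * Real.log n ^ 2 * (ρ n ^ 2 * n) := by gcongr
    _ = _ := by ring

lemma Regime.tendsto_log_div (h : Regime (fun n => n) p₀ p₁ ρ) :
    Tendsto (fun n : ℕ => Real.log n / timeExponent (p₀ n) (p₁ n) n) atTop (𝓝 0) := by
  refine squeeze_zero' ?_ ?_ h.tendsto_snr
  · filter_upwards with n
    have := Real.log_natCast_nonneg n
    rw [timeExponent]
    positivity
  · filter_upwards [h.eventually_snr_log, tendsto_log_natCast.eventually_ge_atTop 1]
      with n hn hlog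
    have h56 : snr (p₀ n) (p₁ n) ^ 2 * Real.log n ^ 5 ≤ snr (p₀ n) (p₁ n) ^ 2 * Real.log n ^ 6 := by
      gcongr; norm_num
    refine le_trans (le_of_eq ?_) (h56.trans hn)
    rw [timeExponent, ← mul_inv, div_inv_eq_mul]; ring

/-- The main term of the quotient is exactly a constant times the square of `λ²ρ²n(log n)²`. This
matches the fourth power of the logarithm in the time exponent with the second power in the regime.
-/
lemma Regime.tendsto_advExponent_div (h : Regime (fun n => n) p₀ p₁ ρ) :
    Tendsto (fun n : ℕ => advExponent (p₀ n) (p₁ n) (ρ n) n / timeExponent (p₀ n) (p₁ n) n)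
      atTop (𝓝 0) := by
  have hlim : Tendsto (fun n : ℕ =>
      220 * (snr (p₀ n) (p₁ n) ^ 2 * ρ n ^ 2 * n * Real.log n ^ 2) ^ 2 +
      2 * (snr (p₀ n) (p₁ n) ^ 2 * ρ n ^ 2 * n * Real.log n ^ 2)) atTop (𝓝 0) := by
    simpa using ((h.tendsto_snr.pow 2).const_mul 220).add (h.tendsto_snr.const_mul 2)
  refine squeeze_zero' ?_ ?_ hlim
  · filter_upwards with n
    rw [timeExponent, advExponent]
    positivity
  · filter_upwards [h.eventually_snr_log, tendsto_log_natCast.eventually_ge_atTop 1]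
      with n hn hlog
    have h46 : snr (p₀ n) (p₁ n) ^ 2 * Real.log n ^ 4 ≤ snr (p₀ n) (p₁ n) ^ 2 * Real.log n ^ 6 := by
      gcongr; norm_num
    rw [timeExponent, advExponent, ← mul_inv, div_inv_eq_mul]
    calc _ = 220 * (snr (p₀ n) (p₁ n) ^ 2 * ρ n ^ 2 * n * Real.log n ^ 2) ^ 2 +
        2 * (snr (p₀ n) (p₁ n) ^ 2 * Real.log n ^ 4) := by ring
      _ ≤ _ := by linarith

end Regime

/-! ## Tests for the hidden sample problem from weak recovery -/

section HiddenTests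

variable {p₀ p₁ ρ : ℕ → ℝ}

/-- Exponent of the false alarm probability of the scan test. -/
def scanExponent (c l ρ : ℝ) (n : ℕ) : ℝ :=
  c ^ 2 / 8192 * (l * (n * ρ) * min (ρ * √n) (l * (n * ρ)))

/-- Number of samples of the hidden sample problem. -/
def sampleCount (c p₀ p₁ ρ : ℝ) (n : ℕ) : ℕ :=
  ⌈Real.exp (advExponent p₀ p₁ ρ n) *
    min (n : ℝ) (Real.exp (scanExponent c (snr p₀ p₁) ρ n / 2))⌉₊

/-- Up to a constant `λ²p₀` is at most `(p₁ - p₀)²`, and `p₀ ≥ 1/n`. -/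
lemma snr_le_sqrt_mul {a b : ℝ} {n : ℕ} (ha : 0 < a) (ha4 : a ≤ 1 / 4) (hab : a ≤ b) (hn : 0 < n)
    (hna : 1 / (n : ℝ) ≤ a) : snr a b ≤ 2 * √n * (b - a) := by
  have hn' : (0 : ℝ) < n := Nat.cast_pos.2 hn
  refine (abs_le_of_sq_le_sq' ?_ (mul_nonneg (by positivity) (sub_nonneg.2 hab))).2
  have h1 := sq_sub_ge ha ha4 b
  have h2 : (1 : ℝ) ≤ a * n := (div_le_iff₀ hn').1 hna
  have h3 : snr a b ^ 2 ≤ snr a b ^ 2 * (a * n) := le_mul_of_one_le_right (sq_nonneg _) h2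
  have h4 : 3 / 4 * (snr a b ^ 2 * a) * n ≤ (b - a) ^ 2 * n :=
    mul_le_mul_of_nonneg_right h1 hn'.le
  have h5 : (2 * √n * (b - a)) ^ 2 = 4 * ((b - a) ^ 2 * n) := by
    rw [mul_pow, mul_pow, Real.sq_sqrt hn'.le]; ring
  rw [h5]
  nlinarith [mul_nonneg (sq_nonneg (b - a)) hn'.le]

lemma mul_min_le_scan {a b r : ℝ} {n : ℕ} (ha : 0 < a) (ha4 : a ≤ 1 / 4) (hab : a ≤ b) (hn : 0 < n)
    (hna : 1 / (n : ℝ) ≤ a) (hr : 0 ≤ r) :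
    snr a b * (n * r) * (r * √n) ≤ 2 * ((b - a) * (n * r) ^ 2) := by
  have hn' : (0 : ℝ) < n := Nat.cast_pos.2 hn
  have hs : √(n : ℝ) * √n = n := Real.mul_self_sqrt hn'.le
  calc snr a b * (n * r) * (r * √n) = snr a b * ((n * r) * (r * √n)) := by ring
    _ ≤ 2 * √n * (b - a) * ((n * r) * (r * √n)) := by
        refine mul_le_mul_of_nonneg_right (snr_le_sqrt_mul ha ha4 hab hn hna) (by positivity)
    _ = 2 * ((b - a) * (n * r ^ 2 * (√(n : ℝ) * √n))) := by ring
    _ = _ := by rw [hs]; ring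

/-- Split `b = a + (b - a)`: the null density is beaten by the squared signal-to-noise ratio, the
excess density by the number of excess planted edges. -/
lemma scan_variance_le {a b c R J : ℝ} (hc : 0 < c) (ha : 0 < a) (hδ : 0 < b - a) (hR : 0 < R)
    (hJ : 2 * (65536 / c ^ 3) ≤ J) (hsq : 3 / 4 * (J * a) ≤ ((b - a) * R) ^ 2)
    (hlin : 2 * (65536 / c ^ 3) ≤ 2 * ((b - a) * R ^ 2)) :
    1024 * b / (c * ((b - a) * R)) ^ 2 ≤ c / 32 := by
  set D := ((b - a) * R) ^ 2 with hD
  have hD0 : 0 < D := by positivity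
  set K := 65536 / c ^ 3 with hK
  have hK0 : 0 < K := by positivity
  have k1 : a * K ≤ D := by
    have h1 := mul_le_mul_of_nonneg_right hJ ha.le
    have h2 : 0 < a * K := by positivity
    linarith
  have k2 : (b - a) * K ≤ D := by
    have h1 : K ≤ (b - a) * R ^ 2 := by linarith
    calc (b - a) * K ≤ (b - a) * ((b - a) * R ^ 2) := mul_le_mul_of_nonneg_left h1 hδ.le
      _ = D := by rw [hD]; ring
  have k3 : b * K ≤ 2 * D := by linarith
  rw [mul_pow, ← hD, div_le_iff₀ (by positivity)]
  rw [hK, mul_div_assoc', div_le_iff₀ (by positivity)] at k3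
  have k4 : c / 32 * (c ^ 2 * D) = c ^ 3 * D / 32 := by ring
  rw [k4]
  linarith

lemma eventually_exists_test (h : Regime (fun n => n) p₀ p₁ ρ) {A : ∀ n, Estimator n} {c : ℝ}
    (hc : 0 < c) (hcorr : ∀ᶠ n in atTop, c ≤ (A n).meanCorr (p₀ n) (p₁ n) (ρ n))
    (hJ : Tendsto (fun n : ℕ => snr (p₀ n) (p₁ n) * (n * ρ n)) atTop atTop) :
    ∀ᶠ n : ℕ in atTop, ∃ B : Test (Edge n), B.out < B.prog.time ∧
      B.prog.time ≤ (A n).prog.time + 302 * (n ^ 4 + 1) ∧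
      B.acceptProb (nullLaw (2 * p₀ n) n) ≤
        Real.exp (-scanExponent c (snr (p₀ n) (p₁ n)) (ρ n) n) ∧
      B.rejectProb (plantedLaw (2 * p₀ n) (2 * p₁ n) (ρ n) n) ≤ 1 - c / 8 := by
  have hg := h.tendsto_ρ_mul_sqrt
  have hJJ := hJ.atTop_mul_atTop₀ hJ
  have hJg := hJ.atTop_mul_atTop₀ hg
  filter_upwards [hcorr, h.eventually_p₀, hJ.eventually_ge_atTop 1, hg.eventually_ge_atTop 1,
    hJJ.eventually_ge_atTop (2 * (65536 / c ^ 3)), hJg.eventually_ge_atTop (2 * (65536 / c ^ 3)),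
    h.tendsto_p₁.eventually_le_const (show (0 : ℝ) < 1 / 4 by norm_num),
    h.tendsto_p₁.eventually_le_const (show (0 : ℝ) < c ^ 2 / 512 by positivity),
    h.tendsto_mean.eventually_ge_atTop (128 / c), h.tendsto_mean.eventually_ge_atTop (128 / c ^ 2),
    eventually_gt_atTop 0] with n hmc hp0 hJ1 hg1 hJ2 hJg2 hp4 hpc hR1 hR2 hn
  have hn' : (0 : ℝ) < n := Nat.cast_pos.2 hn
  obtain ⟨ha, hna⟩ := hp0
  have hab := h.p₀_le_p₁ n
  have hr0 : 0 < ρ n := by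
    rcases (h.ρ_nonneg n).eq_or_lt with h0 | h0
    · rw [← h0] at hg1; norm_num at hg1
    · exact h0
  have hr1 := h.ρ_le_one n
  set a := p₀ n
  set b := p₁ n
  set r := ρ n
  have hlt : a < b := by
    rcases hab.eq_or_lt with h0 | h0
    · rw [← h0] at hJ1; simp [snr] at hJ1; norm_num at hJ1
    · exact h0
  have ha4 : a ≤ 1 / 4 := hab.trans hp4
  have hδ : 0 < b - a := sub_pos.2 hlt
  set R : ℝ := n * r with hRd
  have hR : 0 < R := by positivity
  set l := snr a b with hl
  have hkey := mul_min_le_scan ha ha4 hab hn hna hr0.le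
  have hsq := sq_sub_ge ha ha4 b
  rw [← hRd, ← hl] at hkey
  rw [← hl] at hsq
  have hsqR : 3 / 4 * (l * R * (l * R) * a) ≤ ((b - a) * R) ^ 2 := by
    have := mul_le_mul_of_nonneg_right hsq (sq_nonneg R)
    nlinarith
  -- The largest tilt allowed by truncation and by sparsity of the null graph. The first alternative
  -- yields the factor `ρ√n` in the scan exponent, the second the factor `λR`.
  set t := min (c * R / 16) (c * ((b - a) * R) / (128 * a)) with ht
  have ht0 : 0 ≤ t := le_min (by positivity) (by positivity)
  obtain ⟨B, hBo, hBt, hBa, hBr⟩ := (A n).exists_test (t := t) ha hlt hp4 hr0 hr1 hn hc ht0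
    (by have := min_le_left (c * R / 16) (c * ((b - a) * R) / (128 * a)); rw [← ht] at this; linarith)
    (by
      have := min_le_right (c * R / 16) (c * ((b - a) * R) / (128 * a))
      rw [← ht, le_div_iff₀ (by positivity)] at this
      linarith)
  refine ⟨B, hBo, hBt, hBa.trans (Real.exp_le_exp.2 (neg_le_neg ?_)), hBr.trans ?_⟩
  · have hJ0 : 0 ≤ l * R := by linarith
    rw [scanExponent, ← hRd]
    rcases min_choice (c * R / 16) (c * ((b - a) * R) / (128 * a)) with hm | hm
    · rw [ht, hm]
      have h1 : l * R * min (r * √n) (l * R) ≤ l * R * (r * √n) :=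
        mul_le_mul_of_nonneg_left (min_le_left _ _) hJ0
      have h2 : c * R / 16 * (c * ((b - a) * R)) / 32 =
          c ^ 2 / 1024 * (2 * ((b - a) * R ^ 2)) := by ring
      rw [h2]
      have h3 : 0 ≤ (b - a) * R ^ 2 := by positivity
      calc c ^ 2 / 8192 * (l * R * min (r * √n) (l * R))
          ≤ c ^ 2 / 8192 * (2 * ((b - a) * R ^ 2)) := by
            refine mul_le_mul_of_nonneg_left (h1.trans hkey) (by positivity)
        _ ≤ _ := by
            refine mul_le_mul_of_nonneg_right ?_ (by positivity)
            have := sq_nonneg c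
            linarith
    · rw [ht, hm]
      have h1 : l * R * min (r * √n) (l * R) ≤ l * R * (l * R) :=
        mul_le_mul_of_nonneg_left (min_le_right _ _) hJ0
      have h2 : c * ((b - a) * R) / (128 * a) * (c * ((b - a) * R)) / 32 =
          c ^ 2 / 4096 * (((b - a) * R) ^ 2 / a) := by field_simp; ring
      rw [h2]
      have h3 : 3 / 4 * (l * R * (l * R)) ≤ ((b - a) * R) ^ 2 / a := by
        rw [le_div_iff₀ ha]; linarith
      have h4 : 0 ≤ c ^ 2 := sq_nonneg c
      calc c ^ 2 / 8192 * (l * R * min (r * √n) (l * R))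
          ≤ c ^ 2 / 8192 * (l * R * (l * R)) := mul_le_mul_of_nonneg_left h1 (by positivity)
        _ ≤ c ^ 2 / 4096 * (3 / 4 * (l * R * (l * R))) := by
            have : 0 ≤ c ^ 2 * (l * R * (l * R)) := by positivity
            linarith
        _ ≤ _ := mul_le_mul_of_nonneg_left h3 (by positivity)
  -- Of the margin `c - 3c/4 = c/4`, the four error terms take at most `c/32` each, leaving `c/8`.
  · have s1 : 4 / R ≤ c / 32 := by
      rw [div_le_iff₀ hR]
      rw [div_le_iff₀ hc] at hR1
      linarith
    have s2 : 4 / (c * R) ≤ c / 32 := by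
      rw [div_le_iff₀ (by positivity)]
      rw [div_le_iff₀ (by positivity)] at hR2
      linarith
    have s3 : 16 * b / c ≤ c / 32 := by
      rw [div_le_iff₀ hc]
      nlinarith
    have s4 : 1024 * b / (c * ((b - a) * R)) ^ 2 ≤ c / 32 :=
      scan_variance_le hc ha hδ hR hJ2 hsqR (hJg2.trans hkey)
    linarith

lemma tendsto_scanExponent (h : Regime (fun n => n) p₀ p₁ ρ) {c : ℝ} (hc : 0 < c)
    (hJ : Tendsto (fun n : ℕ => snr (p₀ n) (p₁ n) * (n * ρ n)) atTop atTop) :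
    Tendsto (fun n : ℕ => scanExponent c (snr (p₀ n) (p₁ n)) (ρ n) n) atTop atTop := by
  have hmin : Tendsto (fun n : ℕ => min (ρ n * √n) (snr (p₀ n) (p₁ n) * (n * ρ n)))
      atTop atTop := by
    refine tendsto_atTop.2 fun K => ?_
    filter_upwards [h.tendsto_ρ_mul_sqrt.eventually_ge_atTop K, hJ.eventually_ge_atTop K]
      with n h1 h2 using le_min h1 h2
  exact (hJ.atTop_mul_atTop₀ hmin).const_mul_atTop (by positivity)

/-- The main term of the advantage exponent is `220 · λR · (λRρ²)`. Here `λRρ² = (λρ√n) · ρ ·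
(ρ√n)`, so it is negligible against `ρ√n` because `λρ√n ≤ 1` and `ρ → 0`; it is negligible against
`λR` because `ρ² → 0`. With `1760 = 8 · 220` the main term is at most `F/8`, and the additive `2` is
at most `F/8` once `F ≥ 16`. -/
lemma eventually_advExponent_le (h : Regime (fun n => n) p₀ p₁ ρ) {c : ℝ} (hc : 0 < c)
    (hJ : Tendsto (fun n : ℕ => snr (p₀ n) (p₁ n) * (n * ρ n)) atTop atTop) :
    ∀ᶠ n : ℕ in atTop, advExponent (p₀ n) (p₁ n) (ρ n) n ≤
      scanExponent c (snr (p₀ n) (p₁ n)) (ρ n) n / 4 := by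
  have hε : 0 < c ^ 2 / 8192 / 1760 := by positivity
  filter_upwards [(tendsto_scanExponent h hc hJ).eventually_ge_atTop 16,
    h.tendsto_ρ.eventually_le_const hε, h.tendsto_ρ.eventually_le_const one_pos,
    h.tendsto_snr.eventually_le_const one_pos, tendsto_log_natCast.eventually_ge_atTop 1,
    hJ.eventually_ge_atTop 0, eventually_gt_atTop 0] with n hF hρε hρ1 hw hlog hJ0 hn
  have hr := h.ρ_nonneg n
  have hl := snr_nonneg (h.p₀_le_p₁ n)
  have hn' : (0 : ℝ) < n := Nat.cast_pos.2 hn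
  have hs : √(n : ℝ) * √n = n := Real.mul_self_sqrt hn'.le
  set l := snr (p₀ n) (p₁ n)
  set r := ρ n
  set c₁ := c ^ 2 / 8192 with hc₁
  have hc₁0 : 0 < c₁ := by positivity
  have hsmall : l * r * √n ≤ 1 := by
    refine (abs_le_of_sq_le_sq' ?_ zero_le_one).2
    have h1 : (l * r * √n) ^ 2 = l ^ 2 * r ^ 2 * n := by
      rw [mul_pow, mul_pow, Real.sq_sqrt hn'.le]
    rw [h1, one_pow]
    refine le_trans ?_ hw
    exact le_mul_of_one_le_right (by positivity) (one_le_pow₀ hlog)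
  have k1 : 1760 * (l * (n * r) * r ^ 2) ≤ c₁ * (r * √n) := by
    have e1 : l * (n * r) * r ^ 2 = (l * r * √n) * r * (r * √n) := by
      calc l * (n * r) * r ^ 2 = l * r ^ 3 * n := by ring
        _ = l * r ^ 3 * (√(n : ℝ) * √n) := by rw [hs]
        _ = _ := by ring
    have e2 : (l * r * √n) * r ≤ c₁ / 1760 :=
      le_trans (mul_le_of_le_one_left hr hsmall) hρε
    have := mul_le_mul_of_nonneg_right e2 (show 0 ≤ r * √n by positivity)
    rw [e1]
    linarith
  have k2 : 1760 * (l * (n * r) * r ^ 2) ≤ c₁ * (l * (n * r)) := by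
    have e2 : r ^ 2 ≤ c₁ / 1760 := by
      refine le_trans ?_ hρε
      rw [sq]; exact mul_le_of_le_one_left hr hρ1
    have := mul_le_mul_of_nonneg_left e2 hJ0
    linarith
  have k3 : 1760 * (l * (n * r) * r ^ 2) ≤ c₁ * min (r * √n) (l * (n * r)) := by
    rcases min_choice (r * √n) (l * (n * r)) with hm | hm <;> rw [hm] <;> assumption
  have k4 := mul_le_mul_of_nonneg_left k3 hJ0
  rw [advExponent]
  rw [scanExponent] at hF ⊢
  have e3 : l ^ 2 * (n * r ^ 2) ^ 2 = l * (n * r) * (l * (n * r) * r ^ 2) := by ring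
  rw [e3]
  rw [← hc₁] at hF ⊢
  nlinarith

lemma sampleCount_pos {c p₀ p₁ ρ : ℝ} {n : ℕ} (hn : 0 < n) : 0 < sampleCount c p₀ p₁ ρ n := by
  have hn' : (0 : ℝ) < n := Nat.cast_pos.2 hn
  exact Nat.ceil_pos.2 (mul_pos (Real.exp_pos _) (lt_min hn' (Real.exp_pos _)))

lemma eventually_exists_hidden_test (h : Regime (fun n => n) p₀ p₁ ρ) {A : ∀ n, Estimator n}
    {c : ℝ} (hc : 0 < c) (hcorr : ∀ᶠ n in atTop, c ≤ (A n).meanCorr (p₀ n) (p₁ n) (ρ n))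
    (hJ : Tendsto (fun n : ℕ => snr (p₀ n) (p₁ n) * (n * ρ n)) atTop atTop) :
    ∀ᶠ n : ℕ in atTop, ∃ B : Test (Fin (sampleCount c (p₀ n) (p₁ n) (ρ n) n) × Edge n),
      B.prog.time ≤ sampleCount c (p₀ n) (p₁ n) (ρ n) n *
        ((A n).prog.time + 302 * (n ^ 4 + 1) + 8) + 3 ∧
      B.error (hiddenPlanted _ (plantedLaw (2 * p₀ n) (2 * p₁ n) (ρ n) n) (nullLaw (2 * p₀ n) n))
        (hiddenNull _ (nullLaw (2 * p₀ n) n)) ≤ 1 - c / 16 := by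
  have hF := tendsto_scanExponent h hc hJ
  have hexp : Tendsto (fun n : ℕ =>
      2 * Real.exp (-(scanExponent c (snr (p₀ n) (p₁ n)) (ρ n) n / 4))) atTop (𝓝 0) := by
    have := (Real.tendsto_exp_neg_atTop_nhds_zero.comp (hF.atTop_div_const four_pos)).const_mul 2
    simpa using this
  filter_upwards [eventually_exists_test h hc hcorr hJ, eventually_advExponent_le h hc hJ,
    hexp.eventually_le_const (show 0 < c / 16 by positivity), hF.eventually_ge_atTop 0,
    h.tendsto_p₁.eventually_le_const (show (0 : ℝ) < 1 / 4 by norm_num),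
    eventually_ge_atTop 1] with n hB hL he hF0 hp4 hn
  obtain ⟨B, hBo, hBt, hBa, hBr⟩ := hB
  have hn' : (1 : ℝ) ≤ n := Nat.one_le_cast.2 hn
  have ha := h.p₀_nonneg n
  have hab := h.p₀_le_p₁ n
  set M := sampleCount c (p₀ n) (p₁ n) (ρ n) n with hM
  set F := scanExponent c (snr (p₀ n) (p₁ n)) (ρ n) n with hFd
  set L := advExponent (p₀ n) (p₁ n) (ρ n) n with hLd
  have hL0 : 0 ≤ L := by rw [hLd, advExponent]; positivity
  obtain ⟨B', hB't, hB'e⟩ := B.exists_hidden_test hBo (M := M) (sampleCount_pos hn)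
    (isLaw_plantedLaw (n := n) (by linarith : 0 ≤ 2 * p₀ n) (by linarith : 2 * p₀ n ≤ 2 * p₁ n)
      (by linarith) (h.ρ_nonneg n) (h.ρ_le_one n))
    (isLaw_prodBern (fun _ : Edge n => (by linarith : 0 ≤ 2 * p₀ n)) fun _ => by linarith)
  refine ⟨B', ?_, hB'e.trans ?_⟩
  · rw [hB't]; gcongr
  -- With `L ≤ F/4`, the `M` samples together cause at most `2e^{L + F/2 - F} ≤ 2e^{-F/4}` false
  -- alarms.
  · have hMle : (M : ℝ) ≤ 2 * Real.exp (L + F / 2) := by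
      have h1 : (M : ℝ) < Real.exp L * min (n : ℝ) (Real.exp (F / 2)) + 1 :=
        Nat.ceil_lt_add_one (by positivity)
      have h2 : Real.exp L * min (n : ℝ) (Real.exp (F / 2)) ≤ Real.exp (L + F / 2) := by
        rw [Real.exp_add]
        exact mul_le_mul_of_nonneg_left (min_le_right _ _) (Real.exp_pos _).le
      have h3 : 1 ≤ Real.exp (L + F / 2) := Real.one_le_exp (by linarith)
      linarith
    have hMa : (M : ℝ) * B.acceptProb (nullLaw (2 * p₀ n) n) ≤ c / 16 := by
      calc (M : ℝ) * B.acceptProb (nullLaw (2 * p₀ n) n) ≤ M * Real.exp (-F) := by gcongr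
        _ ≤ 2 * Real.exp (L + F / 2) * Real.exp (-F) := by gcongr
        _ = 2 * Real.exp (L + F / 2 + -F) := by rw [mul_assoc, ← Real.exp_add]
        _ ≤ 2 * Real.exp (-(F / 4)) := by gcongr; linarith
        _ ≤ _ := he
    have : (M : ℝ) * B.acceptProb (prodBern fun _ : Edge n => 2 * p₀ n) ≤ c / 16 := hMa
    linarith

end HiddenTests

/-! ## Lower bound on the running time of weak recovery -/

lemma isLaw_hiddenPlanted {ι : Type} [Fintype ι] [DecidableEq ι] {M : ℕ} (hM : 0 < M)
    {P Q : (ι → Bool) → ℝ} (hP : IsLaw P) (hQ : IsLaw Q) : IsLaw (hiddenPlanted M P Q) where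
  nonneg Y := mul_nonneg (by positivity) (Finset.sum_nonneg fun κ _ => Finset.prod_nonneg
    fun j _ => by split_ifs; exacts [hP.nonneg _, hQ.nonneg _])
  sum_eq_one := by
    have hM' : (M : ℝ) ≠ 0 := Nat.cast_ne_zero.2 hM.ne'
    have h := expect_hiddenPlanted M P Q fun _ => 1
    have h1 : ∀ κ : Fin M, expect (fun Y : Fin M × ι → Bool =>
        ∏ j, (if j = κ then P else Q) fun i => Y (j, i)) (fun _ => 1) = 1 := by
      intro κ
      have h2 := sum_hiddenTerm (fun j => if j = κ then P else Q) fun _ _ => (1 : ℝ)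
      simp only [Finset.prod_const_one] at h2
      refine h2.trans (Finset.prod_eq_one fun j _ => ?_)
      split_ifs
      exacts [expect_const hP 1, expect_const hQ 1]
    simp only [h1] at h
    simpa [expect, hM'] using h

/-- The logarithm of the dimension cancels, so the time budget does not depend on the number of
samples. -/
lemma timeBound_eq {N D : ℕ} {C : ℝ} (hN : 2 ≤ N) : timeBound N D C = Real.exp (D / C) := by
  have hN' : (1 : ℝ) < N := by exact_mod_cast hN
  have hlog : Real.log N ≠ 0 := (Real.log_pos hN').ne'
  rw [timeBound, Real.rpow_def_of_pos (by linarith)]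
  congr 1
  rw [mul_comm C, ← div_div, mul_div_assoc', mul_div_cancel₀ _ hlog]

lemma card_edge_eq (n : ℕ) : (n : ℝ) ^ 2 = n + 2 * Fintype.card (Edge n) := by
  have h := sum_pairs_eq (n := n) fun _ _ => 1
  simp only [Finset.sum_const, Finset.card_univ, Fintype.card_fin, nsmul_eq_mul, mul_one] at h
  rw [sq, h]; ring

lemma succ_le_card_edge {n : ℕ} (hn : 4 ≤ n) : (n : ℝ) + 1 ≤ Fintype.card (Edge n) := by
  have h := card_edge_eq n
  have hn' : (4 : ℝ) ≤ n := by exact_mod_cast hn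
  nlinarith

/-! ### Degree, number of samples and running time along a subsequence -/

section Sequences

variable {p₀ p₁ ρ : ℕ → ℝ}

/-- Doubling the densities along a subsequence stays in the regime. -/
lemma Regime.two_mul_comp (h : Regime (fun n => n) p₀ p₁ ρ) {φ : ℕ → ℕ} (hφ : StrictMono φ)
    (hp : ∀ k, 2 * p₁ (φ k) ≤ 1) :
    Regime φ (fun k => 2 * p₀ (φ k)) (fun k => 2 * p₁ (φ k)) fun k => ρ (φ k) where
  size := hφ.tendsto_atTop
  p₀_nonneg k := mul_nonneg two_pos.le (h.p₀_nonneg _)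
  p₀_le_p₁ k := mul_le_mul_of_nonneg_left (h.p₀_le_p₁ _) two_pos.le
  p₁_le_one := hp
  ρ_nonneg k := h.ρ_nonneg _
  ρ_le_one k := h.ρ_le_one _
  p₀_large := (h.p₀_large.comp_tendsto hφ.tendsto_atTop).const_mul_right two_ne_zero
  p₁_small := (h.p₁_small.comp_tendsto hφ.tendsto_atTop).const_mul_left 2
  ρ_large := h.ρ_large.comp_tendsto hφ.tendsto_atTop
  ρ_small := h.ρ_small.comp_tendsto hφ.tendsto_atTop
  snr_small := by
    refine IsBigO.trans_isLittleO ?_ (h.snr_small.comp_tendsto hφ.tendsto_atTop)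
    refine IsBigO.of_bound 4 ?_
    filter_upwards [hφ.tendsto_atTop.eventually h.eventually_p₀, hφ.tendsto_atTop.eventually
      (h.tendsto_p₁.eventually_le_const (show (0 : ℝ) < 1 / 4 by norm_num))] with k h0 h4
    have h1 := snr_two_mul_sq_le h0.1 ((h.p₀_le_p₁ _).trans h4) (p₁ (φ k))
    have hnn : 0 ≤ ρ (φ k) ^ 2 * (φ k : ℝ) := by positivity
    rw [Real.norm_of_nonneg (by positivity)]
    refine le_trans ?_ (mul_le_mul_of_nonneg_left (le_abs_self _) four_pos.le)
    have := mul_le_mul_of_nonneg_right h1 hnn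
    simp only [Function.comp]
    linarith

/-- Degree of the polynomials used for the lower bound. -/
def lowDegree (p₀ p₁ : ℝ) (n : ℕ) : ℕ := ⌊timeExponent p₀ p₁ n⌋₊

lemma timeExponent_nonneg (p₀ p₁ : ℝ) (n : ℕ) : 0 ≤ timeExponent p₀ p₁ n := by
  rw [timeExponent]; positivity

/-- The degree makes `λ²D ≤ (log n)⁻⁴`, small enough even after the factor four from doubling, which
also turns `55` into `220`. The summand `2` is absorbed by `e^y + 2 ≤ 3e^y ≤ e^{y+2}`. -/
lemma Regime.eventually_lowDegreeSum_le (h : Regime (fun n => n) p₀ p₁ ρ) :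
    ∀ᶠ n in atTop, lowDegreeSum (2 * p₀ n) (plantedLaw (2 * p₀ n) (2 * p₁ n) (ρ n) n)
      (lowDegree (p₀ n) (p₁ n) n) ≤ Real.exp (advExponent (p₀ n) (p₁ n) (ρ n) n) := by
  filter_upwards [h.eventually_p₀,
    h.tendsto_p₁.eventually_le_const (show (0 : ℝ) < 1 / 4 by norm_num),
    h.tendsto_ρ_mul_sqrt.eventually_ge_atTop 1, tendsto_log_natCast.eventually_ge_atTop 10,
    eventually_gt_atTop 0] with n h0 h4 hg hlog hn
  have hn' : (0 : ℝ) < n := Nat.cast_pos.2 hn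
  have hr0 : 0 < ρ n := by
    rcases (h.ρ_nonneg n).eq_or_lt with h0 | h0
    · rw [← h0] at hg; norm_num at hg
    · exact h0
  have hsnr := snr_two_mul_sq_le h0.1 ((h.p₀_le_p₁ n).trans h4) (p₁ n)
  set l := snr (p₀ n) (p₁ n)
  have hD : (lowDegree (p₀ n) (p₁ n) n : ℝ) ≤ timeExponent (p₀ n) (p₁ n) n :=
    Nat.floor_le (timeExponent_nonneg _ _ _)
  have hlog4 : (10000 : ℝ) ≤ Real.log n ^ 4 := by
    calc (10000 : ℝ) = 10 ^ 4 := by norm_num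
      _ ≤ _ := by gcongr
  have hlD : l ^ 2 * lowDegree (p₀ n) (p₁ n) n ≤ 1 / 10000 := by
    calc l ^ 2 * lowDegree (p₀ n) (p₁ n) n ≤ l ^ 2 * ((l ^ 2)⁻¹ * (Real.log n ^ 4)⁻¹) := by
          gcongr; exact hD
      _ = (l ^ 2 * (l ^ 2)⁻¹) * (Real.log n ^ 4)⁻¹ := by ring
      _ ≤ 1 * (Real.log n ^ 4)⁻¹ := by
          gcongr
          exact mul_inv_le_one
      _ ≤ 1 / 10000 := by
          rw [one_mul, one_div]
          gcongr
  have hμ : 0 < (n : ℝ) * ρ n ^ 2 := by positivity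
  have hD' : (0 : ℝ) ≤ lowDegree (p₀ n) (p₁ n) n := Nat.cast_nonneg _
  refine (lowDegreeSum_plantedLaw_le (h.ρ_nonneg n) (h.ρ_le_one n) hμ ?_).trans ?_
  · have := mul_le_mul_of_nonneg_right hsnr hD'
    linarith
  · have h1 := mul_le_mul_of_nonneg_right hsnr (sq_nonneg ((n : ℝ) * ρ n ^ 2))
    set y := 220 * (l ^ 2 * (n * ρ n ^ 2) ^ 2) with hy
    have hy0 : 0 ≤ y := by positivity
    have h2 : Real.exp (55 * (snr (2 * p₀ n) (2 * p₁ n) ^ 2 * (n * ρ n ^ 2) ^ 2)) ≤ Real.exp y :=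
      Real.exp_le_exp.2 (by linarith)
    have h3 : 1 ≤ Real.exp y := Real.one_le_exp hy0
    have h4 : (3 : ℝ) ≤ Real.exp 2 := by linarith [Real.add_one_le_exp (2 : ℝ)]
    rw [advExponent, ← hy, Real.exp_add]
    nlinarith

lemma sampleCount_le {c p₀ p₁ ρ : ℝ} {n : ℕ} :
    (sampleCount c p₀ p₁ ρ n : ℝ) ≤ Real.exp (advExponent p₀ p₁ ρ n) * (n + 1) := by
  have hL : 0 ≤ advExponent p₀ p₁ ρ n := by rw [advExponent]; positivity
  have h1 : (sampleCount c p₀ p₁ ρ n : ℝ) < Real.exp (advExponent p₀ p₁ ρ n) *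
      min (n : ℝ) (Real.exp (scanExponent c (snr p₀ p₁) ρ n / 2)) + 1 :=
    Nat.ceil_lt_add_one (by positivity)
  have h2 := mul_le_mul_of_nonneg_left (min_le_left (n : ℝ)
    (Real.exp (scanExponent c (snr p₀ p₁) ρ n / 2))) (Real.exp_pos (advExponent p₀ p₁ ρ n)).le
  have h3 := Real.one_le_exp hL
  linarith

/-- The minimum in the number of samples diverges because `F → ∞`; however slowly, this suffices for
an advantage of `1 + o(1)`. -/
lemma tendsto_exp_div_sampleCount (h : Regime (fun n => n) p₀ p₁ ρ) {c : ℝ} (hc : 0 < c)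
    (hJ : Tendsto (fun n : ℕ => snr (p₀ n) (p₁ n) * (n * ρ n)) atTop atTop) :
    Tendsto (fun n : ℕ => Real.exp (advExponent (p₀ n) (p₁ n) (ρ n) n) /
      sampleCount c (p₀ n) (p₁ n) (ρ n) n) atTop (𝓝 0) := by
  have hω : Tendsto (fun n : ℕ => min (n : ℝ)
      (Real.exp (scanExponent c (snr (p₀ n) (p₁ n)) (ρ n) n / 2))) atTop atTop := by
    refine tendsto_atTop.2 fun K => ?_
    have h2 := Real.tendsto_exp_atTop.comp
      ((tendsto_scanExponent h hc hJ).atTop_div_const two_pos)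
    filter_upwards [tendsto_natCast_atTop_atTop.eventually_ge_atTop K, h2.eventually_ge_atTop K]
      with n h1 h2 using le_min h1 h2
  refine squeeze_zero' (Eventually.of_forall fun n => by positivity) ?_ hω.inv_tendsto_atTop
  filter_upwards [eventually_gt_atTop 0] with n hn
  have hn' : (0 : ℝ) < n := Nat.cast_pos.2 hn
  have hM : (0 : ℝ) < sampleCount c (p₀ n) (p₁ n) (ρ n) n := Nat.cast_pos.2 (sampleCount_pos hn)
  have hle : Real.exp (advExponent (p₀ n) (p₁ n) (ρ n) n) * min (n : ℝ)
      (Real.exp (scanExponent c (snr (p₀ n) (p₁ n)) (ρ n) n / 2)) ≤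
      sampleCount c (p₀ n) (p₁ n) (ρ n) n := Nat.le_ceil _
  have hmin : 0 < min (n : ℝ) (Real.exp (scanExponent c (snr (p₀ n) (p₁ n)) (ρ n) n / 2)) :=
    lt_min hn' (Real.exp_pos _)
  rw [div_le_iff₀ hM, Pi.inv_apply, ← div_eq_inv_mul, le_div_iff₀ hmin]
  exact hle

/-- The power `n⁹` covers the polynomial overhead of one test (`n⁶`) and the factor `2(n + 1)`
(`n³`). -/
lemma program_time_le {M T n : ℕ} {L y : ℝ} (hn : 400 ≤ n) (hM1 : 1 ≤ M) (hy : 0 ≤ y)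
    (hM : (M : ℝ) ≤ Real.exp L * (n + 1)) (hT : (T : ℝ) ≤ Real.exp y) :
    ((M * (T + 302 * (n ^ 4 + 1) + 8) + 3 : ℕ) : ℝ) ≤ Real.exp (L + 9 * Real.log n + y) := by
  have hn' : (400 : ℝ) ≤ n := by exact_mod_cast hn
  have hn0 : (0 : ℝ) < n := by linarith
  have hM1' : (1 : ℝ) ≤ M := by exact_mod_cast hM1
  have hy1 := Real.one_le_exp hy
  have hpoly : 302 * ((n : ℝ) ^ 4 + 1) + 11 ≤ (n : ℝ) ^ 6 := by
    have h4 : (1 : ℝ) ≤ (n : ℝ) ^ 4 := one_le_pow₀ (by linarith)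
    have h2 : (160000 : ℝ) ≤ (n : ℝ) ^ 2 := by nlinarith
    have : (n : ℝ) ^ 6 = (n : ℝ) ^ 4 * (n : ℝ) ^ 2 := by ring
    nlinarith
  have h6 : (1 : ℝ) ≤ (n : ℝ) ^ 6 := one_le_pow₀ (by linarith)
  have hnlog : Real.exp (9 * Real.log n) = (n : ℝ) ^ 9 := by
    rw [show (9 : ℝ) * Real.log n = ((9 : ℕ) : ℝ) * Real.log n by norm_num, Real.exp_nat_mul,
      Real.exp_log hn0]
  have hcube : 2 * ((n : ℝ) + 1) ≤ (n : ℝ) ^ 3 := by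
    have h2 : (160000 : ℝ) ≤ (n : ℝ) ^ 2 := by nlinarith
    have h3 : (n : ℝ) ^ 3 = n * (n : ℝ) ^ 2 := by ring
    nlinarith
  push_cast
  calc (M : ℝ) * (T + 302 * ((n : ℝ) ^ 4 + 1) + 8) + 3
      ≤ M * (T + (302 * ((n : ℝ) ^ 4 + 1) + 11)) := by linarith
    _ ≤ M * (Real.exp y + (n : ℝ) ^ 6) := by gcongr
    _ ≤ M * (2 * (Real.exp y * (n : ℝ) ^ 6)) := by
        gcongr
        nlinarith
    _ ≤ (Real.exp L * (n + 1)) * (2 * (Real.exp y * (n : ℝ) ^ 6)) := by gcongr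
    _ = Real.exp L * (n : ℝ) ^ 6 * Real.exp y * (2 * (n + 1)) := by ring
    _ ≤ Real.exp L * (n : ℝ) ^ 6 * Real.exp y * (n : ℝ) ^ 3 := by gcongr
    _ = Real.exp (L + 9 * Real.log n + y) := by
        rw [Real.exp_add, Real.exp_add, hnlog]; ring

lemma Regime.tendsto_timeExponent (h : Regime (fun n => n) p₀ p₁ ρ)
    (hJ : Tendsto (fun n : ℕ => snr (p₀ n) (p₁ n) * (n * ρ n)) atTop atTop) :
    Tendsto (fun n : ℕ => timeExponent (p₀ n) (p₁ n) n) atTop atTop := by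
  refine tendsto_atTop_mono' _ ?_ tendsto_log_natCast
  filter_upwards [h.tendsto_log_div.eventually_le_const one_pos, hJ.eventually_ge_atTop 1,
    tendsto_log_natCast.eventually_ge_atTop 1] with n h1 h2 hlog
  have hl : snr (p₀ n) (p₁ n) ≠ 0 := by
    rintro h0
    rw [h0] at h2; norm_num at h2
  have : 0 < timeExponent (p₀ n) (p₁ n) n := by rw [timeExponent]; positivity
  rwa [div_le_one this] at h1

end Sequences

/-- A test that does nothing. -/
def Test.trivial (ι : Type) : Test ι := ⟨⟨0, Fin.elim0⟩, 0⟩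

end PlantedDenseSubgraph

end

/-! ### Contradiction with the low-degree heuristic -/

open PlantedDenseSubgraph in
theorem mainTheorem3 (p₀ p₁ ρ : ℕ → ℝ) (hreg : Regime (fun n => n) p₀ p₁ ρ)
    (hLD : HiddenSampleHeuristic)
    (A : ∀ n, Estimator n) (hA : WeakRecovery p₀ p₁ ρ A) :
    ∃ c : ℝ, 0 < c ∧ ∀ᶠ n : ℕ in atTop,
      Real.exp (c * ((snr (p₀ n) (p₁ n) ^ 2)⁻¹ * (Real.log n ^ 4)⁻¹)) ≤ ((A n).prog.time : ℝ) := by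
  have hJ := hA.tendsto_snr_mul hreg
  obtain ⟨c, hc, hcorr⟩ := hA
  by_contra hcon
  push Not at hcon
  -- Failure of the bound for every constant, used with `1/(k+1)`, gives a subsequence along which
  -- the running time is `exp` of a vanishing fraction of the time exponent. The condition on `p₁`
  -- keeps the doubled densities in `[0,1]`.
  have hfreq : ∀ k : ℕ, ∃ᶠ n : ℕ in atTop, ((A n).prog.time : ℝ) <
      Real.exp (1 / ((k : ℝ) + 1) * timeExponent (p₀ n) (p₁ n) n) ∧ 2 * p₁ n ≤ 1 := by
    intro k
    refine (hcon (1 / ((k : ℝ) + 1)) (by positivity)).and_eventually ?_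
    filter_upwards [hreg.tendsto_p₁.eventually_le_const (show (0 : ℝ) < 1 / 2 by norm_num)]
      with n hn
    linarith
  obtain ⟨φ, hφ, hP⟩ := extraction_forall_of_frequently hfreq
  have hφt := hφ.tendsto_atTop
  set M : ℕ → ℕ := fun n => sampleCount c (p₀ n) (p₁ n) (ρ n) n with hM
  set L : ℕ → ℝ := fun n => advExponent (p₀ n) (p₁ n) (ρ n) n with hL
  have hratio : Tendsto (fun k => Real.exp (L (φ k)) / (M (φ k) : ℝ)) atTop (𝓝 0) :=
    (tendsto_exp_div_sampleCount hreg hc hJ).comp hφt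
  have hn0 : ∀ᶠ k in atTop, 4 ≤ φ k := hφt.eventually_ge_atTop 4
  have hlow := hφt.eventually hreg.eventually_lowDegreeSum_le
  have hp0 := hφt.eventually hreg.eventually_p₀
  have hp4 := hφt.eventually
    (hreg.tendsto_p₁.eventually_le_const (show (0 : ℝ) < 1 / 4 by norm_num))
  have hheur := hLD φ (fun k => M (φ k)) (fun k => lowDegree (p₀ (φ k)) (p₁ (φ k)) (φ k))
    (fun k => 2 * p₀ (φ k)) (fun k => 2 * p₁ (φ k)) (fun k => ρ (φ k))
    (fun k => Real.exp (L (φ k))) (hreg.two_mul_comp hφ fun k => (hP k).2)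
    (fun k => Real.one_lt_exp_iff.2 (by simp only [hL, advExponent]; positivity))
    (by
      filter_upwards [hlow, hp0, hp4] with k hk h0 h4
      have hle := hreg.p₀_le_p₁ (φ k)
      exact (adv_sq_le (by linarith [h0.1]) (by linarith) _ _).trans (ENNReal.ofReal_le_ofReal hk))
    (by
      refine (isLittleO_iff_tendsto' ?_).2 hratio
      filter_upwards [hn0] with k hk h0
      exact absurd (Nat.cast_eq_zero.1 h0) (sampleCount_pos (by omega)).ne')
    (by
      filter_upwards [hn0] with k hk
      refine sampleCount_le.trans ?_
      rw [mul_comm]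
      exact mul_le_mul_of_nonneg_right (succ_le_card_edge hk) (Real.exp_pos _).le)
  have hadv : Tendsto (fun k => adv
      (hiddenPlanted (M (φ k)) (plantedLaw (2 * p₀ (φ k)) (2 * p₁ (φ k)) (ρ (φ k)) (φ k))
        (nullLaw (2 * p₀ (φ k)) (φ k)))
      (hiddenNull (M (φ k)) (nullLaw (2 * p₀ (φ k)) (φ k)))
      (lowDegree (p₀ (φ k)) (p₁ (φ k)) (φ k))) atTop (𝓝 1) := by
    have hup : Tendsto (fun k => ENNReal.ofReal (1 + Real.exp (L (φ k)) / (M (φ k) : ℝ))) atTop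
        (𝓝 1) := by
      have := ENNReal.tendsto_ofReal (hratio.const_add 1)
      simpa using this
    have hboth : ∀ᶠ k in atTop, 1 ≤ adv
        (hiddenPlanted (M (φ k)) (plantedLaw (2 * p₀ (φ k)) (2 * p₁ (φ k)) (ρ (φ k)) (φ k))
          (nullLaw (2 * p₀ (φ k)) (φ k)))
        (hiddenNull (M (φ k)) (nullLaw (2 * p₀ (φ k)) (φ k)))
        (lowDegree (p₀ (φ k)) (p₁ (φ k)) (φ k)) ∧ adv
        (hiddenPlanted (M (φ k)) (plantedLaw (2 * p₀ (φ k)) (2 * p₁ (φ k)) (ρ (φ k)) (φ k))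
          (nullLaw (2 * p₀ (φ k)) (φ k)))
        (hiddenNull (M (φ k)) (nullLaw (2 * p₀ (φ k)) (φ k)))
        (lowDegree (p₀ (φ k)) (p₁ (φ k)) (φ k)) ≤
          ENNReal.ofReal (1 + Real.exp (L (φ k)) / (M (φ k) : ℝ)) := by
      filter_upwards [hlow, hp0, hp4, hn0] with k hk h0 h4 hn
      have hle := hreg.p₀_le_p₁ (φ k)
      have hMpos : 0 < M (φ k) := sampleCount_pos (by omega)
      have q0 : 0 < 2 * p₀ (φ k) := by linarith [h0.1]
      have q1 : 2 * p₀ (φ k) < 1 := by linarith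
      have hPl : IsLaw (plantedLaw (2 * p₀ (φ k)) (2 * p₁ (φ k)) (ρ (φ k)) (φ k)) :=
        isLaw_plantedLaw q0.le (by linarith) (by linarith) (hreg.ρ_nonneg _) (hreg.ρ_le_one _)
      have hNl : IsLaw (prodBern fun _ : Edge (φ k) => 2 * p₀ (φ k)) :=
        isLaw_prodBern (fun _ => q0.le) fun _ => q1.le
      rw [nullLaw, hiddenNull_prodBern]
      have h1 := one_le_adv (isLaw_hiddenPlanted hMpos hPl hNl)
        (isLaw_prodBern (fun _ : Fin (M (φ k)) × Edge (φ k) => q0.le) fun _ => q1.le)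
        (lowDegree (p₀ (φ k)) (p₁ (φ k)) (φ k))
      refine ⟨h1, (le_self_pow₀ h1 two_ne_zero).trans ((adv_sq_le q0 q1 _ _).trans
        (ENNReal.ofReal_le_ofReal ((lowDegreeSum_hiddenPlanted_le hMpos q0 q1 hPl _).trans ?_)))⟩
      gcongr
    exact tendsto_of_tendsto_of_tendsto_of_le_of_le' tendsto_const_nhds hup
      (hboth.mono fun _ h => h.1) (hboth.mono fun _ h => h.2)
  obtain ⟨C, hC, hno⟩ := hheur.2 hadv
  -- The logarithm of the total running time, divided by the time exponent: advantage exponent,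
  -- polynomial overhead, estimator.
  have hsmall : Tendsto (fun k : ℕ => L (φ k) / timeExponent (p₀ (φ k)) (p₁ (φ k)) (φ k) +
      9 * (Real.log (φ k) / timeExponent (p₀ (φ k)) (p₁ (φ k)) (φ k)) + 1 / ((k : ℝ) + 1))
      atTop (𝓝 0) := by
    have h1 := hreg.tendsto_advExponent_div.comp hφt
    have h2 := (hreg.tendsto_log_div.comp hφt).const_mul 9
    simpa using (h1.add h2).add tendsto_one_div_add_atTop_nhds_zero_nat
  have htest : ∀ᶠ k in atTop, ∃ B : Test (Fin (M (φ k)) × Edge (φ k)),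
      (B.prog.time : ℝ) ≤ timeBound (Fintype.card (Fin (M (φ k)) × Edge (φ k)))
        (lowDegree (p₀ (φ k)) (p₁ (φ k)) (φ k)) C ∧
      B.error (hiddenPlanted (M (φ k)) (plantedLaw (2 * p₀ (φ k)) (2 * p₁ (φ k)) (ρ (φ k)) (φ k))
          (nullLaw (2 * p₀ (φ k)) (φ k)))
        (hiddenNull (M (φ k)) (nullLaw (2 * p₀ (φ k)) (φ k))) ≤ 1 - c / 16 := by
    filter_upwards [hφt.eventually (eventually_exists_hidden_test hreg hc hcorr hJ),
      hφt.eventually_ge_atTop 400, hsmall.eventually_le_const (show 0 < 1 / (2 * C) by positivity),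
      (hreg.tendsto_timeExponent hJ).comp hφt |>.eventually_ge_atTop 2] with k hB hn hs hx
    obtain ⟨B, hBt, hBe⟩ := hB
    refine ⟨B, ?_, hBe⟩
    have hMpos : 0 < M (φ k) := sampleCount_pos (by omega)
    have hcard : 2 ≤ Fintype.card (Fin (M (φ k)) × Edge (φ k)) := by
      rw [Fintype.card_prod, Fintype.card_fin]
      have h1 : (2 : ℝ) ≤ Fintype.card (Edge (φ k)) := by
        have h2 := succ_le_card_edge (n := φ k) (by omega)
        have h3 : (400 : ℝ) ≤ φ k := by exact_mod_cast hn
        linarith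
      have h4 : 2 ≤ Fintype.card (Edge (φ k)) := by exact_mod_cast h1
      exact h4.trans (Nat.le_mul_of_pos_left _ hMpos)
    rw [timeBound_eq hcard]
    simp only [Function.comp] at hx
    set x := timeExponent (p₀ (φ k)) (p₁ (φ k)) (φ k) with hxd
    have hx0 : 0 < x := by linarith
    have hy : 0 ≤ 1 / ((k : ℝ) + 1) * x := by positivity
    have htime : (B.prog.time : ℝ) ≤
        ((M (φ k) * ((A (φ k)).prog.time + 302 * ((φ k) ^ 4 + 1) + 8) + 3 : ℕ) : ℝ) := by
      exact_mod_cast hBt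
    refine htime.trans ((program_time_le hn hMpos hy sampleCount_le (hP k).1.le).trans
      (Real.exp_le_exp.2 ?_))
    -- For `x ≥ 2` the degree exceeds `x - 1 ≥ x/2`, so a total exponent of at most `x/(2C)` fits
    -- into the budget `D/C`.
    have hfloor : x - 1 < lowDegree (p₀ (φ k)) (p₁ (φ k)) (φ k) := Nat.sub_one_lt_floor _
    have hle := mul_le_mul_of_nonneg_right hs hx0.le
    have e1 : (L (φ k) / x + 9 * (Real.log (φ k) / x) + 1 / ((k : ℝ) + 1)) * x =
        L (φ k) + 9 * Real.log (φ k) + 1 / ((k : ℝ) + 1) * x := by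
      field_simp
    rw [e1] at hle
    refine hle.trans ?_
    rw [one_div_mul_eq_div, div_le_div_iff₀ (by positivity) hC]
    nlinarith
  classical
  -- The heuristic demands the time bound for every `k`; at the finitely many exceptional indices
  -- the empty program, of time zero, is used.
  refine hno ⟨fun k => if h : ∃ B : Test (Fin (M (φ k)) × Edge (φ k)),
      (B.prog.time : ℝ) ≤ timeBound (Fintype.card (Fin (M (φ k)) × Edge (φ k)))
        (lowDegree (p₀ (φ k)) (p₁ (φ k)) (φ k)) C ∧
      B.error (hiddenPlanted (M (φ k)) (plantedLaw (2 * p₀ (φ k)) (2 * p₁ (φ k)) (ρ (φ k)) (φ k))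
          (nullLaw (2 * p₀ (φ k)) (φ k)))
        (hiddenNull (M (φ k)) (nullLaw (2 * p₀ (φ k)) (φ k))) ≤ 1 - c / 16
    then h.choose else Test.trivial _, fun k => ?_, c / 16, by positivity, ?_⟩
  · dsimp only
    split_ifs with h
    · exact h.choose_spec.1
    · simp only [Test.trivial, Nat.cast_zero]
      exact Real.rpow_nonneg (Nat.cast_nonneg _) _
  · filter_upwards [htest] with k h
    rw [dif_pos h]
    exact h.choose_spec.2
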